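/- **Setting.** $\kappa$ is the security parameter; all algorithms and adversaries are probabilistic polynomial-time (PPT), and adversaries may query oracles. Write $\varepsilon\le\mathrm{negl}(\kappa)$ if for every nonzero polynomial $p$ with coefficients in $\mathbb N$ there is $\kappa_0$ with $\varepsilon(\kappa)<1/p(\kappa)$ for all $\kappa\ge\kappa_0$. $\bot$ is an error symbol. A *designated verifier signature (DVS) scheme* $\Pi$ consists of PPT algorithms $\mathsf{Setup}(1^\kappa)\to\mathsf{params}$, and, with $1^\kappa$ and $\mathsf{params}$ as implicit inputs, $\mathsf{KeyGen}\to(\mathsf{pk},\mathsf{sk})$, $\mathsf{Sign}_{S\to V}(m)=\mathsf{Sign}(\mathsf{sk}_S,\mathsf{pk}_S,\mathsf{pk}_V,m)$, $\mathsf{Verify}_{S\to V}(m,\sigma)=\mathsf{Verify}(\mathsf{sk}_V,\mathsf{pk}_V,\mathsf{pk}_S,m,\sigma)$, $\mathsf{Simulate}_{S\to V}(m)=\mathsf{Simulate}(\mathsf{sk}_V,\mathsf{pk}_V,\mathsf{pk}_S,m)$, where, for valid keys (possible outputs of $\mathsf{KeyGen}$), $\mathsf{Sign}$ never outputs $\bot$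 and $\mathsf{Verify}$ outputs $0$ or $1$. The scheme is *correct* if for all valid keys of $S$ and $V$ (for the same $\mathsf{params}$) and all $m$, every possible output $\sigma$ of $\mathsf{Sign}_{S\to V}(m)$ or of $\mathsf{Simulate}_{S\to V}(m)$ satisfies $\mathsf{Verify}_{S\to V}(m,\sigma)=1$ with probability $1$. Let $n\ge 1$, with parties $P_0,\dots,P_n$. The *standard $n$-sender oracles* $\mathcal O$ are - $\mathcal O_{sign}^{(1)}=\mathcal O_{sign}^{(2)}$: on $(m,s,v)$ return $\mathsf{Sign}_{P_s\to P_v}(m)$ if $s,v\in\{0,\dots,n\}$, else $\bot$; - $\mathcal O_{sim}^{(1)}=\mathcal O_{sim}^{(2)}$: on $(m,s,v)$ return $\mathsf{Simulate}_{P_s\to P_v}(m)$ if $s,v\in\{0,\dots,n\}$, else $\bot$; - $\mathcal O_{veri}^{(1)}$: on $(m,\sigma,s,v)$ return $\mathsf{Verify}_{P_s\to P_v}(m,\sigma)$ if $s,v\in\{0,\dots,n\}$, else $\bot$; - $\mathcal O_{veri}^{(2)}$: the same, but also return $\bot$ if $\sigma=\sigma^*$, the challenge below. Let $\mathcal O'$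 be $\mathcal O$ without the verification oracles (verification queries are answered by $\bot$). *Sender privacy.* For $c\in\{0,1\}$, in $\mathsf{G}^{\mathrm{PSI}}_{\mathcal A,\mathcal Q}(\kappa,n,c)$ one samples $\mathsf{params}\leftarrow\mathsf{Setup}$ and independent key pairs of $P_0,\dots,P_n$ from $\mathsf{KeyGen}$; the adversary $\mathcal A$, given $1^\kappa$, $\mathsf{params}$ and all public keys, with access to the phase-1 oracles of $\mathcal Q$, outputs $(m^*,\mathsf{state})$; then $\sigma^*\leftarrow\mathsf{Sign}_{P_c\to P_n}(m^*)$; finally $\mathcal A$, given $1^\kappa$, $\mathsf{state}$, $\sigma^*$, with access to the phase-2 oracles of $\mathcal Q$, outputs $c'$, the output of the game. $\Pi$ is *$n$-party sender private with respect to $\mathcal Q$* if for every PPT $\mathcal A$, $\Pr_{c\leftarrow\{0,1\}}[\mathsf{G}^{\mathrm{PSI}}_{\mathcal A,\mathcal Q}(\kappa,n,c)=c]-\tfrac12\le\mathrm{negl}(\kappa)$, and *$n$-party sender private* if this holds with respect to $\mathcal O$. *Strong unforgeability.* In the game, parameters and keys are sampled as above; the adversary $\mathcal B$, given $1^\kappa$,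 $\mathsf{params}$ and all public keys, with access to $\mathcal O_{sign}^{(1)},\mathcal O_{sim}^{(1)},\mathcal O_{veri}^{(1)}$, outputs $(m^*,\sigma^*,s,v)$. It wins if $s,v\in\{0,\dots,n\}$, $\mathsf{Verify}_{P_s\to P_v}(m^*,\sigma^*)=1$, and $\sigma^*$ was not returned by the signing or the simulation oracle to a query $(m^*,s,v)$. $\Pi$ is *$n$-party strongly unforgeable* if every PPT $\mathcal B$ wins with probability $\le\mathrm{negl}(\kappa)$. **Theorem.** Let $n\ge1$. Every correct DVS scheme that is $n$-party sender private with respect to $\mathcal O'$ and $n$-party strongly unforgeable is $n$-party sender private (with respect to $\mathcal O$). -/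

import Mathlib

namespace DesignatedVerifier

/-! ### Finite data -/

/-- The finite objects that algorithms work on: binary trees with two atoms.  `nil` is the empty
object and `bot` is the reserved error symbol `⊥`.  Bit strings, numbers and tuples are embedded as
lists. -/
inductive Data : Type
  | nil : Data
  | bot : Data
  | cons : Data → Data → Data
  deriving DecidableEq

namespace Data

/-- Number of nodes. -/
def size : Data → ℕ
  | nil => 1
  | bot => 1
  | cons a b => a.size + b.size + 1

/-- First component of a pair (`nil` on atoms). -/
def fst : Data → Data
  | cons a _ => a
  | _ => nil

/-- Second component of a pair (`nil` on atoms). -/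
def snd : Data → Data
  | cons _ b => b
  | _ => nil

/-- Only pairs count as "true" in a test. -/
def isTrue : Data → Bool
  | cons _ _ => true
  | _ => false

/-- Unary numerals; `ofNat κ` is the string `1^κ`. -/
def ofNat : ℕ → Data
  | 0 => nil
  | k + 1 => cons nil (ofNat k)

/-- Partial inverse of `ofNat`. -/
def toNat? : Data → Option ℕ
  | nil => some 0
  | bot => none
  | cons nil d => (toNat? d).map (· + 1)
  | cons _ _ => none

/-- Bits, `0 = ofNat 0` and `1 = ofNat 1`. -/
def ofBool (b : Bool) : Data := if b then ofNat 1 else ofNat 0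

/-- Tuples. -/
def ofList : List Data → Data
  | [] => nil
  | a :: l => cons a (ofList l)

/-- The party `P_i`, `i ∈ {0, …, n}`, that a numeral names, if there is one. -/
def toParty? (n : ℕ) (d : Data) : Option (Fin (n + 1)) :=
  d.toNat?.bind fun i => if h : i < n + 1 then some ⟨i, h⟩ else none

end Data

/-! ### Probabilistic oracle machines with a running time

A machine is a program over registers `0, 1, 2, …` (finitely many of which occur in the program),
each of which holds a piece of data.  Every operation is charged the sizes of all data that it
reads or produces.  Hence the memory in use never exceeds input size plus elapsed time (up to a
constant factor), and the model agrees with probabilistic oracle Turing machines up to polynomial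
factors in the running time. -/

/-- Expressions over the registers. -/
inductive Expr : Type
  | reg : ℕ → Expr
  | const : Data → Expr
  | cons : Expr → Expr → Expr
  | fst : Expr → Expr
  | snd : Expr → Expr
  | eq : Expr → Expr → Expr

namespace Expr

/-- The value of an expression. -/
def val (r : ℕ → Data) : Expr → Data
  | reg x => r x
  | const d => d
  | cons e f => .cons (e.val r) (f.val r)
  | fst e => (e.val r).fst
  | snd e => (e.val r).snd
  | eq e f => Data.ofBool (decide (e.val r = f.val r))

/-- The time needed to evaluate an expression: the total size of the values of its
subexpressions. -/
def cost (r : ℕ → Data) : Expr → ℕ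
  | reg x => (r x).size
  | const d => d.size
  | cons e f => e.cost r + f.cost r + ((cons e f).val r).size
  | fst e => e.cost r + ((fst e).val r).size
  | snd e => e.cost r + ((snd e).val r).size
  | eq e f => e.cost r + f.cost r + ((eq e f).val r).size

end Expr

/-- Programs with oracles named by `ι`. -/
inductive Prog (ι : Type) : Type
  /-- `x := e` -/
  | assign : ℕ → Expr → Prog ι
  /-- `x :=` a fair coin -/
  | flip : ℕ → Prog ι
  /-- `x :=` the answer of oracle `o` to the query `e` -/
  | call : ι → ℕ → Expr → Prog ι
  | seq : Prog ι → Prog ι → Prog ι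
  | cond : Expr → Prog ι → Prog ι → Prog ι
  | loop : Expr → Prog ι → Prog ι

/-- The probabilistic, stateful answering behaviour of oracles named by `ι`: the internal state
and the query determine the joint law of the answer and of the next state. -/
abbrev Oracles (ι S : Type) : Type := ι → S → Data → PMF (Data × S)

/-- A configuration: registers, internal state of the oracles, time used so far. -/
structure Config (S : Type) : Type where
  regs : ℕ → Data
  orc : S
  time : ℕ

namespace Config

/-- Let `t` units of time pass. -/
def tick {S : Type} (c : Config S) (t : ℕ) : Config S := ⟨c.regs, c.orc, c.time + t⟩

/-- Write `d` to register `x`. -/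
def write {S : Type} (c : Config S) (x : ℕ) (d : Data) : Config S :=
  ⟨Function.update c.regs x d, c.orc, c.time⟩

/-- The initial configuration: the input is in register `0`, all other registers are empty. -/
def init {S : Type} (s : S) (x : Data) : Config S :=
  ⟨Function.update (fun _ => Data.nil) 0 x, s, 0⟩

end Config

noncomputable section

/-- A `while`-loop cut off (result `none`) after a given number of iterations. -/
def iterLoop {S : Type} (e : Expr) (body : Config S → PMF (Option (Config S))) :
    ℕ → Config S → PMF (Option (Config S))
  | 0, _ => PMF.pure none
  | k + 1, c =>
    if (e.val c.regs).isTrue then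
      (body (c.tick (1 + e.cost c.regs))).bind fun r =>
        match r with
        | none => PMF.pure none
        | some c' => iterLoop e body k c'
    else PMF.pure (some (c.tick (1 + e.cost c.regs)))

/-- The law of the final configuration of a program, where each loop is cut off (result `none`)
at `k` iterations. -/
def Prog.exec {ι S : Type} (O : Oracles ι S) (k : ℕ) :
    Prog ι → Config S → PMF (Option (Config S))
  | .assign x e, c =>
    PMF.pure (some ((c.tick (1 + e.cost c.regs)).write x (e.val c.regs)))
  | .flip x, c =>
    (PMF.uniformOfFintype Bool).bind fun b =>
      PMF.pure (some ((c.tick (1 + (Data.ofBool b).size)).write x (Data.ofBool b)))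
  | .call o x e, c =>
    (O o c.orc (e.val c.regs)).bind fun as =>
      PMF.pure (some (Config.write
        ⟨c.regs, as.2, c.time + (1 + e.cost c.regs + as.1.size)⟩ x as.1))
  | .seq p q, c =>
    (Prog.exec O k p c).bind fun r =>
      match r with
      | none => PMF.pure none
      | some c' => Prog.exec O k q c'
  | .cond e p q, c =>
    if (e.val c.regs).isTrue then Prog.exec O k p (c.tick (1 + e.cost c.regs))
    else Prog.exec O k q (c.tick (1 + e.cost c.regs))
  | .loop e p, c => iterLoop e (Prog.exec O k p) k c

/-- With probability one, the program halts on input `x`. -/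
def Prog.Halts {ι S : Type} (O : Oracles ι S) (p : Prog ι) (s : S) (x : Data) : Prop :=
  ∃ k, ∀ r ∈ (p.exec O k (Config.init s x)).support, ∃ c, r = some c

/-- With probability one, the program halts on input `x` within `t` units of time. -/
def Prog.HaltsIn {ι S : Type} (O : Oracles ι S) (p : Prog ι) (s : S) (x : Data) (t : ℕ) : Prop :=
  ∃ k, ∀ r ∈ (p.exec O k (Config.init s x)).support, ∃ c, r = some c ∧ c.time ≤ t

open Classical in
/-- The joint law of the output (register `0`) of a halting program and the final state of its
oracles.  The value for non-halting programs is irrelevant. -/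
def Prog.output {ι S : Type} (O : Oracles ι S) (p : Prog ι) (s : S) (x : Data) :
    PMF (Data × S) :=
  if h : p.Halts O s x then
    (p.exec O h.choose (Config.init s x)).map fun r =>
      match r with
      | none => (Data.nil, s)
      | some c => (c.regs 0, c.orc)
  else PMF.pure (Data.nil, s)

/-- Polynomial running time: for all oracles whose answers are of length polynomial (`ℓ`) in input
and query, the running time is at most a polynomial (`q`) in the input.  For programs without
oracles this is the usual notion. -/
def Prog.IsPolyTime {ι : Type} (p : Prog ι) : Prop :=
  ∀ l : Polynomial ℕ, ∃ q : Polynomial ℕ, ∀ (N : ℕ) (x : Data), x.size ≤ N →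
    ∀ (S : Type) (O : Oracles ι S) (s : S),
      (∀ o s' d, ∀ as ∈ (O o s' d).support, as.1.size ≤ l.eval (N + d.size)) →
      p.HaltsIn O s x (q.eval N)

/-- A probabilistic polynomial-time (oracle) algorithm. -/
structure PPT (ι : Type) : Type where
  prog : Prog ι
  polyTime : prog.IsPolyTime

/-- Run an algorithm with oracles, which start in state `s`. -/
def PPT.runWith {ι S : Type} (M : PPT ι) (O : Oracles ι S) (s : S) (x : Data) : PMF (Data × S) :=
  M.prog.output O s x

/-- Run an algorithm without oracles. -/
def PPT.run (M : PPT Empty) (x : List Data) : PMF Data :=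
  (M.runWith (S := Unit) (fun o => o.elim) () (Data.ofList x)).map Prod.fst

/-! ### Designated verifier signature schemes -/

/-- The five algorithms of a designated verifier signature scheme. -/
structure Algorithms : Type where
  setupAlg : PPT Empty
  keyGenAlg : PPT Empty
  signAlg : PPT Empty
  verifyAlg : PPT Empty
  simulateAlg : PPT Empty

/-- A key pair. -/
structure KeyPair : Type where
  pk : Data
  sk : Data

namespace Algorithms

variable (D : Algorithms) (κ : ℕ)

/-- `Setup(1^κ)` -/
def setup : PMF Data := D.setupAlg.run [.ofNat κ]

/-- `KeyGen(1^κ, params)` -/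
def keyGen (params : Data) : PMF KeyPair :=
  (D.keyGenAlg.run [.ofNat κ, params]).map fun d => ⟨d.fst, d.snd⟩

/-- `Sign(sk_S, pk_S, pk_V, m)` -/
def sign (params : Data) (S : KeyPair) (pkV m : Data) : PMF Data :=
  D.signAlg.run [.ofNat κ, params, S.sk, S.pk, pkV, m]

/-- `Verify(sk_V, pk_V, pk_S, m, σ)` -/
def verify (params : Data) (V : KeyPair) (pkS m sig : Data) : PMF Data :=
  D.verifyAlg.run [.ofNat κ, params, V.sk, V.pk, pkS, m, sig]

/-- `Simulate(sk_V, pk_V, pk_S, m)` -/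
def simulate (params : Data) (V : KeyPair) (pkS m : Data) : PMF Data :=
  D.simulateAlg.run [.ofNat κ, params, V.sk, V.pk, pkS, m]

/-- Valid keys: `K` is a possible output of `KeyGen` for the possible parameters `params`. -/
def Valid (params : Data) (K : KeyPair) : Prop :=
  params ∈ (D.setup κ).support ∧ K ∈ (D.keyGen κ params).support

end Algorithms

/-- A designated verifier signature scheme.  On valid keys `Sign` gives a signature and `Verify`
gives a bit (and not `⊥`); the behaviour on invalid keys is left open. -/
structure Scheme : Type extends Algorithms where
  sign_valid : ∀ (κ : ℕ) (params : Data) (S V : KeyPair),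
    toAlgorithms.Valid κ params S → toAlgorithms.Valid κ params V →
    ∀ m, ∀ sig ∈ (toAlgorithms.sign κ params S V.pk m).support, sig ≠ Data.bot
  verify_valid : ∀ (κ : ℕ) (params : Data) (S V : KeyPair),
    toAlgorithms.Valid κ params S → toAlgorithms.Valid κ params V →
    ∀ m sig, ∀ b ∈ (toAlgorithms.verify κ params V S.pk m sig).support,
      b = Data.ofNat 0 ∨ b = Data.ofNat 1

/-- Correctness: for valid keys, signatures and simulated signatures are accepted by the
designated verifier. -/
def Scheme.IsCorrect (D : Scheme) : Prop :=
  ∀ (κ : ℕ) (params : Data) (S V : KeyPair), D.Valid κ params S → D.Valid κ params V → ∀ m,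
    (∀ sig ∈ (D.sign κ params S V.pk m).support,
      D.verify κ params V S.pk m sig = PMF.pure (Data.ofNat 1)) ∧
    (∀ sig ∈ (D.simulate κ params V S.pk m).support,
      D.verify κ params V S.pk m sig = PMF.pure (Data.ofNat 1))

/-- `k` independent samples. -/
def iid {α : Type} (p : PMF α) : (k : ℕ) → PMF (Fin k → α)
  | 0 => PMF.pure Fin.elim0
  | k + 1 => p.bind fun a => (iid p k).bind fun f => PMF.pure (Fin.cons a f)

/-- `ε ≤ negl`: for every (nonzero) polynomial `p`, eventually `ε(κ) < 1 / p(κ)`. -/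
def IsNegligible (ε : ℕ → ℝ) : Prop :=
  ∀ p : Polynomial ℕ, p ≠ 0 → ∃ κ₀, ∀ κ ≥ κ₀, ε κ < 1 / ((p.eval κ : ℕ) : ℝ)

/-! ### Oracles -/

/-- The names of the oracles. -/
inductive OracleName : Type
  | sign
  | sim
  | veri

/-- The tuple `(m, σ, s, v)`: a message, a signature, a sender `P_s`, and a verifier `P_v`. -/
structure Signed (n : ℕ) : Type where
  m : Data
  sig : Data
  s : Fin (n + 1)
  v : Fin (n + 1)
  deriving DecidableEq

/-- The state of the oracles: the list of all tuples `(m_i, σ_i, s_i, v_i)` such that `σ_i` was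
returned to a signing or simulation query `(m_i, s_i, v_i)`. -/
abbrev Log (n : ℕ) : Type := List (Signed n)

namespace Scheme

variable (D : Scheme) (κ : ℕ) {n : ℕ} (params : Data) (K : Fin (n + 1) → KeyPair)

/-- `O_sign`: on `(m, s, v)` returns `Sign_{P_s → P_v}(m)` if `s, v ∈ {0, …, n}`, and `⊥`
otherwise. -/
def signOracle (log : Log n) : Data → PMF (Data × Log n)
  | .cons m (.cons s v) =>
    match s.toParty? n, v.toParty? n with
    | some s, some v =>
      (D.sign κ params (K s) (K v).pk m).map fun sig => (sig, ⟨m, sig, s, v⟩ :: log)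
    | _, _ => PMF.pure (.bot, log)
  | _ => PMF.pure (.bot, log)

/-- `O_sim`: on `(m, s, v)` returns `Simulate_{P_s → P_v}(m)` if `s, v ∈ {0, …, n}`, and `⊥`
otherwise. -/
def simOracle (log : Log n) : Data → PMF (Data × Log n)
  | .cons m (.cons s v) =>
    match s.toParty? n, v.toParty? n with
    | some s, some v =>
      (D.simulate κ params (K v) (K s).pk m).map fun sig => (sig, ⟨m, sig, s, v⟩ :: log)
    | _, _ => PMF.pure (.bot, log)
  | _ => PMF.pure (.bot, log)

/-- `O_veri`: on `(m, σ, s, v)` returns `Verify_{P_s → P_v}(m, σ)` if `s, v ∈ {0, …, n}` and `σ` is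
not the challenge (if a challenge has been issued), and `⊥` otherwise. -/
def veriOracle (challenge : Option Data) (log : Log n) : Data → PMF (Data × Log n)
  | .cons m (.cons sig (.cons s v)) =>
    match s.toParty? n, v.toParty? n with
    | some s, some v =>
      if some sig = challenge then PMF.pure (.bot, log)
      else (D.verify κ params (K v) (K s).pk m sig).map fun b => (b, log)
    | _, _ => PMF.pure (.bot, log)
  | _ => PMF.pure (.bot, log)

/-- The standard `n`-sender oracles: those of the first phase for `challenge = none`, those of the
second phase for `challenge = some σ*`. -/
def stdOracles (challenge : Option Data) : Oracles OracleName (Log n)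
  | .sign => D.signOracle κ params K
  | .sim => D.simOracle κ params K
  | .veri => D.veriOracle κ params K challenge

/-- The standard `n`-sender oracles without the verification oracles: every verification query is
answered by `⊥`. -/
def stdOraclesNoVeri (_challenge : Option Data) : Oracles OracleName (Log n)
  | .sign => D.signOracle κ params K
  | .sim => D.simOracle κ params K
  | .veri => fun log _ => PMF.pure (.bot, log)

end Scheme

/-- An oracle family for the sender-privacy game: depending on the scheme, the security parameter,
the public parameters, and the key pairs, it provides the oracles of the first phase (`none`) and
those of the second phase (`some σ*`). -/
abbrev OracleFamily : Type :=
  Scheme → ℕ → {n : ℕ} → Data → (Fin (n + 1) → KeyPair) → Option Data →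
    Oracles OracleName (Log n)

/-! ### Sender privacy -/

/-- A two-phase adversary for sender privacy. -/
structure PrivacyAdversary : Type where
  phase1 : PPT OracleName
  phase2 : PPT OracleName

/-- The public keys `pk_{P_0}, …, pk_{P_n}`. -/
def pubKeys {n : ℕ} (K : Fin (n + 1) → KeyPair) : List Data := List.ofFn fun i => (K i).pk

/-- The sender-privacy game with challenge sender `P_c` and challenge verifier `P_n`.  The output
`(m*, state)` of the first phase is a pair; the result is the output of the second phase. -/
def psiGame (D : Scheme) (A : PrivacyAdversary) (O : OracleFamily) (κ n : ℕ) (c : Fin (n + 1)) :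
    PMF Data :=
  (D.setup κ).bind fun params =>
  (iid (D.keyGen κ params) (n + 1)).bind fun K =>
  (A.phase1.runWith (O D κ params K none) []
    (.ofList (.ofNat κ :: params :: pubKeys K))).bind fun out =>
  (D.sign κ params (K c) (K (Fin.last n)).pk out.1.fst).bind fun sig =>
  (A.phase2.runWith (O D κ params K (some sig)) out.2
    (.ofList [.ofNat κ, out.1.snd, sig])).map Prod.fst

/-- `Pr_{c ← {0,1}}[Game(κ, n, c) = c] - 1/2` -/
def psiAdvantage (D : Scheme) (A : PrivacyAdversary) (O : OracleFamily) (n κ : ℕ) : ℝ :=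
  (((PMF.uniformOfFintype Bool).bind fun c =>
    (psiGame D A O κ n (if c then 1 else 0)).map fun c' => decide (c' = Data.ofBool c)) true).toReal
  - 1 / 2

/-- `n`-party sender privacy with respect to `O`. -/
def Scheme.IsSenderPrivateWrt (D : Scheme) (n : ℕ) (O : OracleFamily) : Prop :=
  ∀ A : PrivacyAdversary, IsNegligible (psiAdvantage D A O n)

/-- `n`-party sender privacy. -/
def Scheme.IsSenderPrivate (D : Scheme) (n : ℕ) : Prop :=
  D.IsSenderPrivateWrt n fun D κ _ params K ch => D.stdOracles κ params K ch

/-! ### Strong unforgeability -/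

/-- The strong unforgeability game.  The adversary outputs `(m*, σ*, s, v)` and wins if
`Verify_{P_s → P_v}(m*, σ*) = 1` and `σ*` was not returned to a signing or simulation query
`(m*, s, v)`. -/
def ufGame (D : Scheme) (B : PPT OracleName) (κ n : ℕ) : PMF Bool :=
  (D.setup κ).bind fun params =>
  (iid (D.keyGen κ params) (n + 1)).bind fun K =>
  (B.runWith (D.stdOracles κ params K none) []
    (.ofList (.ofNat κ :: params :: pubKeys K))).bind fun out =>
  match out.1 with
  | .cons m (.cons sig (.cons s v)) =>
    match s.toParty? n, v.toParty? n with
    | some s, some v =>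
      (D.verify κ params (K v) (K s).pk m sig).map fun b =>
        decide (b = Data.ofNat 1 ∧ (⟨m, sig, s, v⟩ : Signed n) ∉ out.2)
    | _, _ => PMF.pure false
  | _ => PMF.pure false

/-- `n`-party strong unforgeability (with respect to the standard first-phase oracles). -/
def Scheme.IsStronglyUnforgeable (D : Scheme) (n : ℕ) : Prop :=
  ∀ B : PPT OracleName, IsNegligible fun κ => (ufGame D B κ n true).toReal

end

end DesignatedVerifier

/-! A verification oracle tells a privacy adversary nothing that it cannot work out for itself,
unless it forges. Keep a log of all answers of the signing and simulation oracles. A verification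
query `(m, σ, s, v)` for which `σ` was returned to `(m, s, v)` is accepted with probability one, by
correctness; any other admissible query that is accepted is a strong forgery. So the rule "accept
exactly what is logged" errs only on forgeries. The challenge, which a forger has to request from
its own signing oracle, is not entered in this log; this does no harm, because verification queries
containing it are answered by `⊥`.

`logOracles` follows this rule. It also forwards each unlogged admissible query to the given
verification oracle, hides the verdict, and records the first query that is accepted. `attack` is
the hybrid in which both phases run with `logOracles` over the true oracles. Until a query is
recorded it agrees with the true game (`fixedGame_coupled_attack`) and with the game without
verification, played by `PrivacyAdversary.withoutVerification` (`attack_coupled_fixedGame`). Hence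
the true advantage exceeds the advantage without verification by at most the probabilities of a
recorded query for `c = 0, 1` (`psiGame_le`, `psiAdvantage_le`).

It remains to see that a query is recorded with negligible probability only. The forger runs the
hybrid and outputs the recorded query. Verification may be probabilistic, and the unforgeability
game verifies again with fresh coins: a query of acceptance probability `p` is recorded with
probability `p`, but recorded and won with probability `p²` only. What holds is `ε * Pr[recorded] ≤
Pr[win] + ε² * T` for every `ε > 0`, where the polynomial `T` bounds the number of queries: recorded
queries with `p ≥ ε` win with probability at least `ε`, and each other query is recorded with
probability at most `ε`. This is proved with a potential (`le_expect_add_sq`, `potential_le`,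
`Prog.HaltsIn.le_expect_output`, `mul_expect_recorded_le`). An inverse polynomial `ε` then gives
negligibility (`IsNegligible.of_mul_le`).

Both reductions must be programs of the concrete machine model. `compile` replaces oracle calls by
subroutines that implement `logOracles`, and the simulation theorem `exec_translate` transfers the
output law exactly and the running time up to a polynomial (`Prog.Implements`). -/

namespace DesignatedVerifier

open scoped ENNReal

noncomputable section

/-! ### Expectations and couplings -/

/-- The expectation of a nonnegative function. -/
def expect {α : Type} (μ : PMF α) (f : α → ℝ≥0∞) : ℝ≥0∞ := ∑' a, μ a * f a

section Expect

variable {α β : Type} {μ : PMF α}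

@[simp] theorem expect_pure (a : α) (f : α → ℝ≥0∞) : expect (PMF.pure a) f = f a := by
  rw [expect, tsum_eq_single a]
  · simp
  · intro b hb
    simp [hb]

@[simp] theorem expect_bind (μ : PMF α) (F : α → PMF β) (f : β → ℝ≥0∞) :
    expect (μ.bind F) f = expect μ fun a => expect (F a) f := by
  simp only [expect, PMF.bind_apply, ← ENNReal.tsum_mul_right, ← ENNReal.tsum_mul_left]
  rw [ENNReal.tsum_comm]
  simp only [mul_assoc]

@[simp] theorem expect_map (μ : PMF α) (F : α → β) (f : β → ℝ≥0∞) :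
    expect (μ.map F) f = expect μ fun a => f (F a) := by
  simp [PMF.map]

theorem expect_mono {f g : α → ℝ≥0∞} (h : ∀ a ∈ μ.support, f a ≤ g a) : expect μ f ≤ expect μ g := by
  refine ENNReal.tsum_le_tsum fun a => ?_
  by_cases ha : a ∈ μ.support
  · exact mul_le_mul_right (h a ha) _
  · simp [(PMF.apply_eq_zero_iff μ a).2 ha]

theorem expect_congr {f g : α → ℝ≥0∞} (h : ∀ a ∈ μ.support, f a = g a) : expect μ f = expect μ g :=
  le_antisymm (expect_mono fun a ha => (h a ha).le) (expect_mono fun a ha => (h a ha).ge)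

@[simp] theorem expect_const (μ : PMF α) (x : ℝ≥0∞) : expect μ (fun _ => x) = x := by
  simp [expect, ENNReal.tsum_mul_right, PMF.tsum_coe]

theorem expect_add (μ : PMF α) (f g : α → ℝ≥0∞) :
    expect μ (fun a => f a + g a) = expect μ f + expect μ g := by
  simp [expect, mul_add, ENNReal.tsum_add]

theorem expect_const_mul (μ : PMF α) (x : ℝ≥0∞) (f : α → ℝ≥0∞) :
    expect μ (fun a => x * f a) = x * expect μ f := by
  simp only [expect, ← ENNReal.tsum_mul_left]
  exact tsum_congr fun a => by ring

theorem apply_eq_expect [DecidableEq α] (μ : PMF α) (y : α) :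
    μ y = expect μ fun a => if a = y then 1 else 0 := by
  rw [expect, tsum_eq_single y]
  · simp
  · intro b hb
    simp [hb]

/-- `μ` and `ν` admit a coupling concentrated on `R`, expressed through expectations. -/
def Coupled (R : α → β → Prop) (μ : PMF α) (ν : PMF β) : Prop :=
  ∀ (f : α → ℝ≥0∞) (g : β → ℝ≥0∞), (∀ a b, R a b → f a ≤ g b) → expect μ f ≤ expect ν g

end Expect

/-! ### Calculus of couplings. -/

namespace Coupled

variable {α β α' β' : Type} {R : α → β → Prop} {R' : α' → β' → Prop} {μ : PMF α} {ν : PMF β}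

theorem pure {a : α} {b : β} (h : R a b) : Coupled R (PMF.pure a) (PMF.pure b) :=
  fun f g hfg => by simpa using hfg a b h

/-- Off the supports, `f` may be lowered to `0` and `g` raised to `⊤` without changing the
expectations; this makes the pointwise comparison trivial there. -/
theorem and_support (h : Coupled R μ ν) :
    Coupled (fun a b => R a b ∧ a ∈ μ.support ∧ b ∈ ν.support) μ ν := by
  classical
  intro f g hfg
  have h1 : expect μ f = expect μ fun a => if a ∈ μ.support then f a else 0 :=
    expect_congr fun a ha => by rw [if_pos ha]
  have h2 : expect ν g = expect ν fun b => if b ∈ ν.support then g b else ⊤ :=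
    expect_congr fun b hb => by rw [if_pos hb]
  rw [h1, h2]
  refine h _ _ fun a b hab => ?_
  split_ifs with ha hb
  · exact hfg a b ⟨hab, ha, hb⟩
  · exact le_top
  · exact zero_le
  · exact zero_le

theorem mono {R₂ : α → β → Prop} (h : Coupled R μ ν)
    (hR : ∀ a ∈ μ.support, ∀ b ∈ ν.support, R a b → R₂ a b) : Coupled R₂ μ ν :=
  fun f g hfg => h.and_support f g fun a b hab => hfg a b (hR a hab.2.1 b hab.2.2 hab.1)

theorem bind {F : α → PMF α'} {G : β → PMF β'} (h : Coupled R μ ν)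
    (hFG : ∀ a ∈ μ.support, ∀ b ∈ ν.support, R a b → Coupled R' (F a) (G b)) :
    Coupled R' (μ.bind F) (ν.bind G) := by
  intro f g hfg
  rw [expect_bind, expect_bind]
  exact h.and_support _ _ fun a b hab => hFG a hab.2.1 b hab.2.2 hab.1 f g hfg

/-- Every value of `f` lies below every value of `g`, so the two sides can be averaged separately.
This disposes of branches in which one run is already bad and the other is unconstrained. -/
theorem of_forall (h : ∀ a ∈ μ.support, ∀ b ∈ ν.support, R a b) : Coupled R μ ν := by
  intro f g hfg
  rw [← expect_const ν (expect μ f)]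
  refine expect_mono fun b hb => ?_
  rw [← expect_const μ (g b)]
  exact expect_mono fun a ha => hfg a b (h a ha b hb)

theorem refl (μ : PMF α) : Coupled (fun a b => a = b) μ μ :=
  fun _ _ hfg => expect_mono fun a _ => hfg a a rfl

theorem bind_same {F : α → PMF α'} {G : α → PMF β'}
    (hFG : ∀ a ∈ μ.support, Coupled R' (F a) (G a)) :
    Coupled R' (μ.bind F) (μ.bind G) :=
  (refl μ).bind fun a ha b _ hab => by subst hab; exact hFG a ha

theorem map {F : α → α'} {G : β → β'} (h : Coupled R μ ν)
    (hFG : ∀ a ∈ μ.support, ∀ b ∈ ν.support, R a b → R' (F a) (G b)) :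
    Coupled R' (μ.map F) (ν.map G) :=
  h.bind fun a ha b hb hab => pure (hFG a ha b hb hab)

theorem map_left {F : α → α'} {R' : α' → β → Prop} (h : Coupled R μ ν)
    (hF : ∀ a ∈ μ.support, ∀ b ∈ ν.support, R a b → R' (F a) b) : Coupled R' (μ.map F) ν := by
  have := h.map (F := F) (G := id) hF
  rwa [PMF.map_id] at this

theorem map_right {G : β → β'} {R' : α → β' → Prop} (h : Coupled R μ ν)
    (hG : ∀ a ∈ μ.support, ∀ b ∈ ν.support, R a b → R' a (G b)) : Coupled R' μ (ν.map G) := by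
  have := h.map (F := id) (G := G) hG
  rwa [PMF.map_id] at this

/-- If `b` had no partner, testing the constant `1` against the indicator of `b' ≠ b` would give `1
≤ 1 - ν b`. Halting of a simulating program is read off from this. -/
theorem exists_of_mem_support (h : Coupled R μ ν) {b : β} (hb : b ∈ ν.support) :
    ∃ a ∈ μ.support, R a b := by
  classical
  by_contra! hno
  have h1 := h.and_support (fun _ => 1) (fun b' => if b' = b then 0 else 1) fun a b' hab => by
    rw [if_neg]
    rintro rfl
    exact hno a hab.2.1 hab.1
  have h2 : expect ν (fun b' => if b' = b then 0 else 1) + ν b = 1 := by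
    rw [apply_eq_expect, ← expect_add]
    rw [← expect_const ν 1]
    exact expect_congr fun a _ => by split_ifs <;> simp
  rw [expect_const] at h1
  have h3 : ν b = 0 := by
    have h4 : 1 + ν b ≤ 1 + 0 := by
      rw [add_zero]
      calc 1 + ν b ≤ _ + ν b := by gcongr
        _ = 1 := h2
    simpa using (ENNReal.add_le_add_iff_left ENNReal.one_ne_top).1 h4
  exact hb h3

end Coupled

theorem pmf_eq_of_le {α : Type} {μ ν : PMF α} (h : ∀ a, μ a ≤ ν a) : μ = ν := by
  ext a
  refine le_antisymm (h a) ?_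
  by_contra! hlt
  have := ENNReal.tsum_lt_tsum (f := μ) (g := ν) (by simp [PMF.tsum_coe]) h hlt
  simp [PMF.tsum_coe] at this

/-- `Coupled` gives one inequality at each point only; equality follows because both sides have
total mass one. -/
theorem Coupled.map_eq_map {α β γ : Type} {R : α → β → Prop} {μ : PMF α} {ν : PMF β}
    (h : Coupled R μ ν) {F : α → γ} {G : β → γ}
    (hFG : ∀ a ∈ μ.support, ∀ b ∈ ν.support, R a b → F a = G b) : μ.map F = ν.map G := by
  classical
  refine pmf_eq_of_le fun y => ?_
  rw [apply_eq_expect, apply_eq_expect, expect_map, expect_map]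
  refine h.and_support _ _ fun a b hab => ?_
  rw [hFG a hab.2.1 b hab.2.2 hab.1]

/-! ### Data, expressions, and invariants of executions -/

/-! ### Sizes and numerals. -/

namespace Data

theorem one_le_size (d : Data) : 1 ≤ d.size := by
  cases d <;> simp [size]

theorem size_fst_le (d : Data) : d.fst.size ≤ d.size := by
  cases d <;> simp [size, fst]; omega

theorem size_snd_le (d : Data) : d.snd.size ≤ d.size := by
  cases d <;> simp [size, snd]; omega

theorem size_ofNat (k : ℕ) : (ofNat k).size = 2 * k + 1 := by
  induction k with
  | zero => rfl
  | succ k ih => simp [ofNat, size, ih]; omega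

theorem size_ofBool_le (b : Bool) : (ofBool b).size ≤ 3 := by
  cases b <;> decide

@[simp] theorem isTrue_ofBool (b : Bool) : (ofBool b).isTrue = b := by
  cases b <;> rfl

theorem toNat?_ofNat (k : ℕ) : (ofNat k).toNat? = some k := by
  induction k with
  | zero => rfl
  | succ k ih => simp [ofNat, toNat?, ih]

theorem eq_ofNat_of_toNat? {d : Data} {k : ℕ} (h : d.toNat? = some k) : d = ofNat k := by
  induction d generalizing k with
  | nil => simp [toNat?] at h; subst h; rfl
  | bot => simp [toNat?] at h
  | cons a b _ ih =>
    cases a with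
    | nil =>
      simp only [toNat?, Option.map_eq_some_iff] at h
      obtain ⟨j, hj, rfl⟩ := h
      rw [ih hj, ofNat]
    | bot => simp [toNat?] at h
    | cons _ _ => simp [toNat?] at h

theorem toParty?_ofNat {n : ℕ} (i : Fin (n + 1)) : (ofNat i).toParty? n = some i := by
  simp [toParty?, toNat?_ofNat, Nat.le_of_lt_succ i.isLt]

theorem eq_ofNat_of_toParty? {n : ℕ} {d : Data} {i : Fin (n + 1)} (h : d.toParty? n = some i) :
    d = ofNat i := by
  simp only [toParty?, Option.bind_eq_some_iff] at h
  obtain ⟨k, hk, h⟩ := h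
  split_ifs at h with hlt
  simp only [Option.some.injEq] at h
  subst h
  exact eq_ofNat_of_toNat? hk

end Data

/-! ### Renaming of registers and cost of expressions. -/

namespace Expr

theorem size_val_le_cost (r : ℕ → Data) (e : Expr) : (e.val r).size ≤ e.cost r := by
  cases e <;> simp [cost, val]

/-- Rename the registers. -/
def rename (ρ : ℕ → ℕ) : Expr → Expr
  | reg x => reg (ρ x)
  | const d => const d
  | cons e f => cons (e.rename ρ) (f.rename ρ)
  | fst e => fst (e.rename ρ)
  | snd e => snd (e.rename ρ)
  | eq e f => eq (e.rename ρ) (f.rename ρ)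

@[simp] theorem rename_id (e : Expr) : e.rename id = e := by
  induction e <;> simp_all [rename]

theorem val_rename {ρ : ℕ → ℕ} {r r' : ℕ → Data} (h : ∀ x, r' (ρ x) = r x) (e : Expr) :
    (e.rename ρ).val r' = e.val r := by
  induction e <;> simp_all [rename, val]

theorem cost_rename {ρ : ℕ → ℕ} {r r' : ℕ → Data} (h : ∀ x, r' (ρ x) = r x) (e : Expr) :
    (e.rename ρ).cost r' = e.cost r := by
  have hv := val_rename h
  induction e <;> simp_all [rename, cost, val]

/-- A factor by which evaluation time exceeds the size of the registers. -/
def weight : Expr → ℕ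
  | reg _ => 1
  | const d => d.size
  | cons e f => 2 * (e.weight + f.weight) + 1
  | fst e => 2 * e.weight
  | snd e => 2 * e.weight
  | eq e f => e.weight + f.weight + 3

theorem cost_le_weight_mul {r : ℕ → Data} {B : ℕ} (hr : ∀ x, (r x).size ≤ B) (e : Expr) :
    e.cost r ≤ e.weight * (B + 1) := by
  induction e with
  | reg x => simpa [cost, weight] using (hr x).trans (Nat.le_succ B)
  | const d => exact Nat.le_mul_of_pos_right _ (Nat.succ_pos B)
  | cons e f he hf =>
    have h1 := size_val_le_cost r e
    have h2 := size_val_le_cost r f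
    simp only [cost, val, Data.size, weight]
    nlinarith
  | fst e he =>
    have h1 := size_val_le_cost r e
    have h2 := Data.size_fst_le (e.val r)
    simp only [cost, val, weight]
    nlinarith
  | snd e he =>
    have h1 := size_val_le_cost r e
    have h2 := Data.size_snd_le (e.val r)
    simp only [cost, val, weight]
    nlinarith
  | eq e f he hf =>
    have h1 := Data.size_ofBool_le (decide (e.val r = f.val r))
    simp only [cost, val, weight]
    nlinarith

end Expr

/-! ### Invariants of executions. -/

/-- The configuration after an oracle has answered `as.1` and moved to state `as.2`. -/
def Config.answer {S : Type} (c : Config S) (t x : ℕ) (as : Data × S) : Config S :=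
  Config.write ⟨c.regs, as.2, c.time + (t + as.1.size)⟩ x as.1

/-- `I` is preserved by every elementary step of a program with oracles `O`. -/
structure IsInvariant {ι S : Type} (O : Oracles ι S) (I : Config S → Prop) : Prop where
  tick : ∀ c t, I c → I (c.tick t)
  write : ∀ c t x d, I c → d.size ≤ t → I ((c.tick t).write x d)
  answer : ∀ c t x o d, ∀ as ∈ (O o c.orc d).support, I c → d.size ≤ t → 1 ≤ t →
    I (c.answer t x as)

theorem iterLoop_invariant {S : Type} {I : Config S → Prop} (htick : ∀ c t, I c → I (c.tick t))
    {e : Expr} {body : Config S → PMF (Option (Config S))}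
    (hbody : ∀ c, I c → ∀ c', some c' ∈ (body c).support → I c') (k : ℕ) :
    ∀ c, I c → ∀ c', some c' ∈ (iterLoop e body k c).support → I c' := by
  induction k with
  | zero => intro c _ c' h; simp [iterLoop] at h
  | succ k ih =>
    intro c hc c' h
    rw [iterLoop] at h
    split_ifs at h with he
    · rw [PMF.mem_support_bind_iff] at h
      obtain ⟨r, hr, h⟩ := h
      cases r with
      | none => simp at h
      | some c₁ => exact ih c₁ (hbody _ (htick _ _ hc) _ hr) c' h
    · simp only [PMF.support_pure, Set.mem_singleton_iff, Option.some.injEq] at h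
      subst h
      exact htick _ _ hc

theorem exec_invariant {ι S : Type} {O : Oracles ι S} {I : Config S → Prop} (hI : IsInvariant O I)
    (k : ℕ) (p : Prog ι) :
    ∀ c, I c → ∀ c', some c' ∈ (p.exec O k c).support → I c' := by
  induction p with
  | assign x e =>
    intro c hc c' h
    simp only [Prog.exec, PMF.support_pure, Set.mem_singleton_iff, Option.some.injEq] at h
    subst h
    exact hI.write _ _ _ _ hc ((e.size_val_le_cost _).trans (Nat.le_add_left _ _))
  | flip x =>
    intro c hc c' h
    simp only [Prog.exec, PMF.mem_support_bind_iff, PMF.support_pure, Set.mem_singleton_iff,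
      Option.some.injEq] at h
    obtain ⟨b, _, rfl⟩ := h
    exact hI.write _ _ _ _ hc (Nat.le_add_left _ _)
  | call o x e =>
    intro c hc c' h
    simp only [Prog.exec, PMF.mem_support_bind_iff, PMF.support_pure, Set.mem_singleton_iff,
      Option.some.injEq] at h
    obtain ⟨as, has, rfl⟩ := h
    exact hI.answer c (1 + e.cost c.regs) x o _ as has hc
      ((e.size_val_le_cost _).trans (Nat.le_add_left _ _)) (Nat.le_add_right _ _)
  | seq p q hp hq =>
    intro c hc c' h
    rw [Prog.exec, PMF.mem_support_bind_iff] at h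
    obtain ⟨r, hr, h⟩ := h
    cases r with
    | none => simp at h
    | some c₁ => exact hq c₁ (hp c hc _ hr) c' h
  | cond e p q hp hq =>
    intro c hc c' h
    rw [Prog.exec] at h
    split_ifs at h
    · exact hp _ (hI.tick _ _ hc) _ h
    · exact hq _ (hI.tick _ _ hc) _ h
  | loop e p hp => exact iterLoop_invariant hI.tick hp k

theorem isInvariant_le_time {ι S : Type} (O : Oracles ι S) (T : ℕ) :
    IsInvariant O fun c => T ≤ c.time where
  tick _ _ h := h.trans (Nat.le_add_right _ _)
  write _ _ _ _ h _ := h.trans (Nat.le_add_right _ _)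
  answer _ _ _ _ _ _ _ h _ _ := h.trans (Nat.le_add_right _ _)

/-- Whatever is written has been charged, so no register outgrows the clock. -/
theorem isInvariant_size {ι S : Type} (O : Oracles ι S) (M : ℕ) :
    IsInvariant O fun c => ∀ x, (c.regs x).size ≤ M + c.time where
  tick c t h x := (h x).trans (by simp [Config.tick])
  write c t x d h hd y := by
    have := h y
    simp only [Config.tick, Config.write, Function.update_apply]
    split_ifs <;> omega
  answer c t x o d as _ h _ _ y := by
    have := h y
    simp only [Config.answer, Config.write, Function.update_apply]
    split_ifs <;> omega

theorem isInvariant_orc {ι S : Type} {O : Oracles ι S} {P : S → Prop}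
    (h : ∀ o s d, ∀ as ∈ (O o s d).support, P s → P as.2) : IsInvariant O fun c => P c.orc where
  tick _ _ hc := hc
  write _ _ _ _ hc _ := hc
  answer c _ _ o d as has hc _ _ := h o c.orc d as has hc

theorem IsInvariant.or {ι S : Type} {O : Oracles ι S} {I J : Config S → Prop}
    (hI : IsInvariant O I) (hJ : IsInvariant O J) : IsInvariant O fun c => I c ∨ J c where
  tick c t h := h.imp (hI.tick c t) (hJ.tick c t)
  write c t x d h hd := h.imp (fun h => hI.write c t x d h hd) fun h => hJ.write c t x d h hd
  answer c t x o d as has h hd ht :=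
    h.imp (fun h => hI.answer c t x o d as has h hd ht) fun h => hJ.answer c t x o d as has h hd ht

theorem isInvariant_false {ι S : Type} (O : Oracles ι S) : IsInvariant O fun _ => False where
  tick _ _ h := h
  write _ _ _ _ h _ := h
  answer _ _ _ _ _ _ _ h _ _ := h

/-! ### Translating programs -/

/-- Rename the registers of a program and replace its oracle calls by subroutines. -/
def Prog.translate {ι ι' : Type} (ρ : ℕ → ℕ) (h : ι → ℕ → Expr → Prog ι') : Prog ι → Prog ι'
  | .assign x e => .assign (ρ x) (e.rename ρ)
  | .flip x => .flip (ρ x)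
  | .call o x e => h o x e
  | .seq p q => .seq (p.translate ρ h) (q.translate ρ h)
  | .cond e p q => .cond (e.rename ρ) (p.translate ρ h) (q.translate ρ h)
  | .loop e p => .loop (e.rename ρ) (p.translate ρ h)

theorem Prog.translate_id {ι : Type} (p : Prog ι) : p.translate id Prog.call = p := by
  induction p <;> simp_all [Prog.translate]

/-- Results of two executions match, unless one of them is cut off or dead. -/
def Matching {S₁ S₂ : Type} (Dead₁ : Config S₁ → Prop) (Dead₂ : Config S₂ → Prop)
    (Rel : Config S₁ → Config S₂ → Prop) (r₁ : Option (Config S₁)) (r₂ : Option (Config S₂)) :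
    Prop :=
  -- The two sides are not symmetric. A cut-off on the left matches anything; a cut-off on the right
  -- does so only if `Dead₂` is satisfiable. With `Dead₂` identically false, a live left result
  -- forces the right run to finish.
  (∀ c, r₁ = some c → Dead₁ c) ∨ ((∃ c, Dead₂ c) ∧ ∀ c, r₂ = some c → Dead₂ c) ∨
    ∃ c₁ c₂, r₁ = some c₁ ∧ r₂ = some c₂ ∧ Rel c₁ c₂

section Translate

variable {ι₁ ι₂ S₁ S₂ : Type} {O₁ : Oracles ι₁ S₁} {O₂ : Oracles ι₂ S₂}
  {Dead₁ : Config S₁ → Prop} {Dead₂ : Config S₂ → Prop} {Rel : Config S₁ → Config S₂ → Prop}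

theorem Matching.dead_left {r₁ : Option (Config S₁)} {r₂ : Option (Config S₂)}
    (h : ∀ c, r₁ = some c → Dead₁ c) : Matching Dead₁ Dead₂ Rel r₁ r₂ := Or.inl h

theorem Matching.dead_right {r₁ : Option (Config S₁)} {r₂ : Option (Config S₂)}
    (h₀ : ∃ c, Dead₂ c) (h : ∀ c, r₂ = some c → Dead₂ c) : Matching Dead₁ Dead₂ Rel r₁ r₂ :=
  Or.inr (Or.inl ⟨h₀, h⟩)

theorem Matching.some {c₁ : Config S₁} {c₂ : Config S₂} (h : Rel c₁ c₂) :
    Matching Dead₁ Dead₂ Rel (some c₁) (some c₂) := Or.inr (Or.inr ⟨c₁, c₂, rfl, rfl, h⟩)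

theorem Coupled.bind_matching {μ : PMF (Option (Config S₁))} {ν : PMF (Option (Config S₂))}
    (h : Coupled (Matching Dead₁ Dead₂ Rel) μ ν)
    {F : Config S₁ → PMF (Option (Config S₁))} {G : Config S₂ → PMF (Option (Config S₂))}
    (hF : ∀ c, Dead₁ c → ∀ c', Option.some c' ∈ (F c).support → Dead₁ c')
    (hG : ∀ c, Dead₂ c → ∀ c', Option.some c' ∈ (G c).support → Dead₂ c')
    (hFG : ∀ c₁ c₂, Option.some c₁ ∈ μ.support → Option.some c₂ ∈ ν.support → Rel c₁ c₂ →
      Coupled (Matching Dead₁ Dead₂ Rel) (F c₁) (G c₂)) :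
    Coupled (Matching Dead₁ Dead₂ Rel)
      (μ.bind fun r => match r with | none => PMF.pure none | Option.some c => F c)
      (ν.bind fun r => match r with | none => PMF.pure none | Option.some c => G c) := by
  refine h.bind fun r₁ hr₁ r₂ hr₂ hr => ?_
  rcases hr with hr | ⟨h₀, hr⟩ | ⟨c₁, c₂, rfl, rfl, hr⟩
  · refine Coupled.of_forall fun a ha b _ => Matching.dead_left ?_
    rintro c rfl
    cases r₁ with
    | none => simp at ha
    | some c₁ => exact hF c₁ (hr _ rfl) c ha
  · refine Coupled.of_forall fun a _ b hb => Matching.dead_right h₀ ?_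
    rintro c rfl
    cases r₂ with
    | none => simp at hb
    | some c₂ => exact hG c₂ (hr _ rfl) c hb
  · exact hFG c₁ c₂ hr₁ hr₂ hr

/-- A general simulation theorem: all that depends on the oracles sits in `hcall`. The cut-offs are
compared through time. Each loop iteration takes at least one unit, so when the right side has used
up more than `T` iterations, the left clock is past `T` and the left run is dead. Alternatively, `k
≤ k'` and the right side never stops earlier. -/
theorem exec_translate {ρ : ℕ → ℕ} {h : ι₁ → ℕ → Expr → Prog ι₂} {T k k' : ℕ}
    (hT : (T < k' ∧ ∀ c, T < c.time → Dead₁ c) ∨ k ≤ k') (hdead₁ : IsInvariant O₁ Dead₁)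
    (hdead₂ : IsInvariant O₂ Dead₂)
    (hregs : ∀ c₁ c₂, Rel c₁ c₂ → ∀ x, c₂.regs (ρ x) = c₁.regs x)
    (htick : ∀ c₁ c₂ t, Rel c₁ c₂ → Rel (c₁.tick t) (c₂.tick t))
    (hwrite : ∀ c₁ c₂ t x d, Rel c₁ c₂ → d.size ≤ t →
      Rel ((c₁.tick t).write x d) ((c₂.tick t).write (ρ x) d))
    (hcall : ∀ c₁ c₂ o x e, Rel c₁ c₂ → Coupled (Matching Dead₁ Dead₂ Rel)
      ((Prog.call o x e).exec O₁ k c₁) ((h o x e).exec O₂ k' c₂))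
    (p : Prog ι₁) : ∀ c₁ c₂, Rel c₁ c₂ → Coupled (Matching Dead₁ Dead₂ Rel)
      (p.exec O₁ k c₁) ((p.translate ρ h).exec O₂ k' c₂) := by
  induction p with
  | assign x e =>
    intro c₁ c₂ hc
    simp only [Prog.translate, Prog.exec, Expr.val_rename (hregs _ _ hc),
      Expr.cost_rename (hregs _ _ hc)]
    exact Coupled.pure (.some (hwrite _ _ _ _ _ hc
      ((e.size_val_le_cost _).trans (Nat.le_add_left _ _))))
  | flip x =>
    intro c₁ c₂ hc
    simp only [Prog.translate, Prog.exec]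
    exact Coupled.bind_same fun b _ =>
      Coupled.pure (.some (hwrite _ _ _ _ _ hc (Nat.le_add_left _ _)))
  | call o x e => exact fun c₁ c₂ hc => hcall c₁ c₂ o x e hc
  | seq p q hp hq =>
    intro c₁ c₂ hc
    simp only [Prog.translate, Prog.exec]
    exact (hp c₁ c₂ hc).bind_matching (exec_invariant hdead₁ k q)
      (exec_invariant hdead₂ k' _) fun c₁ c₂ _ _ hc => hq c₁ c₂ hc
  | cond e p q hp hq =>
    intro c₁ c₂ hc
    simp only [Prog.translate, Prog.exec, Expr.val_rename (hregs _ _ hc),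
      Expr.cost_rename (hregs _ _ hc)]
    split_ifs
    · exact hp _ _ (htick _ _ _ hc)
    · exact hq _ _ (htick _ _ _ hc)
  | loop e p hp =>
    intro c₁ c₂ hc
    simp only [Prog.translate, Prog.exec]
    -- The cut-off inside the body stays `k` and `k'`, while the remaining iterations `j`, `j'`
    -- vary; remaining iterations plus elapsed time is the quantity that stays above `T`.
    suffices H : ∀ j j' c₁ c₂, Rel c₁ c₂ →
        ((T < j' + c₁.time ∧ ∀ c, T < c.time → Dead₁ c) ∨ j ≤ j') →
        Coupled (Matching Dead₁ Dead₂ Rel) (iterLoop e (p.exec O₁ k) j c₁)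
          (iterLoop (e.rename ρ) ((p.translate ρ h).exec O₂ k') j' c₂) from
      H k k' c₁ c₂ hc (hT.imp (fun h => ⟨by omega, h.2⟩) id)
    intro j
    induction j with
    | zero =>
      intro j' c₁ c₂ _ _
      refine Coupled.of_forall fun r hr _ _ => .dead_left ?_
      rintro c rfl
      simp [iterLoop] at hr
    | succ j ih =>
      intro j' c₁ c₂ hc hj
      cases j' with
      | zero =>
        obtain ⟨hj, hlate⟩ := hj.resolve_right (by omega)
        refine Coupled.of_forall fun r hr _ _ => .dead_left ?_
        rintro c rfl
        exact iterLoop_invariant hdead₁.tick (exec_invariant hdead₁ k p) _ _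
          (hlate _ (by omega)) _ hr
      | succ j' =>
        rw [iterLoop, iterLoop, Expr.val_rename (hregs _ _ hc), Expr.cost_rename (hregs _ _ hc)]
        split_ifs
        · refine (hp _ _ (htick _ _ _ hc)).bind_matching
            (iterLoop_invariant hdead₁.tick (exec_invariant hdead₁ k p) _)
            (iterLoop_invariant hdead₂.tick (exec_invariant hdead₂ k' _) _)
            fun c₁' c₂' h₁ _ hc' => ih _ _ _ hc' ?_
          -- Testing the loop condition has already cost at least one unit, which makes up for the
          -- iteration used.
          have := exec_invariant (isInvariant_le_time O₁ _) k p _ le_rfl _ h₁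
          simp only [Config.tick] at this
          exact hj.imp (fun h => ⟨by omega, h.2⟩) (by omega)
        · exact Coupled.pure (.some (htick _ _ _ hc))

end Translate

/-! ### Cut-offs, outputs, and running times -/

/-- This is the simulation of a program by itself. It covers two regimes: a time bound `T` below the
new cut-off, or a new cut-off that is not smaller than the old one. -/
theorem exec_cutoff {ι S : Type} (O : Oracles ι S) (p : Prog ι) {s : S} {x : Data} {T k k' : ℕ}
    (h : ∀ r ∈ (p.exec O k (Config.init s x)).support, ∃ c, r = some c ∧ (T < k' → c.time ≤ T))
    (hk : T < k' ∨ k ≤ k') :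
    p.exec O k (Config.init s x) = p.exec O k' (Config.init s x) := by
  -- The conjunct `T < k'` switches death off in the regime `k ≤ k'`, where the running time is not
  -- known.
  have := exec_translate (O₁ := O) (O₂ := O) (Dead₁ := fun c => T < k' ∧ T < c.time)
    (Dead₂ := fun _ => False) (Rel := fun c₁ c₂ => c₁ = c₂) (ρ := id) (h := Prog.call) (k := k)
    (hk.imp_left fun hT => ⟨hT, fun _ h => ⟨hT, h⟩⟩)
    ⟨fun _ _ h => ⟨h.1, h.2.trans_le (Nat.le_add_right _ _)⟩,
      fun _ _ _ _ h _ => ⟨h.1, h.2.trans_le (Nat.le_add_right _ _)⟩,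
      fun _ _ _ _ _ _ _ h _ _ => ⟨h.1, h.2.trans_le (Nat.le_add_right _ _)⟩⟩
    (isInvariant_false O)
    (by rintro _ _ rfl _; rfl) (by rintro _ _ _ rfl; rfl) (by rintro _ _ _ _ _ rfl _; rfl)
    (by
      rintro c _ o x e rfl
      simp only [Prog.exec]
      exact Coupled.bind_same fun as _ => Coupled.pure (.some rfl)) p _ (Config.init s x) rfl
  rw [Prog.translate_id] at this
  rw [← PMF.map_id (p.exec O k _), ← PMF.map_id (p.exec O k' _)]
  refine this.map_eq_map fun a ha b _ hab => ?_
  obtain ⟨c, rfl, hc⟩ := h a ha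
  rcases hab with hab | ⟨⟨_, hab⟩, _⟩ | ⟨c₁, c₂, h₁, h₂, rfl⟩
  · have := hab c rfl
    have := hc this.1
    omega
  · exact hab.elim
  · rw [h₁, h₂]

section Output

variable {ι S : Type} {O : Oracles ι S} {p : Prog ι} {s : S} {x : Data} {t : ℕ}

/-- The output and the final oracle state of a configuration. -/
def Config.result {S : Type} (s : S) (r : Option (Config S)) : Data × S :=
  match r with
  | none => (Data.nil, s)
  | some c => (c.regs 0, c.orc)

/-- A cut-off above the time bound is never reached, so the existential cut-off may be traded for
any such `k`; two machines can then be compared at a common one. -/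
theorem Prog.HaltsIn.forall_support (h : p.HaltsIn O s x t) {k : ℕ} (hk : t < k) :
    ∀ r ∈ (p.exec O k (Config.init s x)).support, ∃ c, r = some c ∧ c.time ≤ t := by
  obtain ⟨j, hj⟩ := h
  rw [← exec_cutoff O p (T := t) (fun r hr => (hj r hr).imp fun c hc => ⟨hc.1, fun _ => hc.2⟩)
    (Or.inl hk)]
  exact hj

theorem output_eq_map {j : ℕ}
    (hj : ∀ r ∈ (p.exec O j (Config.init s x)).support, ∃ c, r = some c) :
    p.output O s x = (p.exec O j (Config.init s x)).map (Config.result s) := by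
  have h : p.Halts O s x := ⟨j, hj⟩
  have key : ∀ {i j}, (∀ r ∈ (p.exec O i (Config.init s x)).support, ∃ c, r = some c) →
      i ≤ j → p.exec O i (Config.init s x) = p.exec O j (Config.init s x) := fun {i j} hi hij =>
    -- The choice `T := j` makes the clause about time vacuous: its premise is `j < j`.
    exec_cutoff O p (T := j) (fun r hr => (hi r hr).imp fun c hc => ⟨hc, fun h => absurd h
      (lt_irrefl _)⟩) (Or.inr hij)
  rw [Prog.output, dif_pos h]
  change PMF.map (Config.result s) _ = _
  rcases le_total h.choose j with hle | hle
  · rw [key h.choose_spec hle]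
  · rw [← key hj hle]

theorem Prog.HaltsIn.output_eq (h : p.HaltsIn O s x t) {k : ℕ} (hk : t < k) :
    p.output O s x = (p.exec O k (Config.init s x)).map (Config.result s) :=
  output_eq_map fun r hr => (h.forall_support hk r hr).imp fun _ hc => hc.1

theorem Prog.HaltsIn.size_output_le (h : p.HaltsIn O s x t) {out : Data × S}
    (hout : out ∈ (p.output O s x).support) : out.1.size ≤ x.size + t := by
  rw [h.output_eq (Nat.lt_succ_self t), PMF.mem_support_map_iff] at hout
  obtain ⟨r, hr, rfl⟩ := hout
  obtain ⟨c, rfl, hc⟩ := h.forall_support (Nat.lt_succ_self t) r hr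
  have := exec_invariant (isInvariant_size O x.size) _ p _ (fun y => ?_) c hr 0
  · simp only [Config.result]
    omega
  · have := x.one_le_size
    simp only [Config.init, Function.update_apply]
    split_ifs
    · omega
    · simpa [Data.size] using this

end Output

/-- Two oracles that agree until one of them turns bad: the outputs agree unless one is bad. -/
theorem output_coupled {ι S₁ S₂ : Type} {O₁ : Oracles ι S₁} {O₂ : Oracles ι S₂}
    {Bad₁ : S₁ → Prop} {Bad₂ : S₂ → Prop} {Inv : S₁ → S₂ → Prop}
    (hbad₁ : ∀ o s d, ∀ as ∈ (O₁ o s d).support, Bad₁ s → Bad₁ as.2)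
    (hbad₂ : ∀ o s d, ∀ as ∈ (O₂ o s d).support, Bad₂ s → Bad₂ as.2)
    (hO : ∀ o s₁ s₂ d, Inv s₁ s₂ → Coupled
      (fun a b => Bad₁ a.2 ∨ Bad₂ b.2 ∨ a.1 = b.1 ∧ Inv a.2 b.2) (O₁ o s₁ d) (O₂ o s₂ d))
    {p : Prog ι} {s₁ : S₁} {s₂ : S₂} {x : Data} {t₁ t₂ : ℕ} (h₁ : p.HaltsIn O₁ s₁ x t₁)
    (h₂ : p.HaltsIn O₂ s₂ x t₂) (hs : Inv s₁ s₂) :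
    Coupled (fun a b => Bad₁ a.2 ∨ Bad₂ b.2 ∨ a.1 = b.1 ∧ Inv a.2 b.2)
      (p.output O₁ s₁ x) (p.output O₂ s₂ x) := by
  have hk₁ : t₁ < t₁ + t₂ + 1 := by omega
  have hk₂ : t₂ < t₁ + t₂ + 1 := by omega
  rw [h₁.output_eq hk₁, h₂.output_eq hk₂]
  -- Overtime counts as dead only in order to license the cut-off; the bound `h₁` excludes it at the
  -- end.
  have := exec_translate (O₁ := O₁) (O₂ := O₂) (Dead₁ := fun c => t₁ < c.time ∨ Bad₁ c.orc)
    (Dead₂ := fun c => Bad₂ c.orc)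
    (Rel := fun c₁ c₂ => c₁.regs = c₂.regs ∧ c₁.time = c₂.time ∧ Inv c₁.orc c₂.orc)
    (ρ := id) (h := Prog.call) (k := t₁ + t₂ + 1) (T := t₁)
    (Or.inl ⟨hk₁, fun _ h => Or.inl h⟩)
    ((isInvariant_le_time O₁ (t₁ + 1)).or (isInvariant_orc hbad₁)) (isInvariant_orc hbad₂)
    (fun _ _ h _ => by simp [h.1])
    (fun _ _ _ h => by simpa [Config.tick] using h)
    (fun _ _ _ _ _ h _ => by simpa [Config.tick, Config.write, h.1] using h.2)
    (by
      intro c₁ c₂ o x e hc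
      simp only [Prog.exec, ← hc.1, ← hc.2.1]
      refine (hO o _ _ _ hc.2.2).bind fun a _ b _ hab => Coupled.pure ?_
      rcases hab with hab | hab | ⟨hab, hinv⟩
      · refine .dead_left fun c h => ?_
        cases h
        exact Or.inr hab
      · refine .dead_right ⟨⟨c₂.regs, b.2, 0⟩, hab⟩ fun c h => ?_
        cases h
        exact hab
      · exact .some (by simp [Config.write, hab, hinv]))
    p (Config.init s₁ x) (Config.init s₂ x) ⟨rfl, rfl, hs⟩
  rw [Prog.translate_id] at this
  refine this.map fun a ha b hb hab => ?_
  obtain ⟨c₁, rfl, hc₁⟩ := h₁.forall_support hk₁ a ha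
  obtain ⟨c₂, rfl, hc₂⟩ := h₂.forall_support hk₂ b hb
  rcases hab with hab | hab | ⟨_, _, h, h', hab⟩
  · exact Or.inl ((hab c₁ rfl).resolve_left (by omega))
  · exact Or.inr (Or.inl (hab.2 c₂ rfl))
  · cases h
    cases h'
    exact Or.inr (Or.inr ⟨by simp [Config.result, hab.1], hab.2.2⟩)

/-- A quantity that drops by at most `δ` in expectation with each oracle call drops by at most
`δ` times the running time. -/
theorem Prog.HaltsIn.le_expect_output {ι S : Type} {O : Oracles ι S} {p : Prog ι} {s : S}
    {x : Data} {t : ℕ} (hp : p.HaltsIn O s x t) {h : S → ℝ≥0∞} {δ : ℝ≥0∞}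
    (hO : ∀ o s d, h s ≤ expect (O o s d) (fun as => h as.2) + δ) :
    h s ≤ expect (p.output O s x) (fun out => h out.2) + δ * t := by
  -- This quantity never drops in expectation: an oracle call loses at most `δ` and takes at least
  -- one unit of time. The value `⊤` makes cut-off loops harmless.
  let ψ : Option (Config S) → ℝ≥0∞ := fun r => match r with
    | none => ⊤
    | some c => h c.orc + δ * c.time
  have hmono : ∀ (c : Config S) {t t' : ℕ}, t ≤ t' → h c.orc + δ * t ≤ h c.orc + δ * t' := by
    intro c t t' htt
    gcongr
  have hbind : ∀ (c : Config S) (μ : PMF (Option (Config S)))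
      (F : Config S → PMF (Option (Config S))), ψ (some c) ≤ expect μ ψ →
      (∀ c', ψ (some c') ≤ expect (F c') ψ) →
      ψ (some c) ≤ expect (μ.bind fun r => match r with
        | none => PMF.pure none
        | some c' => F c') ψ := by
    intro c μ F h₁ h₂
    rw [expect_bind]
    refine h₁.trans (expect_mono fun r _ => ?_)
    cases r with
    | none => simp
    | some c' => exact h₂ c'
  have key : ∀ (k : ℕ) (p : Prog ι) c, ψ (some c) ≤ expect (p.exec O k c) ψ := by
    intro k p
    induction p with
    | assign x e =>
      intro c
      simp only [Prog.exec, expect_pure]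
      exact hmono c (Nat.le_add_right _ _)
    | flip x =>
      intro c
      simp only [Prog.exec, expect_bind, expect_pure]
      rw [← expect_const (PMF.uniformOfFintype Bool) (ψ (some c))]
      exact expect_mono fun b _ => hmono c (Nat.le_add_right _ _)
    | call o x e =>
      intro c
      simp only [Prog.exec, expect_bind, expect_pure]
      calc h c.orc + δ * c.time
          ≤ expect (O o c.orc (e.val c.regs)) (fun as => h as.2) + δ + δ * c.time := by
            gcongr
            exact hO _ _ _
        _ = expect (O o c.orc (e.val c.regs)) fun as => h as.2 + (δ + δ * c.time) := by
            rw [expect_add, expect_const, add_assoc]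
        _ ≤ _ := expect_mono fun as _ => by
            simp only [ψ, Config.write]
            gcongr
            calc δ + δ * c.time = δ * ((c.time + 1 : ℕ) : ℝ≥0∞) := by push_cast; ring
              _ ≤ _ := by gcongr; omega
    | seq p q hp hq => exact fun c => hbind c _ _ (hp c) hq
    | cond e p q hp hq =>
      intro c
      rw [Prog.exec]
      split_ifs
      · exact (hmono c (Nat.le_add_right _ _)).trans (hp (c.tick _))
      · exact (hmono c (Nat.le_add_right _ _)).trans (hq (c.tick _))
    | loop e p hp =>
      suffices H : ∀ j c, ψ (some c) ≤ expect (iterLoop e (p.exec O k) j c) ψ from H k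
      intro j
      induction j with
      | zero =>
        intro c
        simp [iterLoop, ψ]
      | succ j ih =>
        intro c
        rw [iterLoop]
        split_ifs
        · exact (hmono c (Nat.le_add_right _ _)).trans
            (hbind (c.tick _) _ _ (hp (c.tick _)) ih)
        · rw [expect_pure]
          exact hmono c (Nat.le_add_right _ _)
  have := key (t + 1) p (Config.init s x)
  rw [hp.output_eq (Nat.lt_succ_self t), expect_map, ← expect_const
    (p.exec O (t + 1) (Config.init s x)) (δ * t), ← expect_add]
  refine le_trans ?_ (this.trans (expect_mono fun r hr => ?_))
  · simp [ψ, Config.init]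
  · obtain ⟨c, rfl, hc⟩ := hp.forall_support (Nat.lt_succ_self t) r hr
    exact hmono c hc

/-! ### Answering verification queries from a log -/

namespace Expr

/-- Disjunction of Boolean expressions. -/
def or (e f : Expr) : Expr := eq (eq (cons e f) (const (.cons .nil .nil))) (const .nil)

/-- Conjunction of Boolean expressions. -/
def and (e f : Expr) : Expr := eq (cons e f) (const (.cons (.ofNat 1) (.ofNat 1)))

/-- Negation of Boolean expressions. -/
def not (e : Expr) : Expr := eq e (const .nil)

variable {r : ℕ → Data} {e f : Expr} {a b : Bool}

theorem val_or (he : e.val r = .ofBool a) (hf : f.val r = .ofBool b) :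
    (e.or f).val r = .ofBool (a || b) := by
  simp only [or, val, he, hf]
  cases a <;> cases b <;> rfl

theorem val_and (he : e.val r = .ofBool a) (hf : f.val r = .ofBool b) :
    (e.and f).val r = .ofBool (a && b) := by
  simp only [and, val, he, hf]
  cases a <;> cases b <;> rfl

theorem val_not (he : e.val r = .ofBool a) : e.not.val r = .ofBool (!a) := by
  simp only [not, val, he]
  cases a <;> rfl

/-- Tests whether a numeral is at most `k`. -/
def isNumeral (e : Expr) : ℕ → Expr
  | 0 => eq e (const (.ofNat 0))
  | k + 1 => or (isNumeral e k) (eq e (const (.ofNat (k + 1))))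

/-- The number of parties is fixed, so a finite disjunction of equality tests decides whether a
party is named; `toParty?` accepts exact numerals only. -/
theorem val_isNumeral (k : ℕ) :
    (e.isNumeral k).val r = .ofBool ((e.val r).toParty? k).isSome := by
  have h : ∀ k, (e.isNumeral k).val r = .ofBool (decide (∃ i ≤ k, e.val r = .ofNat i)) := by
    intro k
    induction k with
    | zero =>
      rw [isNumeral, val]
      congr 1
      rw [decide_eq_decide]
      simp [val]
    | succ k ih =>
      rw [isNumeral, val_or ih (b := decide (e.val r = .ofNat (k + 1))) rfl, ← Bool.decide_or]
      congr 2
      refine propext ⟨?_, ?_⟩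
      · rintro (⟨i, hi, h⟩ | h)
        · exact ⟨i, by omega, h⟩
        · exact ⟨_, le_rfl, h⟩
      · rintro ⟨i, hi, h⟩
        rcases Nat.lt_or_ge k i with hlt | hle
        · obtain rfl : i = k + 1 := by omega
          exact Or.inr h
        · exact Or.inl ⟨i, hle, h⟩
  rw [h]
  congr 1
  rw [Bool.eq_iff_iff, decide_eq_true_iff, Option.isSome_iff_exists]
  constructor
  · rintro ⟨i, hi, h⟩
    exact ⟨⟨i, by omega⟩, by rw [h]; exact Data.toParty?_ofNat (n := k) ⟨i, by omega⟩⟩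
  · rintro ⟨i, h⟩
    exact ⟨i, Nat.le_of_lt_succ i.isLt, Data.eq_ofNat_of_toParty? h⟩

end Expr

/-- Is `q` a well-formed verification query `(m, σ, s, v)` where `σ` is not the challenge?
(`chal` is a pair `(nil, σ*)` if a challenge has been issued, and `nil` otherwise.) -/
def admissible (n : ℕ) (chal q : Data) : Bool :=
  (decide (q = .cons q.fst (.cons q.snd.fst (.cons q.snd.snd.fst q.snd.snd.snd))) &&
    ((q.snd.snd.fst.toParty? n).isSome && (q.snd.snd.snd.toParty? n).isSome)) &&
      !decide (Data.cons .nil q.snd.fst = chal)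

/-- The log entry `(σ, (m, s, v))` that justifies the verification query `(m, σ, s, v)`. -/
def logKey (q : Data) : Data := .cons q.snd.fst (.cons q.fst q.snd.snd)

/-- Membership in a list of data. -/
def Data.mem (d : Data) : Data → Bool
  | .cons a b => decide (a = d) || d.mem b
  | _ => false

/-- Oracles that keep a log of the signatures, and answer verification queries by means of it.
The state consists of the state of the given oracles, the log, and the first verification query
that was accepted by the given oracle though it was not justified by the log; once there is one, all
queries are rejected. -/
def logOracles {S : Type} (n : ℕ) (chal : Data) (O : Oracles OracleName S) :
    Oracles OracleName (S × Data × Data) := fun o st q =>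
  if st.2.2.isTrue then PMF.pure (.bot, st) else
  match o with
  | .veri =>
    if admissible n chal q then
      if (logKey q).mem st.2.1 then PMF.pure (.ofNat 1, st)
      else (O .veri st.1 q).map fun b =>
        -- The answer is the bit `0 = nil` whatever the verdict; the verdict only decides whether
        -- `q` is recorded.
        (.nil, (b.2, st.2.1, if b.1 = .ofNat 1 then q else st.2.2))
    else PMF.pure (.bot, st)
  -- For a well-formed `q = (m, s, v)` this entry has the shape of `logKey`. Entries for ill-formed
  -- queries match no admissible verification query.
  | o => (O o st.1 q).map fun a => (a.1, (a.2, .cons (.cons a.1 q) st.2.1, st.2.2))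

/-! ### The subroutines -/

/-- The register `1` holds an admissible query, if register `5` describes the challenge. -/
def admissibleExpr (n : ℕ) : Expr :=
  let q := Expr.reg 1
  .and (.and (.eq q (.cons q.fst (.cons q.snd.fst (.cons q.snd.snd.fst q.snd.snd.snd))))
      (.and (q.snd.snd.fst.isNumeral n) (q.snd.snd.snd.isNumeral n)))
    (.not (.eq (.cons (.const .nil) q.snd.fst) (.reg 5)))

theorem val_admissibleExpr (n : ℕ) (r : ℕ → Data) :
    (admissibleExpr n).val r = .ofBool (admissible n (r 5) (r 1)) := by
  unfold admissibleExpr admissible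
  exact Expr.val_and (Expr.val_and rfl (Expr.val_and (Expr.val_isNumeral n)
    (Expr.val_isNumeral n))) (Expr.val_not rfl)

/-- The log key of the query in register `1`. -/
def logKeyExpr : Expr :=
  .cons (.fst (.snd (.reg 1))) (.cons (.fst (.reg 1)) (.snd (.snd (.reg 1))))

/-- One step of the search. -/
def searchStep : Prog OracleName :=
  .seq (.assign 7 (.or (.reg 7) (.eq (.fst (.reg 6)) logKeyExpr))) (.assign 6 (.snd (.reg 6)))

/-- Search the log in register `3`. -/
def search : Prog OracleName :=
  .seq (.assign 6 (.reg 3)) (.seq (.assign 7 (.const .nil)) (.loop (.reg 6) searchStep))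

/-- Answer a verification query by means of the log. -/
def verifySubroutine (n : ℕ) : Prog OracleName :=
  .cond (admissibleExpr n)
    (.seq search (.cond (.reg 7) (.assign 2 (.const (.ofNat 1)))
      (.seq (.call .veri 2 (.reg 1))
        (.seq (.cond (.eq (.reg 2) (.const (.ofNat 1))) (.assign 4 (.reg 1))
            (.assign 4 (.reg 4)))
          (.assign 2 (.const .nil))))))
    (.assign 2 (.const .bot))

/-- Answer a signing or simulation query and keep a record of it. -/
def recordSubroutine (o : OracleName) : Prog OracleName :=
  .seq (.call o 2 (.reg 1)) (.assign 3 (.cons (.cons (.reg 2) (.reg 1)) (.reg 3)))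

/-- The implementation of `logOracles`. Registers: `1` query, `2` answer, `3` log, `4` accepted
unjustified query, `5` challenge, `6` and `7` auxiliary. -/
def subroutine (n : ℕ) (o : OracleName) : Prog OracleName :=
  .cond (.reg 4) (.assign 2 (.const .bot))
    (match o with
    | .veri => verifySubroutine n
    | o => recordSubroutine o)

/-! ### Correctness and running time of the subroutines. -/

section Subroutine

variable {S : Type} {O : Oracles OracleName S}

theorem Expr.cost_le_weight_mul_of_lt {r : ℕ → Data} {B Y : ℕ} (hr : ∀ x, (r x).size ≤ B)
    (hY : B < Y) (e : Expr) : e.cost r ≤ e.weight * Y :=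
  (e.cost_le_weight_mul hr).trans (Nat.mul_le_mul_left _ hY)

/-- Each iteration consumes one cell of the log, so `d.size` iterations are enough. The constant
`120` covers the weights of the loop test and of the two assignments; `3 ≤ B` leaves room for a bit
in register `7`. -/
theorem search_loop {k B Y : ℕ} (h3 : 3 ≤ B) (hY : B < Y) (d : Data) : ∀ (j : ℕ) (c : Config S)
    (b : Bool), d.size ≤ j → c.regs 6 = d → c.regs 7 = .ofBool b →
    (∀ x, (c.regs x).size ≤ B) →
    ∃ c' : Config S, iterLoop (.reg 6) (searchStep.exec O k) j c = PMF.pure (some c') ∧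
      c'.regs 7 = .ofBool (b || (logKey (c.regs 1)).mem d) ∧ c'.orc = c.orc ∧
      (∀ x, x ≠ 6 → x ≠ 7 → c'.regs x = c.regs x) ∧ (∀ x, (c'.regs x).size ≤ B) ∧
      c'.time ≤ c.time + d.size * (120 * Y) := by
  induction d with
  | nil =>
    intro j c b hj h6 h7 hB
    obtain ⟨j, rfl⟩ : ∃ i, j = i + 1 := ⟨j - 1, by simp [Data.size] at hj; omega⟩
    refine ⟨_, by simp only [iterLoop, Expr.val, h6]; exact if_neg (by simp [Data.isTrue]), ?_⟩
    simp [Config.tick, h7, Data.mem, hB, Expr.cost, h6, Data.size]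
    omega
  | bot =>
    intro j c b hj h6 h7 hB
    obtain ⟨j, rfl⟩ : ∃ i, j = i + 1 := ⟨j - 1, by simp [Data.size] at hj; omega⟩
    refine ⟨_, by simp only [iterLoop, Expr.val, h6]; exact if_neg (by simp [Data.isTrue]), ?_⟩
    simp [Config.tick, h7, Data.mem, hB, Expr.cost, h6, Data.size]
    omega
  | cons a d _ ih =>
    intro j c b hj h6 h7 hB
    simp only [Data.size] at hj
    obtain ⟨j, rfl⟩ : ∃ i, j = i + 1 := ⟨j - 1, by omega⟩
    rw [iterLoop, if_pos (by simp [Expr.val, h6, Data.isTrue])]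
    rw [searchStep, Prog.exec, Prog.exec, PMF.pure_bind]
    dsimp only
    rw [Prog.exec, PMF.pure_bind]
    dsimp only
    rw [← searchStep]
    set c₁ := c.tick (1 + (Expr.reg 6).cost c.regs) with hc₁
    have hr₁ : c₁.regs = c.regs := rfl
    have hv : (Expr.or (.reg 7) (.eq (.fst (.reg 6)) logKeyExpr)).val c₁.regs =
        .ofBool (b || decide (a = logKey (c.regs 1))) :=
      Expr.val_or h7 (by
        simp only [Expr.val, hr₁, h6]; rfl)
    rw [hv]
    set c₂ := (c₁.tick (1 + (Expr.or (.reg 7) (.eq (.fst (.reg 6)) logKeyExpr)).cost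
      c₁.regs)).write 7 (.ofBool (b || decide (a = logKey (c.regs 1)))) with hc₂
    have hr₂ : ∀ x, x ≠ 7 → c₂.regs x = c.regs x := fun x hx => by
      simp [hc₂, hr₁, Config.write, Config.tick, hx]
    have hB₂ : ∀ x, (c₂.regs x).size ≤ B := fun x => by
      by_cases hx : x = 7
      · subst hx
        simpa [hc₂, Config.write] using (Data.size_ofBool_le _).trans h3
      · rw [hr₂ x hx]; exact hB x
    have hv₂ : (Expr.snd (.reg 6)).val c₂.regs = d := by
      simp [Expr.val, hr₂, h6, Data.snd]
    rw [hv₂]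
    set c₃ := (c₂.tick (1 + (Expr.snd (.reg 6)).cost c₂.regs)).write 6 d with hc₃
    have hr₃ : ∀ x, x ≠ 6 → c₃.regs x = c₂.regs x := fun x hx => by
      simp [hc₃, Config.write, Config.tick, hx]
    have h63 : c₃.regs 6 = d := by simp [hc₃, Config.write]
    obtain ⟨c', he, h₁, h₂, h₃, h₄, h₅⟩ := ih j c₃ (b || decide (a = logKey (c.regs 1)))
      (by omega) h63 (by rw [hr₃ 7 (by decide)]; simp [hc₂, Config.write]) (fun x => by
        by_cases hx : x = 6
        · subst hx
          have := hB 6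
          rw [h6, Data.size] at this
          rw [h63]
          omega
        · rw [hr₃ x hx]; exact hB₂ x)
    have h13 : c₃.regs 1 = c.regs 1 := by rw [hr₃ 1 (by decide), hr₂ 1 (by decide)]
    refine ⟨c', he, ?_, h₂, fun x h6 h7 => ?_, h₄, ?_⟩
    · rw [h₁, h13, Data.mem, Bool.or_assoc]
    · rw [h₃ x h6 h7, hr₃ x h6, hr₂ x h7]
    · have e₁ := (Expr.reg 6).cost_le_weight_mul_of_lt hB hY
      have e₂ := (Expr.or (.reg 7) (.eq (.fst (.reg 6)) logKeyExpr)).cost_le_weight_mul_of_lt hB hY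
      have e₃ := (Expr.snd (.reg 6)).cost_le_weight_mul_of_lt hB₂ hY
      have ht : c₃.time = c.time + (1 + (Expr.reg 6).cost c.regs) +
        (1 + (Expr.or (.reg 7) (.eq (.fst (.reg 6)) logKeyExpr)).cost c.regs) +
        (1 + (Expr.snd (.reg 6)).cost c₂.regs) := rfl
      simp only [Expr.weight, Expr.or, logKeyExpr, Data.size] at e₁ e₂ e₃ ht
      simp only [Data.size]
      have : (a.size + d.size + 1) * (120 * Y) = a.size * (120 * Y) + d.size * (120 * Y) + 120 * Y := by
        ring
      omega

/-- The configuration after the subroutine has produced `out`. -/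
structure Handled (c₀ : Config S) (B H : ℕ) (out : Data × S × Data × Data) (c : Config S) :
    Prop where
  ans : c.regs 2 = out.1
  log : c.regs 3 = out.2.2.1
  flag : c.regs 4 = out.2.2.2
  orc : c.orc = out.2.1
  frame : ∀ x, x ≠ 2 → x ≠ 3 → x ≠ 4 → x ≠ 6 → x ≠ 7 → c.regs x = c₀.regs x
  size : ∀ x, (c.regs x).size ≤ B + out.1.size + (c₀.regs 1).size + 2
  time : c.time ≤ c₀.time + H

theorem Handled.of_tick {c₀ c : Config S} {B H H' a : ℕ} {out : Data × S × Data × Data}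
    (h : Handled (c₀.tick a) B H out c) (hH : a + H ≤ H') : Handled c₀ B H' out c where
  ans := h.ans
  log := h.log
  flag := h.flag
  orc := h.orc
  frame := h.frame
  size := h.size
  time := by
    have := h.time
    simp only [Config.tick] at this
    omega

theorem handled_answer {c₀ c : Config S} {B H t : ℕ} {d : Data} (horc : c.orc = c₀.orc)
    (hframe : ∀ x, x ≠ 6 → x ≠ 7 → c.regs x = c₀.regs x) (hB : ∀ x, (c.regs x).size ≤ B)
    (htime : c.time + t ≤ c₀.time + H) :
    Handled c₀ B H (d, c₀.orc, c₀.regs 3, c₀.regs 4) ((c.tick t).write 2 d) where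
  ans := by simp [Config.write]
  log := by simpa [Config.write, Config.tick] using hframe 3 (by decide) (by decide)
  flag := by simpa [Config.write, Config.tick] using hframe 4 (by decide) (by decide)
  orc := horc
  frame x h2 _ _ h6 h7 := by simpa [Config.write, Config.tick, h2] using hframe x h6 h7
  size x := by
    have := hB x
    simp only [Config.write, Config.tick, Function.update_apply]
    split_ifs <;> omega
  time := htime

theorem search_exec {c : Config S} {B k : ℕ} (h3 : 3 ≤ B) (hB : ∀ x, (c.regs x).size ≤ B)
    (hk : B < k) :
    ∃ c' : Config S, search.exec O k c = PMF.pure (some c') ∧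
      c'.regs 7 = .ofBool ((logKey (c.regs 1)).mem (c.regs 3)) ∧ c'.orc = c.orc ∧
      (∀ x, x ≠ 6 → x ≠ 7 → c'.regs x = c.regs x) ∧ (∀ x, (c'.regs x).size ≤ B) ∧
      c'.time ≤ c.time + 130 * ((B + 1) * (B + 1)) := by
  set c₁ := (c.tick (1 + (Expr.reg 3).cost c.regs)).write 6 (c.regs 3) with hc₁
  set c₂ := (c₁.tick (1 + (Expr.const .nil).cost c₁.regs)).write 7 .nil with hc₂
  have hr : ∀ x, x ≠ 6 → x ≠ 7 → c₂.regs x = c.regs x := fun x h6 h7 => by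
    simp [hc₂, hc₁, Config.write, Config.tick, h6, h7]
  have h6 : c₂.regs 6 = c.regs 3 := by simp [hc₂, hc₁, Config.write, Config.tick]
  have h7 : c₂.regs 7 = .nil := by simp [hc₂, Config.write]
  have ht : c₂.time = c.time + (1 + (c.regs 3).size) + 2 := rfl
  obtain ⟨c', he, h₁, h₂, h₃, h₄, h₅⟩ := search_loop (O := O) (k := k) h3 (Nat.lt_succ_self B)
    (c.regs 3) k c₂ false ((hB 3).trans hk.le) h6 h7 (fun x => by
      by_cases h : x = 6
      · subst h; rw [h6]; exact hB 3
      · by_cases h' : x = 7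
        · subst h'; rw [h7]; simp [Data.size]; omega
        · rw [hr x h h']; exact hB x)
  refine ⟨c', ?_, ?_, h₂, fun x h h' => (h₃ x h h').trans (hr x h h'), h₄, ?_⟩
  · rw [search, Prog.exec, Prog.exec, PMF.pure_bind]
    dsimp only
    rw [Prog.exec, Prog.exec, PMF.pure_bind]
    exact he
  · rw [h₁, hr 1 (by decide) (by decide), Bool.false_or]
  · have h₆ : (c.regs 3).size * (120 * (B + 1)) ≤ 120 * ((B + 1) * (B + 1)) := by
      have := hB 3
      nlinarith
    have := hB 3
    have : B + 1 ≤ (B + 1) * (B + 1) := Nat.le_mul_of_pos_left _ (by omega)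
    simp only [Nat.succ_eq_add_one] at h₅
    omega

theorem record_coupled {c : Config S} {o : OracleName} {B A Y k : ℕ}
    (hB : ∀ x, (c.regs x).size ≤ B)
    (hA : ∀ as ∈ (O o c.orc (c.regs 1)).support, as.1.size ≤ A) (hY : B + A < Y) :
    Coupled (fun out r => ∃ c', r = some c' ∧ Handled c B (100 * Y) out c')
      ((O o c.orc (c.regs 1)).map fun a =>
        (a.1, (a.2, .cons (.cons a.1 (c.regs 1)) (c.regs 3), c.regs 4)))
      ((recordSubroutine o).exec O k c) := by
  rw [recordSubroutine, Prog.exec, Prog.exec, PMF.bind_bind]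
  refine Coupled.bind_same fun as has => ?_
  rw [PMF.pure_bind]
  refine Coupled.pure ⟨_, rfl, ?_⟩
  have h1 := hB 1
  have h3 := hB 3
  have ha := hA as has
  constructor
  · simp [Config.write, Config.tick]
  · simp [Config.write, Config.tick, Expr.val]
  · simp [Config.write, Config.tick]
  · rfl
  · intro x h2 h3 _ _ _
    simp [Config.write, Config.tick, h2, h3]
  · intro x
    have := hB x
    simp only [Config.write, Config.tick, Function.update_apply, Expr.val]
    split_ifs <;> simp [Data.size] <;> omega
  · simp [Config.write, Config.tick, Expr.cost, Expr.val, Data.size]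
    omega

theorem verify_coupled (n : ℕ) {c : Config S} {B A k Y : ℕ} (h3 : 3 ≤ B)
    (hB : ∀ x, (c.regs x).size ≤ B)
    (hA : ∀ as ∈ (O .veri c.orc (c.regs 1)).support, as.1.size ≤ A) (hk : B < k)
    (hY : (B + A + 1) * (B + A + 1) ≤ Y) :
    Coupled (fun out r => ∃ c', r = some c' ∧
        Handled c B (400 * Y + (admissibleExpr n).weight * Y) out c')
      (if admissible n (c.regs 5) (c.regs 1) then
        if (logKey (c.regs 1)).mem (c.regs 3) then
          PMF.pure (Data.ofNat 1, (c.orc, c.regs 3, c.regs 4))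
        else (O .veri c.orc (c.regs 1)).map fun b =>
          (.nil, (b.2, c.regs 3, if b.1 = .ofNat 1 then c.regs 1 else c.regs 4))
      else PMF.pure (Data.bot, (c.orc, c.regs 3, c.regs 4)))
      ((verifySubroutine n).exec O k c) := by
  have hBA : B + A + 1 ≤ (B + A + 1) * (B + A + 1) := Nat.le_mul_of_pos_left _ (by omega)
  have hY' : B < Y := by omega
  have e₁ := (admissibleExpr n).cost_le_weight_mul_of_lt hB hY'
  rw [verifySubroutine, Prog.exec, val_admissibleExpr, Data.isTrue_ofBool]
  set c₁ := c.tick (1 + (admissibleExpr n).cost c.regs) with hc₁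
  have ht₁ : c₁.time = c.time + (1 + (admissibleExpr n).cost c.regs) := rfl
  split_ifs with hadm hmem
  · obtain ⟨c₂, he, h7, horc, hframe, hB₂, ht₂⟩ := search_exec (O := O) (c := c₁) h3 hB hk
    rw [Prog.exec, he, PMF.pure_bind]
    dsimp only
    rw [Prog.exec, Expr.val, h7, Data.isTrue_ofBool]
    have hmem' : (logKey (c₁.regs 1)).mem (c₁.regs 3) = true := hmem
    rw [if_pos hmem', Prog.exec]
    refine Coupled.pure ⟨_, rfl, handled_answer (c := c₂.tick _) horc hframe hB₂ ?_⟩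
    have := hB₂ 7
    have : (B + 1) * (B + 1) ≤ Y := le_trans (Nat.mul_le_mul (by omega) (by omega)) hY
    simp only [Config.tick, Expr.cost, Data.size, Data.ofNat]
    omega
  · obtain ⟨c₂, he, h7, horc, hframe, hB₂, ht₂⟩ := search_exec (O := O) (c := c₁) h3 hB hk
    rw [Prog.exec, he, PMF.pure_bind]
    dsimp only
    rw [Prog.exec, Expr.val, h7, Data.isTrue_ofBool]
    have hmem' : ¬(logKey (c₁.regs 1)).mem (c₁.regs 3) = true := hmem
    have hframe : ∀ x, x ≠ 6 → x ≠ 7 → c₂.regs x = c.regs x := hframe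
    have h1 : c₂.regs 1 = c.regs 1 := hframe 1 (by decide) (by decide)
    rw [if_neg hmem', Prog.exec, Prog.exec, PMF.bind_bind]
    simp only [Config.tick, Expr.val, horc, h1]
    refine Coupled.bind_same fun b hb => ?_
    rw [PMF.pure_bind]
    dsimp only
    have hbA := hA b hb
    have h7' := hB₂ 7
    have h1' := hB 1
    have h4' := hB₂ 4
    have : (B + 1) * (B + 1) ≤ Y := le_trans (Nat.mul_le_mul (by omega) (by omega)) hY
    rw [Prog.exec, Prog.exec]
    simp only [Expr.val, Data.isTrue_ofBool, Config.write, Function.update_self,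
      decide_eq_true_eq]
    have hsz := Data.size_ofBool_le (decide (b.1 = Data.ofNat 1))
    split_ifs with hb1
    · simp only [Prog.exec, PMF.pure_bind]
      refine Coupled.pure ⟨_, rfl, ?_⟩
      constructor
      · simp [Config.write, Expr.val]
      · simpa [Config.write, Config.tick] using hframe 3 (by decide) (by decide)
      · simp [Config.write, Config.tick, Expr.val, h1, hb1]
      · rfl
      · intro x h2 h3 h4 h6 h7
        simpa [Config.write, Config.tick, h2, h4] using hframe x h6 h7
      · intro x
        have := hB₂ x
        simp only [Config.write, Config.tick, Function.update_apply, Expr.val, h1]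
        split_ifs <;> simp [Data.size] <;> omega
      · simp [Config.write, Config.tick, Expr.cost, Expr.val, Data.size, h1, Data.size_ofNat]
        omega
    · simp only [Prog.exec, PMF.pure_bind]
      refine Coupled.pure ⟨_, rfl, ?_⟩
      constructor
      · simp [Config.write, Expr.val]
      · simpa [Config.write, Config.tick] using hframe 3 (by decide) (by decide)
      · simpa [Config.write, Config.tick, Expr.val, hb1] using hframe 4 (by decide) (by decide)
      · rfl
      · intro x h2 h3 h4 h6 h7
        simpa [Config.write, Config.tick, h2, h4] using hframe x h6 h7
      · intro x
        have := hB₂ x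
        simp only [Config.write, Config.tick, Function.update_apply, Expr.val]
        split_ifs <;> simp [Data.size] <;> omega
      · simp [Config.write, Config.tick, Expr.cost, Expr.val, Data.size, h1, Data.size_ofNat]
        omega
  · rw [Prog.exec]
    refine Coupled.pure ⟨_, rfl, handled_answer (c := c₁) rfl (fun _ _ _ => rfl) hB ?_⟩
    simp only [Expr.cost, Data.size]
    omega

/-- The search makes the time quadratic in the memory: at most `B` iterations, each of cost linear
in `B`. The remaining steps are linear. -/
theorem subroutine_coupled (n : ℕ) {o : OracleName} {c : Config S} {B A k : ℕ} (h3 : 3 ≤ B)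
    (hB : ∀ x, (c.regs x).size ≤ B)
    (hA : ∀ o s, ∀ as ∈ (O o s (c.regs 1)).support, as.1.size ≤ A) (hk : B < k) :
    Coupled (fun out r => ∃ c', r = some c' ∧
        Handled c B ((500 + (admissibleExpr n).weight) * ((B + A + 1) * (B + A + 1))) out c')
      (logOracles n (c.regs 5) O o (c.orc, c.regs 3, c.regs 4) (c.regs 1))
      ((subroutine n o).exec O k c) := by
  set Y := (B + A + 1) * (B + A + 1) with hY
  have hBY : B + A + 1 ≤ Y := Nat.le_mul_of_pos_left _ (by omega)
  have hC : (500 + (admissibleExpr n).weight) * Y = 500 * Y + (admissibleExpr n).weight * Y := by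
    ring
  rw [hC]
  have h4 := hB 4
  have record : ∀ o, Coupled (fun out r => ∃ c', r = some c' ∧
        Handled c B (500 * Y + (admissibleExpr n).weight * Y) out c')
      ((O o c.orc (c.regs 1)).map fun a =>
        (a.1, (a.2, .cons (.cons a.1 (c.regs 1)) (c.regs 3), c.regs 4)))
      ((recordSubroutine o).exec O k (c.tick (1 + (Expr.reg 4).cost c.regs))) := fun o =>
    (record_coupled (c := c.tick _) hB (hA o _) (Y := Y) (by omega)).mono
      fun _ _ _ _ ⟨c', hr, hc'⟩ => ⟨c', hr, hc'.of_tick (by simp only [Expr.cost]; omega)⟩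
  by_cases hflag : (c.regs 4).isTrue = true
  · have e₁ : logOracles n (c.regs 5) O o (c.orc, c.regs 3, c.regs 4) (c.regs 1) =
      PMF.pure (.bot, (c.orc, c.regs 3, c.regs 4)) := if_pos hflag
    have e₂ : (subroutine n o).exec O k c =
      (Prog.assign 2 (.const .bot)).exec O k (c.tick (1 + (Expr.reg 4).cost c.regs)) :=
      if_pos hflag
    rw [e₁, e₂]
    refine Coupled.pure ⟨_, rfl, handled_answer (c := c.tick _) rfl (fun _ _ _ => rfl) hB ?_⟩
    simp only [Config.tick, Expr.cost, Data.size]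
    omega
  · cases o with
    | veri =>
      have e₁ : logOracles n (c.regs 5) O .veri (c.orc, c.regs 3, c.regs 4) (c.regs 1) = _ :=
        if_neg hflag
      have e₂ : (subroutine n .veri).exec O k c = (verifySubroutine n).exec O k
        (c.tick (1 + (Expr.reg 4).cost c.regs)) := if_neg hflag
      rw [e₁, e₂]
      exact (verify_coupled n (c := c.tick _) h3 hB (hA .veri _) hk hY.ge).mono
        fun _ _ _ _ ⟨c', hr, hc'⟩ => ⟨c', hr, hc'.of_tick (by simp only [Expr.cost]; omega)⟩
    | sign =>
      have e₁ : logOracles n (c.regs 5) O .sign (c.orc, c.regs 3, c.regs 4) (c.regs 1) = _ :=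
        if_neg hflag
      have e₂ : (subroutine n .sign).exec O k c = (recordSubroutine .sign).exec O k
        (c.tick (1 + (Expr.reg 4).cost c.regs)) := if_neg hflag
      rw [e₁, e₂]
      exact record .sign
    | sim =>
      have e₁ : logOracles n (c.regs 5) O .sim (c.orc, c.regs 3, c.regs 4) (c.regs 1) = _ :=
        if_neg hflag
      have e₂ : (subroutine n .sim).exec O k c = (recordSubroutine .sim).exec O k
        (c.tick (1 + (Expr.reg 4).cost c.regs)) := if_neg hflag
      rw [e₁, e₂]
      exact record .sim

end Subroutine

/-! ### Compiling programs with `logOracles` -/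

/-- Replace the oracles by subroutines, and move the registers by `ρ`. -/
def compile (n : ℕ) (ρ : ℕ → ℕ) (p : Prog OracleName) : Prog OracleName :=
  p.translate ρ fun o x e =>
    .seq (.assign 1 (e.rename ρ)) (.seq (subroutine n o) (.assign (ρ x) (.reg 2)))

/-- `c'` represents the configuration `c` of the program before compilation. -/
structure Represents {S : Type} (ρ : ℕ → ℕ) (c₀ : Config S) (L H : ℕ)
    (c : Config (S × Data × Data)) (c' : Config S) : Prop where
  regs : ∀ x, c'.regs (ρ x) = c.regs x
  chal : c'.regs 5 = c₀.regs 5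
  log : c'.regs 3 = c.orc.2.1
  flag : c'.regs 4 = c.orc.2.2
  orc : c'.orc = c.orc.1
  -- Only the registers `1` to `7` and the range of `ρ` are touched; this lets a second phase be
  -- placed in other registers of the same program.
  frame : ∀ x, (x = 0 ∨ 8 ≤ x) → x ∉ Set.range ρ → c'.regs x = c₀.regs x
  -- The clock is that of the original run, which is charged for each query and each answer; the
  -- factor `2` leaves room for storing them in the log.
  size : ∀ x, (c'.regs x).size ≤ L + 2 * c.time
  -- Every call takes at least one unit in the original run, so `H` per unit pays for the
  -- subroutine.
  time : c'.time ≤ c₀.time + (H + 2) * c.time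

theorem compile_coupled {S : Type} {O : Oracles OracleName S} (n : ℕ) {ρ : ℕ → ℕ}
    (hρ : Function.Injective ρ) (hρ8 : ∀ x, 8 ≤ ρ x) {c₀ : Config S} {L t A k k' H : ℕ}
    (h3 : 3 ≤ L) (hA : ∀ o s d, d.size ≤ t → ∀ as ∈ (O o s d).support, as.1.size ≤ A)
    (hk' : L + 3 * t < k')
    (hH : (500 + (admissibleExpr n).weight) * ((L + 3 * t + A + 1) * (L + 3 * t + A + 1)) ≤ H)
    (p : Prog OracleName) (c : Config (S × Data × Data)) (c' : Config S)
    (hc : Represents ρ c₀ L H c c') :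
    Coupled (Matching (fun c => t < c.time) (fun _ => False) (Represents ρ c₀ L H))
      (p.exec (logOracles n (c₀.regs 5) O) k c) ((compile n ρ p).exec O k' c') := by
  refine exec_translate (T := t) (Or.inl ⟨by omega, fun _ h => h⟩) (isInvariant_le_time _ (t + 1))
    (isInvariant_false _) (fun _ _ h => h.regs) ?_ ?_ ?_ p c c' hc
  · intro c c' a h
    refine { h with size := fun x => ?_, time := ?_ }
    · have := h.size x
      simp only [Config.tick]
      omega
    · have := h.time
      simp only [Config.tick]
      nlinarith
  · intro c c' a x d h hd
    have hne : ∀ y, y < 8 → y ≠ ρ x := fun y hy h => by have := hρ8 x; omega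
    constructor
    · intro y
      have := h.regs y
      by_cases hxy : y = x
      · simp [Config.write, hxy]
      · simpa [Config.write, Config.tick, hxy, hρ.eq_iff] using this
    · simpa [Config.write, Config.tick, hne] using h.chal
    · simpa [Config.write, Config.tick, hne] using h.log
    · simpa [Config.write, Config.tick, hne] using h.flag
    · exact h.orc
    · intro y hy hyρ
      have : y ≠ ρ x := fun h => hyρ ⟨x, h.symm⟩
      simpa [Config.write, Config.tick, this] using h.frame y hy hyρ
    · intro y
      have := h.size y
      simp only [Config.write, Config.tick, Function.update_apply]
      split_ifs <;> omega
    · have := h.time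
      simp only [Config.write, Config.tick]
      nlinarith
  · intro c c' o x e h
    have hne : ∀ y, y < 8 → y ≠ ρ x := fun y hy h => by have := hρ8 x; omega
    have hq := e.size_val_le_cost c.regs
    -- A call that overruns the time limit by its query alone is dead afterwards. Otherwise the
    -- query has size at most `t`, and the bounds for the answer, for the memory and for the search
    -- apply.
    by_cases hlate : t < c.time + (1 + e.cost c.regs)
    · refine Coupled.of_forall fun r hr _ _ => .dead_left ?_
      rintro c₁ rfl
      simp only [Prog.exec, PMF.mem_support_bind_iff, PMF.support_pure, Set.mem_singleton_iff,
        Option.some.injEq] at hr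
      obtain ⟨as, _, rfl⟩ := hr
      simp only [Config.write]
      omega
    · rw [Prog.exec, Prog.exec, Prog.exec, PMF.pure_bind]
      dsimp only
      rw [Prog.exec, Expr.val_rename h.regs, Expr.cost_rename h.regs]
      set q := e.val c.regs with hqdef
      set c₁ := (c'.tick (1 + e.cost c.regs)).write 1 q with hc₁
      have hr₁ : ∀ y, y ≠ 1 → c₁.regs y = c'.regs y := fun y hy => by
        simp [hc₁, Config.write, Config.tick, hy]
      have hr₁' : c₁.regs 1 = q := by simp [hc₁, Config.write]
      have hsize : ∀ y, (c₁.regs y).size ≤ L + 2 * c.time + q.size := fun y => by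
        by_cases hy : y = 1
        · subst hy; rw [hr₁']; omega
        · have := h.size y
          rw [hr₁ y hy]; omega
      have hsub := subroutine_coupled (O := O) n (o := o) (c := c₁) (A := A) (k := k')
        (B := L + 2 * c.time + q.size) (by omega) hsize
        (fun o s => hA o s _ (by rw [hr₁']; omega)) (by omega)
      have horc : c₁.orc = c.orc.1 := h.orc
      rw [hr₁', hr₁ 5 (by decide), hr₁ 3 (by decide), hr₁ 4 (by decide), horc, h.chal, h.log,
        h.flag] at hsub
      refine hsub.bind fun out _ r _ hr => ?_
      obtain ⟨c₂, rfl, hc₂⟩ := hr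
      dsimp only
      rw [Prog.exec]
      refine Coupled.pure (.some ?_)
      have hHle := le_trans (Nat.mul_le_mul_left _ (Nat.mul_le_mul
        (show L + 2 * c.time + q.size + A + 1 ≤ L + 3 * t + A + 1 by omega)
        (show L + 2 * c.time + q.size + A + 1 ≤ L + 3 * t + A + 1 by omega))) hH
      have htime := hc₂.time.trans (Nat.add_le_add_left hHle _)
      have ht₁ : c₁.time = c'.time + (1 + e.cost c.regs) := rfl
      have ht' := h.time
      have hfr : ∀ y, y ≠ 1 → y ≠ 2 → y ≠ 3 → y ≠ 4 → y ≠ 6 → y ≠ 7 →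
          c₂.regs y = c'.regs y := fun y h1 h2 h3 h4 h6 h7 =>
        (hc₂.frame y h2 h3 h4 h6 h7).trans (hr₁ y h1)
      have hfr8 : ∀ y, (y = 0 ∨ 8 ≤ y) → c₂.regs y = c'.regs y := fun y hy => hfr y (by omega) (by omega)
        (by omega) (by omega) (by omega) (by omega)
      constructor
      · intro y
        by_cases hxy : y = x
        · simp [Config.write, hxy, Expr.val, hc₂.ans]
        · simpa [Config.write, Config.tick, hxy, hρ.eq_iff, hfr8 _ (Or.inr (hρ8 y))] using h.regs y
      · simpa [Config.write, Config.tick, hne] using (hfr 5 (by decide) (by decide) (by decide)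
          (by decide) (by decide) (by decide)).trans h.chal
      · simpa [Config.write, Config.tick, hne] using hc₂.log
      · simpa [Config.write, Config.tick, hne] using hc₂.flag
      · exact hc₂.orc
      · intro y hy hyρ
        have : y ≠ ρ x := fun h => hyρ ⟨x, h.symm⟩
        simpa [Config.write, Config.tick, this, hfr8 y hy] using h.frame y hy hyρ
      · intro y
        have h1 := hc₂.size y
        have h2 := hc₂.size 2
        rw [hr₁'] at h1
        simp only [Config.write, Config.tick, Function.update_apply, Expr.val]
        split_ifs
        · rw [hc₂.ans]; omega
        · omega
      · simp only [Config.write, Config.tick, Expr.cost, hc₂.ans]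
        nlinarith

/-- Running a compiled program from a configuration that represents the initial one. -/
theorem Prog.HaltsIn.compile_coupled {S : Type} {O : Oracles OracleName S} {n : ℕ} {ρ : ℕ → ℕ}
    {c₀ : Config S} {L t A k' H : ℕ} {p : Prog OracleName} {x : Data}
    (hp : p.HaltsIn (logOracles n (c₀.regs 5) O) (c₀.orc, c₀.regs 3, c₀.regs 4) x t)
    (hρ : Function.Injective ρ) (hρ8 : ∀ x, 8 ≤ ρ x)
    (h3 : 3 ≤ L) (hA : ∀ o s d, d.size ≤ t → ∀ as ∈ (O o s d).support, as.1.size ≤ A)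
    (hk' : L + 3 * t < k')
    (hH : (500 + (admissibleExpr n).weight) * ((L + 3 * t + A + 1) * (L + 3 * t + A + 1)) ≤ H)
    (hx : ∀ y, c₀.regs (ρ y) = if y = 0 then x else .nil) (hL : ∀ y, (c₀.regs y).size ≤ L) :
    Coupled (fun out r => ∃ c', r = some c' ∧ c'.regs (ρ 0) = out.1 ∧ c'.orc = out.2.1 ∧
        c'.regs 3 = out.2.2.1 ∧ c'.regs 4 = out.2.2.2 ∧
        (∀ y, (y = 0 ∨ 8 ≤ y) → y ∉ Set.range ρ → c'.regs y = c₀.regs y) ∧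
        (∀ y, (c'.regs y).size ≤ L + 2 * t) ∧ c'.time ≤ c₀.time + (H + 2) * t)
      (p.output (logOracles n (c₀.regs 5) O) (c₀.orc, c₀.regs 3, c₀.regs 4) x)
      ((compile n ρ p).exec O k' c₀) := by
  rw [hp.output_eq (Nat.lt_succ_self t), ← PMF.map_id ((compile n ρ p).exec O k' c₀)]
  refine (DesignatedVerifier.compile_coupled n hρ hρ8 h3 hA hk' hH p _ c₀
    ⟨fun y => ?_, rfl, rfl, rfl, rfl, fun _ _ _ => rfl, fun y => (hL y).trans (by simp),
      by simp⟩).map fun a ha b hb hab => ?_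
  · rw [hx]
    simp [Config.init, Function.update_apply]
  · obtain ⟨c, rfl, hc⟩ := hp.forall_support (Nat.lt_succ_self t) a ha
    rcases hab with hab | ⟨⟨_, hab⟩, _⟩ | ⟨c₁, c', h₁, rfl, hab⟩
    · exact absurd (hab c rfl) (by omega)
    · exact hab.elim
    · cases h₁
      refine ⟨c', rfl, hab.regs 0, hab.orc, hab.log, hab.flag, hab.frame, fun y => ?_, ?_⟩
      · exact (hab.size y).trans (by omega)
      · exact hab.time.trans (Nat.add_le_add_left (Nat.mul_le_mul_left _ hc) _)

/-! ### The reductions -/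

theorem polynomial_eval_mono (p : Polynomial ℕ) : Monotone fun N => p.eval N := by
  intro a b hab
  simp only [Polynomial.eval_eq_sum, Polynomial.sum]
  exact Finset.sum_le_sum fun i _ => by gcongr

/-- The answers of the oracles are of length at most `l`. -/
def BoundedBy {ι S : Type} (O : Oracles ι S) (l : Polynomial ℕ) (N : ℕ) : Prop :=
  ∀ o s d, ∀ as ∈ (O o s d).support, as.1.size ≤ l.eval (N + d.size)

theorem BoundedBy.mono {ι S : Type} {O : Oracles ι S} {l : Polynomial ℕ} {N M : ℕ}
    (h : BoundedBy O l N) (hNM : N ≤ M) : BoundedBy O l M := fun o s d as has =>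
  (h o s d as has).trans (polynomial_eval_mono l (by omega))

/-- The only new answers are bits and `⊥`, of size at most `3`; so a bound for `O` yields one that
the adversary's running time can be applied to. -/
theorem BoundedBy.logOracles {S : Type} {O : Oracles OracleName S} {l : Polynomial ℕ} {N : ℕ}
    (h : BoundedBy O l N) (n : ℕ) (chal : Data) :
    BoundedBy (logOracles n chal O) (l + 3) N := by
  intro o st q as has
  have key : ∀ a, a ≤ 3 → a ≤ (l + 3).eval (N + q.size) := fun a ha => by
    simp only [Polynomial.eval_add, Polynomial.eval_ofNat]
    omega
  have key' : ∀ o s (F : Data × S → Data × Data), as ∈ ((O o s q).map fun a =>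
      (a.1, (a.2, F a))).support → as.1.size ≤ (l + 3).eval (N + q.size) := by
    intro o s F has
    rw [PMF.mem_support_map_iff] at has
    obtain ⟨a, ha, rfl⟩ := has
    have := h o s q a ha
    simp only [Polynomial.eval_add, Polynomial.eval_ofNat]
    omega
  unfold DesignatedVerifier.logOracles at has
  split_ifs at has with h1 h2 h3
  · rw [PMF.support_pure, Set.mem_singleton_iff] at has
    subst has
    exact key _ (by simp [Data.size])
  · cases o with
    | veri =>
      simp only [PMF.support_pure, Set.mem_singleton_iff] at has
      subst has
      exact key _ (by simp [Data.size_ofNat])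
    | sign => exact key' _ _ _ has
    | sim => exact key' _ _ _ has
  · cases o with
    | veri =>
      simp only [PMF.mem_support_map_iff] at has
      obtain ⟨a, _, rfl⟩ := has
      exact key _ (by simp [Data.size])
    | sign => exact key' _ _ _ has
    | sim => exact key' _ _ _ has
  · cases o with
    | veri =>
      simp only [PMF.support_pure, Set.mem_singleton_iff] at has
      subst has
      exact key _ (by simp [Data.size])
    | sign => exact key' _ _ _ has
    | sim => exact key' _ _ _ has

/-- The program halts within `t` units of time, and `μ` is the law of its output. -/
def Prog.Implements {ι S : Type} (O : Oracles ι S) (p : Prog ι) (s : S) (x : Data)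
    (μ : PMF (Data × S)) (t : ℕ) : Prop :=
  ∃ k, Coupled (fun out r => ∃ c, r = some c ∧ c.regs 0 = out.1 ∧ c.orc = out.2 ∧ c.time ≤ t) μ
    (p.exec O k (Config.init s x))

theorem Prog.Implements.haltsIn {ι S : Type} {O : Oracles ι S} {p : Prog ι} {s : S} {x : Data}
    {μ : PMF (Data × S)} {t : ℕ} (h : p.Implements O s x μ t) : p.HaltsIn O s x t := by
  obtain ⟨k, hk⟩ := h
  refine ⟨k, fun r hr => ?_⟩
  obtain ⟨_, _, c, hc, _, _, ht⟩ := hk.exists_of_mem_support hr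
  exact ⟨c, hc, ht⟩

theorem Prog.Implements.output_eq {ι S : Type} {O : Oracles ι S} {p : Prog ι} {s : S} {x : Data}
    {μ : PMF (Data × S)} {t : ℕ} (h : p.Implements O s x μ t) : p.output O s x = μ := by
  obtain ⟨k, hk⟩ := h
  rw [output_eq_map (j := k) fun r hr => ?_, ← PMF.map_id μ]
  · refine (hk.map_eq_map ?_).symm
    rintro a _ _ _ ⟨c, rfl, h0, ho, _⟩
    simp [Config.result, h0, ho]
  · obtain ⟨_, _, c, hc, _⟩ := hk.exists_of_mem_support hr
    exact ⟨c, hc⟩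

/-- The configuration after an assignment. -/
def Config.assign {S : Type} (c : Config S) (x : ℕ) (e : Expr) : Config S :=
  (c.tick (1 + e.cost c.regs)).write x (e.val c.regs)

theorem exec_seq_assign {ι S : Type} (O : Oracles ι S) (k x : ℕ) (e : Expr) (p : Prog ι)
    (c : Config S) : (Prog.seq (.assign x e) p).exec O k c =
      p.exec O k (c.assign x e) := by
  rw [Prog.exec, Prog.exec, PMF.pure_bind]
  rfl

/-- The place of the registers of a first-phase program. -/
def evenReg (x : ℕ) : ℕ := 16 + 2 * x

/-- The place of the registers of a second-phase program. -/
def oddReg (x : ℕ) : ℕ := 17 + 2 * x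

theorem evenReg_injective : Function.Injective evenReg := fun a b h => by
  simp only [evenReg] at h; omega

theorem oddReg_injective : Function.Injective oddReg := fun a b h => by
  simp only [oddReg] at h; omega

/-- A bound for the time that a subroutine takes. -/
def overhead (n L t A : ℕ) : ℕ :=
  (500 + (admissibleExpr n).weight) * ((L + 3 * t + A + 1) * (L + 3 * t + A + 1))

/-- The first phase of the adversary that does without verification oracles. -/
def privacyProg₁ (n : ℕ) (p : Prog OracleName) : Prog OracleName :=
  .seq (.assign 16 (.reg 0)) (.seq (compile n evenReg p)
    (.assign 0 (.cons (.fst (.reg 16)) (.cons (.snd (.reg 16)) (.cons (.reg 3) (.reg 4))))))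

/-- The output of `privacyProg₁`: the log is appended to the state. -/
def appendLog {S : Type} (out : Data × S × Data × Data) : Data × S :=
  (.cons out.1.fst (.cons out.1.snd (.cons out.2.2.1 out.2.2.2)), out.2.1)

section Reductions

variable {S : Type} {O : Oracles OracleName S} {n : ℕ} {s : S} {x : Data}

/-- The second phase is a separate machine, so the log and the flag travel inside the state that the
first phase outputs. The summands of the time are the copying of the input, the compiled program,
and the assembly of the output. -/
theorem privacyProg₁_implements {p : Prog OracleName} {N t A : ℕ}
    (hp : p.HaltsIn (logOracles n .nil O) (s, .nil, .nil) x t) (hx : x.size ≤ N)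
    (hA : ∀ o s d, d.size ≤ t → ∀ as ∈ (O o s d).support, as.1.size ≤ A) :
    (privacyProg₁ n p).Implements O s x
      ((p.output (logOracles n .nil O) (s, .nil, .nil) x).map appendLog)
      (1 + N + (overhead n (N + 3) t A + 2) * t + 1 + 100 * (N + 3 + 2 * t + 1)) := by
  set c₀ : Config S := (Config.init s x).assign 16 (.reg 0) with hc₀
  have hreg : ∀ y, c₀.regs y = if y = 0 ∨ y = 16 then x else .nil := fun y => by
    simp only [hc₀, Config.assign, Config.write, Config.tick, Config.init, Expr.val, Function.update_apply]
    split_ifs <;> simp_all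
  have ht₀ : c₀.time ≤ 1 + N := by
    simp only [hc₀, Config.assign, Config.write, Config.tick, Config.init, Expr.cost, Function.update_self]
    omega
  have h5 : c₀.regs 5 = .nil := by simp [hreg]
  have h3 : c₀.regs 3 = .nil := by simp [hreg]
  have h4 : c₀.regs 4 = .nil := by simp [hreg]
  have horc : c₀.orc = s := rfl
  have hp' : p.HaltsIn (logOracles n (c₀.regs 5) O) (c₀.orc, c₀.regs 3, c₀.regs 4) x t := by
    rwa [h5, h3, h4, horc]
  -- `N` bounds the registers at the start, and `+ 3` provides the room for bits that the search
  -- demands.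
  have main := hp'.compile_coupled (L := N + 3) (A := A) (k' := N + 3 + 3 * t + 1)
    evenReg_injective (fun y => by simp only [evenReg]; omega) (by omega) hA (by omega) le_rfl
    (fun y => by
      rw [hreg]
      rcases Nat.eq_zero_or_pos y with rfl | hy
      · rfl
      · rw [if_neg (by simp only [evenReg]; omega), if_neg (by omega)])
    (fun y => by rw [hreg]; split_ifs <;> first | omega | (simp only [Data.size]; omega))
  rw [h5, h3, h4, horc] at main
  refine ⟨N + 3 + 3 * t + 1, ?_⟩
  rw [privacyProg₁, exec_seq_assign, ← hc₀, Prog.exec]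
  refine main.bind fun out _ r _ hr => ?_
  obtain ⟨c, rfl, h0, ho, hlog, hflag, -, hsize, htime⟩ := hr
  dsimp only
  rw [Prog.exec]
  refine Coupled.pure ⟨_, rfl, ?_, ho, ?_⟩
  · simp only [Config.write, Function.update_self, Expr.val, appendLog, hlog, hflag]
    rw [← h0]; rfl
  · have := Expr.cost_le_weight_mul hsize (.cons (.fst (.reg 16)) (.cons (.snd (.reg 16))
      (.cons (.reg 3) (.reg 4))))
    simp only [Expr.weight] at this
    have h' : c.time ≤ c₀.time + (overhead n (N + 3) t A + 2) * t := htime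
    simp only [Config.write, Config.tick]
    omega

/-- The second phase of the adversary that does without verification oracles. -/
def privacyProg₂ (n : ℕ) (p : Prog OracleName) : Prog OracleName :=
  let x := Expr.reg 0
  .seq (.assign 3 x.snd.fst.snd.fst) <| .seq (.assign 4 x.snd.fst.snd.snd) <|
  .seq (.assign 5 (.cons (.const .nil) x.snd.snd.fst)) <|
  .seq (.assign 16 (.cons x.fst (.cons x.snd.fst.fst x.snd.snd))) <|
  .seq (compile n evenReg p) (.assign 0 (.reg 16))

/-- The input of the second phase without the log. -/
def removeLog (x : Data) : Data := .cons x.fst (.cons x.snd.fst.fst x.snd.snd)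

theorem size_removeLog_le (x : Data) : (removeLog x).size ≤ 3 * x.size + 2 := by
  have h₁ := x.size_fst_le
  have h₂ := x.snd.fst.size_fst_le.trans (x.snd.size_fst_le.trans x.size_snd_le)
  have h₃ := x.snd.size_snd_le.trans x.size_snd_le
  simp only [removeLog, Data.size]
  omega

/-- On the inputs that occur in the game, `x` is the list of `1^κ`, `(state, (log, flag))` and `σ*`,
which the projections decode. The bound `3 * N + 2` is the one for `removeLog`. -/
theorem privacyProg₂_implements {p : Prog OracleName} {N t A : ℕ}
    (hp : p.HaltsIn (logOracles n (.cons .nil x.snd.snd.fst) O)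
      (s, x.snd.fst.snd.fst, x.snd.fst.snd.snd) (removeLog x) t) (hx : x.size ≤ N)
    (hA : ∀ o s d, d.size ≤ t → ∀ as ∈ (O o s d).support, as.1.size ≤ A) :
    (privacyProg₂ n p).Implements O s x
      ((p.output (logOracles n (.cons .nil x.snd.snd.fst) O)
        (s, x.snd.fst.snd.fst, x.snd.fst.snd.snd) (removeLog x)).map
          fun out => (out.1, out.2.1))
      (200 * (3 * N + 3) + (overhead n (3 * N + 2) t A + 2) * t + (1 + (3 * N + 2 + 2 * t))) := by
  have hx1 := x.one_le_size
  have hrem := size_removeLog_le x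
  have hsn := x.size_snd_le
  have hsf := x.snd.size_fst_le
  have hss := x.snd.size_snd_le
  have hsfs := x.snd.fst.size_snd_le
  have hsff := x.snd.fst.size_fst_le
  have hf := x.size_fst_le
  have hlog := x.snd.fst.snd.size_fst_le
  have hflag := x.snd.fst.snd.size_snd_le
  have hsig := x.snd.snd.size_fst_le
  obtain ⟨c₀, hc₀, hreg, horc, ht₀⟩ : ∃ c₀ : Config S,
      (∀ k, (privacyProg₂ n p).exec O k (Config.init s x) =
        (Prog.seq (compile n evenReg p) (.assign 0 (.reg 16))).exec O k c₀) ∧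
      (∀ y, c₀.regs y = if y = 0 then x else if y = 3 then x.snd.fst.snd.fst else
        if y = 4 then x.snd.fst.snd.snd else if y = 5 then .cons .nil x.snd.snd.fst else
        if y = 16 then removeLog x else .nil) ∧ c₀.orc = s ∧ c₀.time ≤ 200 * (3 * N + 3) := by
    let e := Expr.reg 0
    refine ⟨((((Config.init s x).assign 3 e.snd.fst.snd.fst).assign 4 e.snd.fst.snd.snd).assign 5
      (.cons (.const .nil) e.snd.snd.fst)).assign 16 (.cons e.fst (.cons e.snd.fst.fst e.snd.snd)),
      fun k => ?_, fun y => ?_, ?_, ?_⟩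
    · rw [privacyProg₂, exec_seq_assign, exec_seq_assign, exec_seq_assign, exec_seq_assign]
    · simp only [e, Config.assign, Config.write, Config.tick, Config.init, Expr.val,
        Function.update_apply]
      by_cases h0 : y = 0
      · simp [h0]
      · by_cases h16 : y = 16
        · simp [h16, removeLog]
        · simp only [h0, h16]
          split_ifs <;> simp_all
    · rfl
    · simp only [e, Config.assign, Config.write, Config.tick, Config.init, Expr.val, Function.update_apply, Expr.cost,
        Data.size]
      simp
      omega
  have h5 : c₀.regs 5 = .cons .nil x.snd.snd.fst := by simp [hreg]
  have h3 : c₀.regs 3 = x.snd.fst.snd.fst := by simp [hreg]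
  have h4 : c₀.regs 4 = x.snd.fst.snd.snd := by simp [hreg]
  have hp' : p.HaltsIn (logOracles n (c₀.regs 5) O) (c₀.orc, c₀.regs 3, c₀.regs 4)
      (removeLog x) t := by
    rwa [h5, h3, h4, horc]
  have main := hp'.compile_coupled (L := 3 * N + 2) (A := A) (k' := 3 * N + 2 + 3 * t + 1)
    evenReg_injective (fun y => by simp only [evenReg]; omega) (by omega) hA (by omega) le_rfl
    (fun y => by
      rw [hreg]
      rcases Nat.eq_zero_or_pos y with rfl | hy
      · rfl
      · have : evenReg y = 16 + 2 * y := rfl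
        rw [if_neg (by omega), if_neg (by omega), if_neg (by omega), if_neg (by omega),
          if_neg (by omega), if_neg (by omega)])
    (fun y => by
      rw [hreg]
      split_ifs <;> first | omega | (simp only [Data.size]; omega))
  rw [h5, h3, h4, horc] at main
  refine ⟨3 * N + 2 + 3 * t + 1, ?_⟩
  rw [hc₀, Prog.exec]
  refine main.bind fun out _ r _ hr => ?_
  obtain ⟨c, rfl, h0, ho, -, -, -, hsize, htime⟩ := hr
  dsimp only
  rw [Prog.exec]
  refine Coupled.pure ⟨_, rfl, ?_, ho, ?_⟩
  · simp only [Config.write, Function.update_self, Expr.val]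
    exact h0
  · have := hsize 16
    have h' : c.time ≤ c₀.time + (overhead n (3 * N + 2) t A + 2) * t := htime
    simp only [Config.write, Config.tick, Expr.cost]
    omega

end Reductions

/-! ### The forger -/

/-- Ask for the challenge signature, and run the second phase. -/
def challengeProg (n c : ℕ) (p : Prog OracleName) : Prog OracleName :=
  .seq (.call .sign 2 (.cons (.fst (.reg 16)) (.const (.cons (.ofNat c) (.ofNat n))))) <|
  .seq (.assign 5 (.cons (.const .nil) (.reg 2))) <|
  .seq (.assign 17 (.cons (.fst (.reg 0)) (.cons (.snd (.reg 16))
    (.cons (.reg 2) (.const .nil))))) (compile n oddReg p)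

/-- Run both phases of a privacy adversary with challenge sender `c`, and output the first accepted
verification query that is not justified by the log. -/
def forgerProg (n c : ℕ) (p₁ p₂ : Prog OracleName) : Prog OracleName :=
  .seq (.assign 16 (.reg 0)) (.seq (compile n evenReg p₁)
    (.seq (.cond (.reg 4) (.assign 4 (.reg 4)) (challengeProg n c p₂)) (.assign 0 (.reg 4))))

/-- The second part of `attack`. -/
def attackSnd {S : Type} (O : Oracles OracleName S) (n c : ℕ) (p₂ : Prog OracleName) (x : Data)
    (out : Data × S × Data × Data) : PMF (Data × S × Data × Data) :=
  if out.2.2.2.isTrue then PMF.pure out else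
  (O .sign out.2.1 (.cons out.1.fst (.cons (.ofNat c) (.ofNat n)))).bind fun as =>
  p₂.output (logOracles n (.cons .nil as.1) O) (as.2, out.2.2.1, out.2.2.2)
    (Data.ofList [x.fst, out.1.snd, as.1])

/-- The two phases of a privacy adversary with oracles that answer verification queries by means of
the log. -/
def attack {S : Type} (O : Oracles OracleName S) (n c : ℕ) (p₁ p₂ : Prog OracleName) (s : S)
    (x : Data) : PMF (Data × S × Data × Data) :=
  (p₁.output (logOracles n .nil O) (s, .nil, .nil) x).bind (attackSnd O n c p₂ x)

/-- A bound for the memory in use when the second phase starts. -/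
def forgerSize (N t₁ A : ℕ) : ℕ := 2 * N + 2 * t₁ + A + 7

/-- A bound for the running time. -/
def forgerTime (n c N t₁ t₂ A A₂ : ℕ) : ℕ :=
  1 + N + (overhead n (N + 3) t₁ A + 2) * t₁ + (500 + 8 * (c + n)) * (forgerSize N t₁ A + 1) +
    (overhead n (forgerSize N t₁ A) t₂ A₂ + 2) * t₂ + (1 + (forgerSize N t₁ A + 2 * t₂))

section Forger

variable {S : Type} {O : Oracles OracleName S} {n c : ℕ} {s : S} {x : Data}

/-- The forger obtains the challenge from its signing oracle without entering it in register `3`, so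
the log is the one that the adversary without verification would hold. Register `5` excludes the
challenge from verification queries. The odd registers are still empty and can host the second
phase. -/
theorem challengeProg_coupled {p₂ : Prog OracleName} {N t₁ t₂ A A₂ : ℕ}
    (hp₂ : ∀ chal s x, x.size ≤ forgerSize N t₁ A → p₂.HaltsIn (logOracles n chal O) s x t₂)
    (hx : x.size ≤ N) (hA : ∀ o s d, d.size ≤ N + 2 * t₁ + 2 * c + 2 * n + 10 →
      ∀ as ∈ (O o s d).support, as.1.size ≤ A)
    (hA₂ : ∀ o s d, d.size ≤ t₂ → ∀ as ∈ (O o s d).support, as.1.size ≤ A₂) {k : ℕ}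
    (hk : forgerSize N t₁ A + 3 * t₂ < k)
    {out : Data × S × Data × Data} {c₁ : Config S} (h16 : c₁.regs 16 = out.1)
    (horc : c₁.orc = out.2.1) (h3 : c₁.regs 3 = out.2.2.1) (h4 : c₁.regs 4 = out.2.2.2)
    (h0 : c₁.regs 0 = x) (hodd : ∀ y, c₁.regs (oddReg y) = .nil)
    (hsize : ∀ y, (c₁.regs y).size ≤ N + 3 + 2 * t₁) (hflag : ¬ out.2.2.2.isTrue = true) :
    Coupled (fun res r => ∃ c', r = some c' ∧ c'.regs 4 = res.2.2.2 ∧ c'.orc = res.2.1 ∧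
        (c'.regs 4).size ≤ forgerSize N t₁ A + 2 * t₂ ∧
        c'.time ≤ c₁.time + (400 + 8 * (c + n)) * (forgerSize N t₁ A + 1) +
          (overhead n (forgerSize N t₁ A) t₂ A₂ + 2) * t₂)
      (attackSnd O n c p₂ x out) ((challengeProg n c p₂).exec O k c₁) := by
  have hL : forgerSize N t₁ A = 2 * N + 2 * t₁ + A + 7 := rfl
  rw [attackSnd, if_neg hflag, challengeProg, Prog.exec, Prog.exec, PMF.bind_bind]
  have hq : (Expr.cons (.fst (.reg 16)) (.const (.cons (.ofNat c) (.ofNat n)))).val c₁.regs =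
      .cons out.1.fst (.cons (.ofNat c) (.ofNat n)) := by
    simp only [Expr.val, h16]
  have hm := (Data.size_fst_le (c₁.regs 16)).trans (hsize 16)
  have hst := (Data.size_snd_le (c₁.regs 16)).trans (hsize 16)
  have hκ := x.size_fst_le
  have h16s := hsize 16
  rw [hq, horc]
  refine Coupled.bind_same fun as has => ?_
  have has' : as.1.size ≤ A := hA _ _ _ (by
    rw [← h16]
    simp only [Data.size, Data.size_ofNat]
    omega) as has
  rw [PMF.pure_bind]
  dsimp only
  rw [exec_seq_assign, exec_seq_assign]
  set cost := (Expr.cons (.fst (.reg 16)) (.const (.cons (.ofNat c) (.ofNat n)))).cost c₁.regs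
    with hcost
  set c₂ : Config S := ((Config.write ⟨c₁.regs, as.2, c₁.time + (1 + cost + as.1.size)⟩ 2
    as.1).assign 5 (.cons (.const .nil) (.reg 2))).assign 17 (.cons (.fst (.reg 0))
    (.cons (.snd (.reg 16)) (.cons (.reg 2) (.const .nil)))) with hc₂
  have hreg : ∀ y, c₂.regs y = if y = 17 then Data.ofList [x.fst, out.1.snd, as.1] else
      if y = 5 then .cons .nil as.1 else if y = 2 then as.1 else c₁.regs y := fun y => by
    simp only [hc₂, Config.assign, Config.write, Config.tick, Expr.val, Function.update_apply]
    by_cases h17 : y = 17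
    · simp [h17, h0, h16, Data.ofList]
    · by_cases h5 : y = 5
      · simp [h5]
      · simp only [h17, h5, if_false]
  have ht₂ : c₂.time ≤ c₁.time + (400 + 8 * (c + n)) * (forgerSize N t₁ A + 1) := by
    have e₁ : cost ≤ N + 3 + 2 * t₁ + (N + 3 + 2 * t₁) + (2 * c + 2 * n + 3) +
        (N + 3 + 2 * t₁ + (2 * c + 2 * n + 3) + 1) := by
      simp only [hcost, Expr.cost, Expr.val, Data.size, Data.size_ofNat]
      omega
    have e₂ : c₂.time ≤ c₁.time + cost + 20 * (forgerSize N t₁ A + 1) := by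
      simp only [hc₂, Config.assign, Config.write, Config.tick, Expr.cost, Expr.val, Data.size,
        Function.update_self, ne_eq, not_false_eq_true,
        Function.update_of_ne, Nat.reduceEqDiff, OfNat.zero_ne_ofNat, h0, h16] at hst h16s ⊢
      omega
    have e₃ : 8 * (c + n) ≤ 8 * (c + n) * (forgerSize N t₁ A + 1) :=
      Nat.le_mul_of_pos_right _ (by omega)
    rw [add_mul]
    omega
  have hx₂ : (Data.ofList [x.fst, out.1.snd, as.1]).size ≤ forgerSize N t₁ A := by
    rw [← h16]
    simp only [Data.ofList, Data.size]
    omega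
  have r5 : c₂.regs 5 = .cons .nil as.1 := by simp [hreg]
  have r3 : c₂.regs 3 = out.2.2.1 := by simp [hreg, h3]
  have r4 : c₂.regs 4 = out.2.2.2 := by simp [hreg, h4]
  have hp' := hp₂ (c₂.regs 5) (c₂.orc, c₂.regs 3, c₂.regs 4) _ hx₂
  have main := hp'.compile_coupled (L := forgerSize N t₁ A) (A := A₂) (k' := k)
    oddReg_injective (fun y => by simp only [oddReg]; omega) (by omega)
    hA₂ hk le_rfl
    (fun y => by
      rw [hreg]
      rcases Nat.eq_zero_or_pos y with rfl | hy
      · rfl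
      · have : oddReg y = 17 + 2 * y := rfl
        rw [if_neg (by omega), if_neg (by omega), if_neg (by omega), if_neg (by omega), hodd])
    (fun y => by
      have := hsize y
      rw [hreg]
      split_ifs <;> first | omega | (simp only [Data.size]; omega))
  have horc₂ : c₂.orc = as.2 := rfl
  rw [r5, r3, r4, horc₂] at main
  refine main.mono fun res _ r _ hr => ?_
  obtain ⟨c', rfl, -, ho, -, hf, -, hs, ht⟩ := hr
  refine ⟨c', rfl, hf, ho, hs 4, ht.trans ?_⟩
  exact Nat.add_le_add_right ht₂ _

theorem forgerProg_implements {p₁ p₂ : Prog OracleName} {N t₁ t₂ A A₂ : ℕ}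
    (hp₁ : p₁.HaltsIn (logOracles n .nil O) (s, .nil, .nil) x t₁)
    (hp₂ : ∀ chal s x, x.size ≤ forgerSize N t₁ A → p₂.HaltsIn (logOracles n chal O) s x t₂)
    (hx : x.size ≤ N) (hA : ∀ o s d, d.size ≤ N + 2 * t₁ + 2 * c + 2 * n + 10 →
      ∀ as ∈ (O o s d).support, as.1.size ≤ A)
    (hA₂ : ∀ o s d, d.size ≤ t₂ → ∀ as ∈ (O o s d).support, as.1.size ≤ A₂) :
    (forgerProg n c p₁ p₂).Implements O s x
      ((attack O n c p₁ p₂ s x).map fun out => (out.2.2.2, out.2.1))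
      (forgerTime n c N t₁ t₂ A A₂) := by
  have hL : forgerSize N t₁ A = 2 * N + 2 * t₁ + A + 7 := rfl
  set k := forgerSize N t₁ A + 3 * t₁ + 3 * t₂ + 1 with hk
  set c₀ : Config S := (Config.init s x).assign 16 (.reg 0) with hc₀
  have hreg : ∀ y, c₀.regs y = if y = 0 ∨ y = 16 then x else .nil := fun y => by
    simp only [hc₀, Config.assign, Config.write, Config.tick, Config.init, Expr.val,
      Function.update_apply]
    split_ifs <;> simp_all
  have ht₀ : c₀.time ≤ 1 + N := by
    simp only [hc₀, Config.assign, Config.write, Config.tick, Config.init, Expr.cost,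
      Function.update_self]
    omega
  have h5 : c₀.regs 5 = .nil := by simp [hreg]
  have h3 : c₀.regs 3 = .nil := by simp [hreg]
  have h4 : c₀.regs 4 = .nil := by simp [hreg]
  have horc : c₀.orc = s := rfl
  have hp' : p₁.HaltsIn (logOracles n (c₀.regs 5) O) (c₀.orc, c₀.regs 3, c₀.regs 4) x t₁ := by
    rwa [h5, h3, h4, horc]
  have main := hp'.compile_coupled (L := N + 3) (A := A) (k' := k)
    evenReg_injective (fun y => by simp only [evenReg]; omega) (by omega)
    (fun o s d hd => hA o s d (by omega)) (by omega) le_rfl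
    (fun y => by
      rw [hreg]
      rcases Nat.eq_zero_or_pos y with rfl | hy
      · rfl
      · rw [if_neg (by simp only [evenReg]; omega), if_neg (by omega)])
    (fun y => by rw [hreg]; split_ifs <;> first | omega | (simp only [Data.size]; omega))
  rw [h5, h3, h4, horc] at main
  refine ⟨k, ?_⟩
  rw [forgerProg, exec_seq_assign, ← hc₀, Prog.exec, attack, PMF.map_bind]
  refine main.bind fun out _ r _ hr => ?_
  obtain ⟨c₁, rfl, h16, ho, hlog, hflag, hframe, hsize, htime⟩ := hr
  have htime' : c₁.time ≤ c₀.time + (overhead n (N + 3) t₁ A + 2) * t₁ := htime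
  dsimp only
  rw [Prog.exec]
  have mid : Coupled (fun res r => ∃ c', r = some c' ∧ c'.regs 4 = res.2.2.2 ∧ c'.orc = res.2.1 ∧
        (c'.regs 4).size ≤ forgerSize N t₁ A + 2 * t₂ ∧
        c'.time ≤ c₁.time + (500 + 8 * (c + n)) * (forgerSize N t₁ A + 1) +
          (overhead n (forgerSize N t₁ A) t₂ A₂ + 2) * t₂)
      (attackSnd O n c p₂ x out)
      ((Prog.cond (.reg 4) (.assign 4 (.reg 4)) (challengeProg n c p₂)).exec O k c₁) := by
    have h4s := hsize 4
    have h500 : (500 + 8 * (c + n)) * (forgerSize N t₁ A + 1) =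
        (400 + 8 * (c + n)) * (forgerSize N t₁ A + 1) + 100 * (forgerSize N t₁ A + 1) := by ring
    have hpos : 0 ≤ (400 + 8 * (c + n)) * (forgerSize N t₁ A + 1) := Nat.zero_le _
    rw [Prog.exec, Expr.val, hflag]
    split_ifs with hb
    -- A query recorded in the first phase ends the attack; the assignment of register `4` to itself
    -- serves as an empty branch.
    · rw [attackSnd, if_pos hb, Prog.exec]
      refine Coupled.pure ⟨_, rfl, ?_, ho, ?_, ?_⟩
      · simpa [Config.write, Config.tick, Expr.val] using hflag
      · simp only [Config.write, Config.tick, Expr.val, Function.update_self]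
        omega
      · simp only [Config.write, Config.tick, Expr.cost]
        omega
    · refine (challengeProg_coupled (c₁ := c₁.tick _) (k := k) hp₂ hx hA hA₂ (by omega) h16 ho
        hlog hflag ?_ (fun y => ?_) hsize hb).mono fun res _ r _ ⟨c', hr, h1, h2, h3, h4⟩ =>
          ⟨c', hr, h1, h2, h3, h4.trans ?_⟩
      · refine (hframe 0 (Or.inl rfl) ?_).trans (by simp [hreg])
        rintro ⟨z, hz⟩
        simp only [evenReg] at hz
        omega
      · refine (hframe _ (Or.inr (by simp only [oddReg]; omega)) ?_).trans ?_
        · rintro ⟨z, hz⟩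
          simp only [evenReg, oddReg] at hz
          omega
        · rw [hreg, if_neg (by simp only [oddReg]; omega)]
      · simp only [Config.tick, Expr.cost]
        omega
  refine mid.bind fun res _ r _ hr => ?_
  obtain ⟨c', rfl, h4', ho', hs', ht'⟩ := hr
  dsimp only
  rw [Prog.exec]
  refine Coupled.pure ⟨_, rfl, ?_, ho', ?_⟩
  · simpa [Config.write, Expr.val] using h4'
  · simp only [Config.write, Config.tick, Expr.cost, forgerTime]
    omega

end Forger

/-! ### The reductions are polynomial-time -/

/-- The running time of an algorithm, given a bound for the length of the answers. -/
def PPT.time {ι : Type} (M : PPT ι) (l : Polynomial ℕ) : Polynomial ℕ := (M.polyTime l).choose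

theorem PPT.haltsIn {ι S : Type} (M : PPT ι) {l : Polynomial ℕ} {N : ℕ} {x : Data}
    (hx : x.size ≤ N) {O : Oracles ι S} (hO : BoundedBy O l N) (s : S) :
    M.prog.HaltsIn O s x ((M.time l).eval N) :=
  (M.polyTime l).choose_spec N x hx S O s hO

theorem PPT.haltsIn_logOracles {S : Type} (M : PPT OracleName) {l : Polynomial ℕ} {N : ℕ}
    {x : Data} (hx : x.size ≤ N) {O : Oracles OracleName S} (hO : BoundedBy O l N) (n : ℕ)
    (chal : Data) (s : S × Data × Data) :
    M.prog.HaltsIn (logOracles n chal O) s x ((M.time (l + 3)).eval N) :=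
  M.haltsIn hx (hO.logOracles n chal) s

theorem BoundedBy.size_le {ι S : Type} {O : Oracles ι S} {l : Polynomial ℕ} {N : ℕ}
    (h : BoundedBy O l N) {t : ℕ} (o : ι) (s : S) (d : Data) (hd : d.size ≤ t) :
    ∀ as ∈ (O o s d).support, as.1.size ≤ l.eval (N + t) := fun as has =>
  (h o s d as has).trans (polynomial_eval_mono l (by omega))

/-- `overhead` as a polynomial. -/
def overheadPoly (n : ℕ) (L t A : Polynomial ℕ) : Polynomial ℕ :=
  (500 + ((admissibleExpr n).weight : Polynomial ℕ)) *
    ((L + 3 * t + A + 1) * (L + 3 * t + A + 1))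

theorem eval_overheadPoly (n : ℕ) (L t A : Polynomial ℕ) (N : ℕ) :
    (overheadPoly n L t A).eval N = overhead n (L.eval N) (t.eval N) (A.eval N) := by
  simp [overheadPoly, overhead]

section PPT

open Polynomial in
theorem exists_privacyProg₁_implements (n : ℕ) (M : PPT OracleName) (l : Polynomial ℕ) :
    ∃ q : Polynomial ℕ, ∀ (N : ℕ) (x : Data), x.size ≤ N → ∀ (S : Type) (O : Oracles OracleName S)
      (s : S), BoundedBy O l N → (privacyProg₁ n M.prog).Implements O s x
        ((M.runWith (logOracles n .nil O) (s, .nil, .nil) x).map appendLog) (q.eval N) := by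
  set t := M.time (l + 3) with ht
  set A := l.comp (X + t) with hA
  refine ⟨1 + X + (overheadPoly n (X + 3) t A + 2) * t + 1 + 100 * (X + 3 + 2 * t + 1),
    fun N x hx S O s hO => ?_⟩
  have h := privacyProg₁_implements (A := A.eval N) (M.haltsIn_logOracles hx hO n .nil
    (s, .nil, .nil)) hx fun o s d hd => by
      simpa [hA] using hO.size_le o s d hd
  convert h using 1
  · rfl
  · simp [eval_overheadPoly, ht]

open Polynomial in
theorem exists_privacyProg₂_implements (n : ℕ) (M : PPT OracleName) (l : Polynomial ℕ) :
    ∃ q : Polynomial ℕ, ∀ (N : ℕ) (x : Data), x.size ≤ N → ∀ (S : Type) (O : Oracles OracleName S)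
      (s : S), BoundedBy O l N → (privacyProg₂ n M.prog).Implements O s x
        ((M.runWith (logOracles n (.cons .nil x.snd.snd.fst) O)
          (s, x.snd.fst.snd.fst, x.snd.fst.snd.snd) (removeLog x)).map
            fun out => (out.1, out.2.1)) (q.eval N) := by
  set t := (M.time (l + 3)).comp (3 * X + 2) with ht
  set A := l.comp (X + t) with hA
  refine ⟨200 * (3 * X + 3) + (overheadPoly n (3 * X + 2) t A + 2) * t +
    (1 + (3 * X + 2 + 2 * t)), fun N x hx S O s hO => ?_⟩
  have hx' : (removeLog x).size ≤ 3 * N + 2 := (size_removeLog_le x).trans (by omega)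
  have h := privacyProg₂_implements (s := s) (A := A.eval N) (M.haltsIn_logOracles hx'
    (hO.mono (by omega)) n _ _) hx fun o s d hd => by
      simpa [hA, ht] using hO.size_le o s d hd
  convert h using 1
  · rfl
  · simp [eval_overheadPoly, ht]

-- The bounds are nested: `t₁` for the first phase, `A₁` for the answers in it and for the
-- challenge, `L` for the memory when the second phase starts, `t₂` for the time of that phase and
-- `A₂` for its answers. Each is a polynomial in `N`.
open Polynomial in
theorem exists_forgerProg_implements (n c : ℕ) (M₁ M₂ : PPT OracleName) (l : Polynomial ℕ) :
    ∃ q : Polynomial ℕ, ∀ (N : ℕ) (x : Data), x.size ≤ N → ∀ (S : Type) (O : Oracles OracleName S)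
      (s : S), BoundedBy O l N → (forgerProg n c M₁.prog M₂.prog).Implements O s x
        ((attack O n c M₁.prog M₂.prog s x).map fun out => (out.2.2.2, out.2.1)) (q.eval N) := by
  set t₁ := M₁.time (l + 3) with ht₁
  set A₁ := l.comp (X + (X + 2 * t₁ + 2 * (c : ℕ[X]) + 2 * (n : ℕ[X]) + 10)) with hA₁
  set L := 2 * X + 2 * t₁ + A₁ + 7 with hL
  set t₂ := (M₂.time (l + 3)).comp L with ht₂
  set A₂ := l.comp (X + t₂) with hA₂
  refine ⟨1 + X + (overheadPoly n (X + 3) t₁ A₁ + 2) * t₁ +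
    (500 + 8 * ((c : ℕ[X]) + (n : ℕ[X]))) * (L + 1) + (overheadPoly n L t₂ A₂ + 2) * t₂ +
    (1 + (L + 2 * t₂)), fun N x hx S O s hO => ?_⟩
  have hLN : L.eval N = forgerSize N (t₁.eval N) (A₁.eval N) := by simp [hL, forgerSize]
  have ht₂N : t₂.eval N = (M₂.time (l + 3)).eval (L.eval N) := by simp [ht₂]
  have h := forgerProg_implements (c := c) (p₂ := M₂.prog) (A := A₁.eval N) (A₂ := A₂.eval N)
    (t₂ := t₂.eval N) (M₁.haltsIn_logOracles hx hO n .nil (s, .nil, .nil))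
    (fun chal s x hx => by
      rw [ht₂N, hLN]
      exact M₂.haltsIn_logOracles hx (hO.mono (by rw [forgerSize]; omega)) n chal s) hx
    (fun o s d hd => by
      simpa [hA₁] using hO.size_le o s d hd)
    (fun o s d hd => by
      simpa [hA₂] using hO.size_le o s d hd)
  convert h using 1
  rw [forgerTime, ← ht₁, ← hLN]
  simp [eval_overheadPoly]

/-- The privacy adversary that does without verification oracles. -/
def PrivacyAdversary.withoutVerification (A : PrivacyAdversary) (n : ℕ) : PrivacyAdversary where
  phase1 := ⟨privacyProg₁ n A.phase1.prog, fun l =>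
    (exists_privacyProg₁_implements n A.phase1 l).imp fun _ hq N x hx S O s hO =>
      (hq N x hx S O s hO).haltsIn⟩
  phase2 := ⟨privacyProg₂ n A.phase2.prog, fun l =>
    (exists_privacyProg₂_implements n A.phase2 l).imp fun _ hq N x hx S O s hO =>
      (hq N x hx S O s hO).haltsIn⟩

/-- The forger built from a privacy adversary and a challenge sender. -/
def PrivacyAdversary.forger (A : PrivacyAdversary) (n c : ℕ) : PPT OracleName :=
  ⟨forgerProg n c A.phase1.prog A.phase2.prog, fun l =>
    (exists_forgerProg_implements n c A.phase1 A.phase2 l).imp fun _ hq N x hx S O s hO =>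
      (hq N x hx S O s hO).haltsIn⟩

variable {S : Type} {O : Oracles OracleName S} {l : Polynomial ℕ} {N : ℕ} {x : Data}

theorem PrivacyAdversary.runWith_withoutVerification_phase1 (A : PrivacyAdversary) (n : ℕ)
    (hx : x.size ≤ N) (hO : BoundedBy O l N) (s : S) :
    (A.withoutVerification n).phase1.runWith O s x =
      (A.phase1.runWith (logOracles n .nil O) (s, .nil, .nil) x).map appendLog :=
  ((exists_privacyProg₁_implements n A.phase1 l).choose_spec N x hx S O s hO).output_eq

theorem PrivacyAdversary.runWith_withoutVerification_phase2 (A : PrivacyAdversary) (n : ℕ)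
    (hx : x.size ≤ N) (hO : BoundedBy O l N) (s : S) :
    (A.withoutVerification n).phase2.runWith O s x =
      (A.phase2.runWith (logOracles n (.cons .nil x.snd.snd.fst) O)
        (s, x.snd.fst.snd.fst, x.snd.fst.snd.snd) (removeLog x)).map fun out => (out.1, out.2.1) :=
  ((exists_privacyProg₂_implements n A.phase2 l).choose_spec N x hx S O s hO).output_eq

theorem PrivacyAdversary.runWith_forger (A : PrivacyAdversary) (n c : ℕ)
    (hx : x.size ≤ N) (hO : BoundedBy O l N) (s : S) :
    (A.forger n c).runWith O s x =
      (attack O n c A.phase1.prog A.phase2.prog s x).map fun out => (out.2.2.2, out.2.1) :=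
  ((exists_forgerProg_implements n c A.phase1 A.phase2 l).choose_spec N x hx S O s hO).output_eq

end PPT

/-! ### The oracles of the games -/

/-- The register content that describes the challenge. -/
def challengeData : Option Data → Data
  | none => .nil
  | some sig => .cons .nil sig

theorem cons_nil_eq_challengeData (sig : Data) (ch : Option Data) :
    Data.cons .nil sig = challengeData ch ↔ some sig = ch := by
  cases ch <;> simp [challengeData]

theorem admissible_iff {n : ℕ} {ch : Option Data} {q : Data} :
    admissible n (challengeData ch) q = true ↔ ∃ (m sig : Data) (i j : Fin (n + 1)),
      q = .cons m (.cons sig (.cons (.ofNat i) (.ofNat j))) ∧ some sig ≠ ch := by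
  simp only [admissible, Bool.and_eq_true, decide_eq_true_eq, Bool.not_eq_true',
    decide_eq_false_iff_not, cons_nil_eq_challengeData, Option.isSome_iff_exists]
  constructor
  · rintro ⟨⟨hq, ⟨i, hi⟩, ⟨j, hj⟩⟩, hch⟩
    refine ⟨q.fst, q.snd.fst, i, j, ?_, hch⟩
    rw [← Data.eq_ofNat_of_toParty? hi, ← Data.eq_ofNat_of_toParty? hj]
    exact hq
  · rintro ⟨m, sig, i, j, rfl, hch⟩
    exact ⟨⟨rfl, ⟨i, Data.toParty?_ofNat i⟩, ⟨j, Data.toParty?_ofNat j⟩⟩, hch⟩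

theorem logOracles_of_isTrue {S : Type} {n : ℕ} {chal : Data} {O : Oracles OracleName S}
    (o : OracleName) {st : S × Data × Data} (q : Data) (h : st.2.2.isTrue = true) :
    logOracles n chal O o st q = PMF.pure (.bot, st) := if_pos h

theorem logOracles_isTrue {S : Type} {n : ℕ} {chal : Data} {O : Oracles OracleName S}
    (o : OracleName) (st : S × Data × Data) (q : Data) (as)
    (has : as ∈ (logOracles n chal O o st q).support) (h : st.2.2.isTrue = true) :
    as.2.2.2.isTrue = true := by
  rw [logOracles_of_isTrue o q h, PMF.support_pure, Set.mem_singleton_iff] at has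
  subst has
  exact h

section LogOracles

variable {S : Type} {n : ℕ} {chal : Data} {O : Oracles OracleName S}

theorem logOracles_of_ne_veri {o : OracleName} (ho : o ≠ .veri) {st : S × Data × Data} (q : Data)
    (h : ¬ st.2.2.isTrue = true) : logOracles n chal O o st q =
      (O o st.1 q).map fun a => (a.1, (a.2, .cons (.cons a.1 q) st.2.1, st.2.2)) := by
  cases o with
  | veri => exact absurd rfl ho
  | sign => exact if_neg h
  | sim => exact if_neg h

theorem logOracles_veri {st : S × Data × Data} (q : Data)
    (h : ¬ st.2.2.isTrue = true) : logOracles n chal O .veri st q =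
      if admissible n chal q then
        if (logKey q).mem st.2.1 then PMF.pure (.ofNat 1, st)
        else (O .veri st.1 q).map fun b =>
          (.nil, (b.2, st.2.1, if b.1 = .ofNat 1 then q else st.2.2))
      else PMF.pure (.bot, st) := if_neg h

end LogOracles

section Games

variable {D : Scheme} {κ n : ℕ} {params : Data} {K : Fin (n + 1) → KeyPair}

theorem stdOraclesNoVeri_eq {o : OracleName} (ho : o ≠ .veri) (ch ch' : Option Data) :
    D.stdOraclesNoVeri κ params K ch o = D.stdOracles κ params K ch' o := by
  cases o with
  | veri => exact absurd rfl ho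
  | sign => rfl
  | sim => rfl

/-- Signing and simulation oracles return a valid signature to well-formed queries, and record
it. -/
theorem exists_stdOracles_eq_map (hD : D.IsCorrect) (hK : ∀ i, D.Valid κ params (K i))
    {o : OracleName} (ho : o ≠ .veri) (q : Data) :
    ∃ (μ : PMF Data) (g : Data → Log n → Log n),
      (∀ ch log, D.stdOracles κ params K ch o log q = μ.map fun a => (a, g a log)) ∧
      (∀ a ∈ μ.support, ∀ m (i j : Fin (n + 1)), q = .cons m (.cons (.ofNat i) (.ofNat j)) →
        D.verify κ params (K j) (K i).pk m a = PMF.pure (.ofNat 1)) ∧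
      ∀ a log, ∀ t ∈ g a log, t ∈ log ∨
        a = t.sig ∧ q = .cons t.m (.cons (.ofNat t.s) (.ofNat t.v)) := by
  by_cases hq : ∃ (m : Data) (i j : Fin (n + 1)), q = .cons m (.cons (.ofNat i) (.ofNat j))
  · obtain ⟨m, i, j, rfl⟩ := hq
    have hparties : ∀ (m' : Data) (i' j' : Fin (n + 1)),
        Data.cons m (.cons (.ofNat i) (.ofNat j)) = .cons m' (.cons (.ofNat i') (.ofNat j')) →
        m = m' ∧ i = i' ∧ j = j' := by
      intro m' i' j' h
      simp only [Data.cons.injEq] at h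
      refine ⟨h.1, ?_, ?_⟩
      · have := congrArg (Data.toParty? n) h.2.1
        simpa [Data.toParty?_ofNat] using this
      · have := congrArg (Data.toParty? n) h.2.2
        simpa [Data.toParty?_ofNat] using this
    have hc := hD κ params (K i) (K j) (hK i) (hK j) m
    cases o with
    | veri => exact absurd rfl ho
    | sign =>
      refine ⟨D.sign κ params (K i) (K j).pk m, fun a log => ⟨m, a, i, j⟩ :: log, ?_, ?_, ?_⟩
      · intro ch log
        simp only [Scheme.stdOracles, Scheme.signOracle, Data.toParty?_ofNat]
      · intro a ha m' i' j' h
        obtain ⟨rfl, rfl, rfl⟩ := hparties m' i' j' h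
        exact hc.1 a ha
      · intro a log t ht
        rcases List.mem_cons.1 ht with rfl | ht
        · exact Or.inr ⟨rfl, rfl⟩
        · exact Or.inl ht
    | sim =>
      refine ⟨D.simulate κ params (K j) (K i).pk m, fun a log => ⟨m, a, i, j⟩ :: log, ?_, ?_, ?_⟩
      · intro ch log
        simp only [Scheme.stdOracles, Scheme.simOracle, Data.toParty?_ofNat]
      · intro a ha m' i' j' h
        obtain ⟨rfl, rfl, rfl⟩ := hparties m' i' j' h
        exact hc.2 a ha
      · intro a log t ht
        rcases List.mem_cons.1 ht with rfl | ht
        · exact Or.inr ⟨rfl, rfl⟩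
        · exact Or.inl ht
  · refine ⟨PMF.pure .bot, fun _ log => log, fun ch log => ?_,
      fun a _ m i j h => absurd ⟨m, i, j, h⟩ hq, fun _ _ t ht => Or.inl ht⟩
    rw [PMF.pure_map]
    cases o with
    | veri => exact absurd rfl ho
    | sign =>
      simp only [Scheme.stdOracles]
      unfold Scheme.signOracle
      split
      · split
        · rename_i m s v _ _ i j hi hj
          exact absurd ⟨m, i, j, by rw [← Data.eq_ofNat_of_toParty? hi,
            ← Data.eq_ofNat_of_toParty? hj]⟩ hq
        · rfl
      · rfl
    | sim =>
      simp only [Scheme.stdOracles]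
      unfold Scheme.simOracle
      split
      · split
        · rename_i m s v _ _ i j hi hj
          exact absurd ⟨m, i, j, by rw [← Data.eq_ofNat_of_toParty? hi,
            ← Data.eq_ofNat_of_toParty? hj]⟩ hq
        · rfl
      · rfl

theorem stdOracles_veri (ch : Option Data) (log : Log n) (m sig : Data) (i j : Fin (n + 1))
    (h : some sig ≠ ch) :
    D.stdOracles κ params K ch .veri log (.cons m (.cons sig (.cons (.ofNat i) (.ofNat j)))) =
      (D.verify κ params (K j) (K i).pk m sig).map fun b => (b, log) := by
  simp only [Scheme.stdOracles, Scheme.veriOracle, Data.toParty?_ofNat, if_neg h]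

theorem stdOracles_veri_of_not_admissible {ch : Option Data} (log : Log n) {q : Data}
    (h : ¬ admissible n (challengeData ch) q = true) :
    D.stdOracles κ params K ch .veri log q = PMF.pure (.bot, log) := by
  rw [admissible_iff] at h
  simp only [Scheme.stdOracles]
  unfold Scheme.veriOracle
  split
  · split
    · rename_i m sig s v _ _ i j hi hj
      split_ifs with hch
      · rfl
      · exact absurd ⟨m, sig, i, j, by rw [← Data.eq_ofNat_of_toParty? hi,
            ← Data.eq_ofNat_of_toParty? hj], hch⟩ h
    · rfl
  · rfl

/-- All entries of the log are valid. -/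
def ValidLog (D : Scheme) (κ : ℕ) (params : Data) (K : Fin (n + 1) → KeyPair) (log : Data) :
    Prop :=
  ∀ (m sig : Data) (i j : Fin (n + 1)),
    (Data.cons sig (.cons m (.cons (.ofNat i) (.ofNat j)))).mem log = true →
    D.verify κ params (K j) (K i).pk m sig = PMF.pure (.ofNat 1)

/-- A logged query is accepted with certainty, by `ValidLog`, which correctness preserves. The true
verdict on an unlogged query is a bit: `0` is the default answer, and `1` raises the flag. The
oracles below `logOracles` are those of the first phase throughout, because `admissible` already
excludes the challenge. -/
theorem stdOracles_coupled_logOracles (hD : D.IsCorrect) (hK : ∀ i, D.Valid κ params (K i))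
    (ch : Option Data) (o : OracleName) (log : Log n) (st : Log n × Data × Data) (q : Data)
    (hflag : st.2.2.isTrue = false) (hlog : ValidLog D κ params K st.2.1) :
    Coupled (fun a b => False ∨ b.2.2.2.isTrue = true ∨
        a.1 = b.1 ∧ b.2.2.2.isTrue = false ∧ ValidLog D κ params K b.2.2.1)
      (D.stdOracles κ params K ch o log q)
      (logOracles n (challengeData ch) (D.stdOracles κ params K none) o st q) := by
  have hflag' : ¬ st.2.2.isTrue = true := by simp [hflag]
  by_cases ho : o = .veri
  · subst ho
    rw [logOracles_veri q hflag']
    split_ifs with hadm hmem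
    · obtain ⟨m, sig, i, j, rfl, hch⟩ := admissible_iff.1 hadm
      rw [stdOracles_veri ch log m sig i j hch, hlog m sig i j hmem, PMF.pure_map]
      exact Coupled.pure (Or.inr (Or.inr ⟨rfl, hflag, hlog⟩))
    · obtain ⟨m, sig, i, j, rfl, hch⟩ := admissible_iff.1 hadm
      rw [stdOracles_veri ch log m sig i j hch, stdOracles_veri none _ m sig i j (by simp),
        PMF.map_comp]
      -- Both sides draw the same verdict.
      refine (Coupled.refl _).map fun b hb b' _ hbb => ?_
      subst hbb
      rcases D.verify_valid κ params (K i) (K j) (hK i) (hK j) m sig b hb with rfl | rfl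
      · exact Or.inr (Or.inr ⟨rfl, by simpa [Data.ofNat] using hflag, hlog⟩)
      · exact Or.inr (Or.inl rfl)
    · rw [stdOracles_veri_of_not_admissible log hadm]
      exact Coupled.pure (Or.inr (Or.inr ⟨rfl, hflag, hlog⟩))
  · obtain ⟨μ, g, hμ, hver, -⟩ := exists_stdOracles_eq_map hD hK ho q
    rw [logOracles_of_ne_veri ho q hflag', hμ, hμ, PMF.map_comp]
    refine (Coupled.refl _).map fun a ha a' _ haa => ?_
    subst haa
    refine Or.inr (Or.inr ⟨rfl, hflag, fun m sig i j hmem => ?_⟩)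
    simp only [Function.comp, Data.mem, Bool.or_eq_true, decide_eq_true_eq,
      Data.cons.injEq] at hmem
    rcases hmem with ⟨rfl, rfl⟩ | hmem
    · exact hver _ ha m i j rfl
    · exact hlog m sig i j hmem

/-- A verdict influences nothing but the flag, and `⊥` never raises it; so hiding the true verdict
is noticed only when it is `1`. The states of the underlying oracles need not agree, since they do
not affect signatures or simulations. -/
theorem logOracles_coupled (hD : D.IsCorrect) (hK : ∀ i, D.Valid κ params (K i))
    (ch ch' : Option Data) (o : OracleName) (st st' : Log n × Data × Data) (q : Data)
    (hst : st.2 = st'.2) :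
    Coupled (fun a b => a.2.2.2.isTrue = true ∨ False ∨ a.1 = b.1 ∧ a.2.2 = b.2.2)
      (logOracles n (challengeData ch) (D.stdOracles κ params K none) o st q)
      (logOracles n (challengeData ch) (D.stdOraclesNoVeri κ params K ch') o st' q) := by
  by_cases hflag : st.2.2.isTrue = true
  · exact Coupled.of_forall fun a ha _ _ => Or.inl (logOracles_isTrue o st q a ha hflag)
  have hflag' : ¬ st'.2.2.isTrue = true := by rwa [← hst]
  by_cases ho : o = .veri
  · subst ho
    rw [logOracles_veri q hflag, logOracles_veri q hflag', ← hst]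
    split_ifs with hadm hmem
    · exact Coupled.pure (Or.inr (Or.inr ⟨rfl, hst⟩))
    · refine Coupled.of_forall fun a ha b hb => ?_
      rw [PMF.mem_support_map_iff] at ha hb
      obtain ⟨a, -, rfl⟩ := ha
      obtain ⟨b, hb, rfl⟩ := hb
      simp only [Scheme.stdOraclesNoVeri, PMF.support_pure, Set.mem_singleton_iff] at hb
      subst hb
      by_cases h1 : a.1 = .ofNat 1
      · obtain ⟨m, sig, i, j, rfl, hch⟩ := admissible_iff.1 hadm
        left
        simp [h1, Data.isTrue]
      · refine Or.inr (Or.inr ⟨rfl, ?_⟩)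
        dsimp only
        rw [if_neg h1, if_neg (by decide)]
    · exact Coupled.pure (Or.inr (Or.inr ⟨rfl, hst⟩))
  · obtain ⟨μ, g, hμ, -, -⟩ := exists_stdOracles_eq_map hD hK ho q
    rw [logOracles_of_ne_veri ho q hflag, logOracles_of_ne_veri ho q hflag',
      stdOraclesNoVeri_eq ho ch' none, hμ, hμ, PMF.map_comp, PMF.map_comp]
    refine (Coupled.refl _).map fun a _ a' _ haa => ?_
    subst haa
    exact Or.inr (Or.inr ⟨rfl, by simp [hst]⟩)

/-! ### The games with fixed keys -/

/-- The sender-privacy game with fixed parameters and keys. -/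
def fixedGame (D : Scheme) (A : PrivacyAdversary) (O : OracleFamily) (κ : ℕ) (params : Data)
    (K : Fin (n + 1) → KeyPair) (c : Fin (n + 1)) : PMF Data :=
  (A.phase1.runWith (O D κ params K none) []
    (.ofList (.ofNat κ :: params :: pubKeys K))).bind fun out =>
  (D.sign κ params (K c) (K (Fin.last n)).pk out.1.fst).bind fun sig =>
  (A.phase2.runWith (O D κ params K (some sig)) out.2
    (.ofList [.ofNat κ, out.1.snd, sig])).map Prod.fst

theorem stdOracles_sign (ch : Option Data) (log : Log n) (m : Data) (c : Fin (n + 1)) :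
    D.stdOracles κ params K ch .sign log (.cons m (.cons (.ofNat c) (.ofNat n))) =
      (D.sign κ params (K c) (K (Fin.last n)).pk m).map fun sig =>
        (sig, ⟨m, sig, c, Fin.last n⟩ :: log) := by
  have : Data.toParty? n (.ofNat n) = some (Fin.last n) := Data.toParty?_ofNat (Fin.last n)
  simp only [Scheme.stdOracles, Scheme.signOracle, Data.toParty?_ofNat, this]

variable {l : Polynomial ℕ} {b : ℕ}

/-- The one-query comparison is lifted to each phase by `output_coupled`. If the first phase raises
the flag, nothing is left to compare; otherwise both runs draw the challenge from the same law. -/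
theorem fixedGame_coupled_attack (hD : D.IsCorrect) (hK : ∀ i, D.Valid κ params (K i))
    (hO : ∀ ch, BoundedBy (D.stdOracles κ params K ch) l b) (A : PrivacyAdversary)
    (c : Fin (n + 1)) :
    Coupled (fun y res => res.2.2.2.isTrue = true ∨ y = res.1)
      (fixedGame D A (fun D κ _ params K ch => D.stdOracles κ params K ch) κ params K c)
      (attack (D.stdOracles κ params K none) n c A.phase1.prog A.phase2.prog []
        (.ofList (.ofNat κ :: params :: pubKeys K))) := by
  set x := Data.ofList (.ofNat κ :: params :: pubKeys K) with hx
  have key : ∀ (M : PPT OracleName) (ch : Option Data) (log : Log n) (st : Log n × Data × Data)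
      (y : Data), st.2.2.isTrue = false → ValidLog D κ params K st.2.1 →
      Coupled (fun a b => False ∨ b.2.2.2.isTrue = true ∨
        a.1 = b.1 ∧ b.2.2.2.isTrue = false ∧ ValidLog D κ params K b.2.2.1)
      (M.prog.output (D.stdOracles κ params K ch) log y)
      (M.prog.output (logOracles n (challengeData ch) (D.stdOracles κ params K none)) st y) := by
    intro M ch log st y h₁ h₂
    exact output_coupled (Bad₁ := fun _ => False) (Bad₂ := fun st => st.2.2.isTrue = true)
      (Inv := fun _ st => st.2.2.isTrue = false ∧ ValidLog D κ params K st.2.1)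
      (fun _ _ _ _ _ h => h) (fun o st q as has h => logOracles_isTrue o st q as has h)
      (fun o log st q h => stdOracles_coupled_logOracles hD hK ch o log st q h.1 h.2)
      (M.haltsIn (N := y.size + b) (by omega) ((hO ch).mono (by omega)) log)
      (M.haltsIn_logOracles (N := y.size + b) (by omega) ((hO none).mono (by omega)) n _ st)
      ⟨h₁, h₂⟩
  refine (key A.phase1 none [] ([], .nil, .nil) x rfl fun m sig i j h => by
    simp [Data.mem] at h).bind fun out _ out' _ hout => ?_
  rw [attackSnd]
  split_ifs with hflag
  · refine Coupled.of_forall fun a _ r hr => Or.inl ?_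
    rw [PMF.support_pure, Set.mem_singleton_iff] at hr
    subst hr
    exact hflag
  · obtain ⟨h₁, h₂, h₃⟩ := (hout.resolve_left id).resolve_left hflag
    rw [stdOracles_sign, PMF.bind_map, h₁]
    refine Coupled.bind_same fun sig _ => ?_
    refine (key A.phase2 (some sig) out.2 (⟨out'.1.fst, sig, c, Fin.last n⟩ :: out'.2.1,
      out'.2.2.1, out'.2.2.2) _ h₂ h₃).map_left fun a _ r _ har => ?_
    exact (har.resolve_left id).imp id fun h => h.1

/-- The compiled adversary is replaced by the original one over `logOracles`, with the log handed
over through the state; then the two runs differ only in the verification oracle underneath. -/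
theorem attack_coupled_fixedGame (hD : D.IsCorrect) (hK : ∀ i, D.Valid κ params (K i))
    (hO : ∀ ch, BoundedBy (D.stdOracles κ params K ch) l b)
    (hO' : ∀ ch, BoundedBy (D.stdOraclesNoVeri κ params K ch) l b) (A : PrivacyAdversary)
    (c : Fin (n + 1)) :
    Coupled (fun res y => res.2.2.2.isTrue = true ∨ res.1 = y)
      (attack (D.stdOracles κ params K none) n c A.phase1.prog A.phase2.prog []
        (.ofList (.ofNat κ :: params :: pubKeys K)))
      (fixedGame D (A.withoutVerification n)
        (fun D κ _ params K ch => D.stdOraclesNoVeri κ params K ch) κ params K c) := by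
  set x := Data.ofList (.ofNat κ :: params :: pubKeys K) with hx
  have key : ∀ (M : PPT OracleName) (ch ch' : Option Data) (st st' : Log n × Data × Data)
      (y : Data), st.2 = st'.2 →
      Coupled (fun a b => a.2.2.2.isTrue = true ∨ False ∨ a.1 = b.1 ∧ a.2.2 = b.2.2)
      (M.prog.output (logOracles n (challengeData ch) (D.stdOracles κ params K none)) st y)
      (M.prog.output (logOracles n (challengeData ch)
        (D.stdOraclesNoVeri κ params K ch')) st' y) := by
    intro M ch ch' st st' y h
    exact output_coupled (Bad₁ := fun st => st.2.2.isTrue = true) (Bad₂ := fun _ => False)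
      (Inv := fun st st' => st.2 = st'.2)
      (fun o st q as has h => logOracles_isTrue o st q as has h) (fun _ _ _ _ _ h => h)
      (fun o st st' q h => logOracles_coupled hD hK ch ch' o st st' q h)
      (M.haltsIn_logOracles (N := y.size + b) (by omega) ((hO none).mono (by omega)) n _ st)
      (M.haltsIn_logOracles (N := y.size + b) (by omega) ((hO' ch').mono (by omega)) n _ st') h
  rw [fixedGame, A.runWith_withoutVerification_phase1 n (N := x.size + b) (Nat.le_add_right _ _)
    ((hO' none).mono (by omega)), PMF.bind_map]
  refine (key A.phase1 none none ([], .nil, .nil) ([], .nil, .nil) x rfl).bind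
    fun out _ out' _ hout => ?_
  rw [attackSnd]
  split_ifs with hflag
  · refine Coupled.of_forall fun r hr a _ => Or.inl ?_
    rw [PMF.support_pure, Set.mem_singleton_iff] at hr
    subst hr
    exact hflag
  · obtain ⟨h₁, h₂⟩ := (hout.resolve_left hflag).resolve_left id
    rw [stdOracles_sign, PMF.bind_map, h₁]
    refine Coupled.bind_same fun sig _ => ?_
    set y := Data.ofList [.ofNat κ, (appendLog out').1.snd, sig] with hy
    rw [A.runWith_withoutVerification_phase2 n (N := y.size + b) (Nat.le_add_right _ _)
      ((hO' _).mono (by omega)), PMF.map_comp]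
    refine (key A.phase2 (some sig) (some sig) _ _ _ ?_).map_right fun a _ r _ har => ?_
    · exact h₂
    · exact har.imp id fun h => (h.resolve_left id).1

end Games

/-! ### Unjustified accepted queries are forgeries -/

section Forgery

variable {D : Scheme} {κ n : ℕ} {params : Data} {K : Fin (n + 1) → KeyPair}

/-- The final step of the unforgeability game. -/
def checkForgery (D : Scheme) (κ : ℕ) (params : Data) (K : Fin (n + 1) → KeyPair)
    (out : Data × Log n) : PMF Bool :=
  match out.1 with
  | .cons m (.cons sig (.cons s v)) =>
    match s.toParty? n, v.toParty? n with
    | some s, some v =>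
      (D.verify κ params (K v) (K s).pk m sig).map fun b =>
        decide (b = Data.ofNat 1 ∧ (⟨m, sig, s, v⟩ : Signed n) ∉ out.2)
    | _, _ => PMF.pure false
  | _ => PMF.pure false

theorem ufGame_eq (D : Scheme) (B : PPT OracleName) (κ n : ℕ) : ufGame D B κ n =
    (D.setup κ).bind fun params => (iid (D.keyGen κ params) (n + 1)).bind fun K =>
      (B.runWith (D.stdOracles κ params K none) []
        (.ofList (.ofNat κ :: params :: pubKeys K))).bind (checkForgery D κ params K) := rfl

/-- The probability that the recorded query is a successful forgery. -/
def winProb (D : Scheme) (κ : ℕ) (params : Data) (K : Fin (n + 1) → KeyPair)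
    (st : Log n × Data × Data) : ℝ≥0∞ :=
  checkForgery D κ params K (st.2.2, st.1) true

/-- Everything that was signed or simulated is in the log, or is the challenge. -/
def IsComplete (chal : Data) (st : Log n × Data × Data) : Prop :=
  ∀ t ∈ st.1, (Data.cons t.sig (.cons t.m (.cons (.ofNat t.s) (.ofNat t.v)))).mem st.2.1 = true ∨
    Data.cons .nil t.sig = chal

open Classical in
/-- The potential that bounds the probability of forgeries from below. -/
def potential (D : Scheme) (κ : ℕ) (params : Data) (K : Fin (n + 1) → KeyPair) (ε : ℝ≥0∞)
    (chal : Data) (st : Log n × Data × Data) : ℝ≥0∞ :=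
  -- The value `0` at incomplete states makes the inequalities trivial there, so completeness need
  -- not be carried along as an invariant of runs.
  if st.2.2.isTrue = true then winProb D κ params K st else if IsComplete chal st then ε else 0

theorem winProb_of_not_mem {log : Log n} {d m sig : Data} {i j : Fin (n + 1)}
    (h : (⟨m, sig, i, j⟩ : Signed n) ∉ log) :
    winProb D κ params K (log, d, .cons m (.cons sig (.cons (.ofNat i) (.ofNat j)))) =
      D.verify κ params (K j) (K i).pk m sig (.ofNat 1) := by
  simp only [winProb, checkForgery, Data.toParty?_ofNat]
  rw [apply_eq_expect, apply_eq_expect, expect_map]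
  simp [h]

theorem potential_of_complete {ε : ℝ≥0∞} {chal : Data} {st : Log n × Data × Data}
    (h : ¬ st.2.2.isTrue = true) (hc : IsComplete chal st) :
    potential D κ params K ε chal st = ε := by
  rw [potential, if_neg h, if_pos hc]

/-- Here `μ` is the law of a verdict and `a` is acceptance. With probability `μ a` the potential `ε`
is exchanged for `μ a`, the chance that fresh coins accept again. This is no loss if `μ a ≥ ε`;
otherwise at most `ε` is lost, with probability at most `ε`. -/
theorem le_expect_add_sq {α : Type} [DecidableEq α] (μ : PMF α) (a : α) (ε : ℝ≥0∞) :
    ε ≤ expect μ (fun b => if b = a then μ a else ε) + ε * ε := by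
  rcases le_total ε (μ a) with h | h
  · refine le_add_right ?_
    rw [← expect_const μ ε]
    refine expect_mono fun b _ => ?_
    rw [expect_const]
    split_ifs
    · exact h
    · exact le_rfl
  · calc ε = expect μ fun b => (if b = a then 0 else ε) + ε * (if b = a then 1 else 0) := by
          rw [← expect_const μ ε]
          refine expect_congr fun b _ => ?_
          rw [expect_const]
          split_ifs <;> simp
      _ = expect μ (fun b => if b = a then 0 else ε) + ε * μ a := by
          rw [expect_add, expect_const_mul, ← apply_eq_expect]
      _ ≤ _ := by
          gcongr
          refine expect_mono fun b _ => ?_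
          split_ifs
          · exact zero_le
          · exact le_rfl

/-- Only an unlogged admissible verification query can lower the potential. By completeness such a
query is absent from the log of the game, so once recorded it wins exactly when it is accepted
again. -/
theorem potential_le (hD : D.IsCorrect) (hK : ∀ i, D.Valid κ params (K i)) (ε : ℝ≥0∞)
    (ch : Option Data) (o : OracleName) (st : Log n × Data × Data) (q : Data) :
    potential D κ params K ε (challengeData ch) st ≤
      expect (logOracles n (challengeData ch) (D.stdOracles κ params K none) o st q)
        (fun as => potential D κ params K ε (challengeData ch) as.2) + ε * ε := by
  by_cases hflag : st.2.2.isTrue = true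
  · rw [logOracles_of_isTrue o q hflag, expect_pure]
    exact le_add_right le_rfl
  by_cases hc : IsComplete (challengeData ch) st
  swap
  · rw [potential, if_neg hflag, if_neg hc]
    exact zero_le
  by_cases ho : o = .veri
  · subst ho
    rw [logOracles_veri q hflag]
    split_ifs with hadm hmem
    · rw [expect_pure]
      exact le_add_right le_rfl
    · obtain ⟨m, sig, i, j, rfl, hch⟩ := admissible_iff.1 hadm
      rw [stdOracles_veri none _ m sig i j (by simp), PMF.map_comp, expect_map,
        potential_of_complete hflag hc]
      refine (le_expect_add_sq (D.verify κ params (K j) (K i).pk m sig) (.ofNat 1) ε).trans ?_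
      gcongr
      refine expect_mono fun b _ => ?_
      dsimp only [Function.comp]
      by_cases hb : b = .ofNat 1
      · rw [if_pos hb, if_pos hb, potential, if_pos (by rfl), winProb_of_not_mem]
        intro hin
        -- Either the entry is in the kept log, against `hmem`, or its signature is the challenge,
        -- against admissibility.
        rcases hc _ hin with h | h
        · exact hmem h
        · exact hch ((cons_nil_eq_challengeData _ _).1 h)
      · rw [if_neg hb, if_neg hb]
        exact (potential_of_complete (st := (st.1, st.2.1, st.2.2)) hflag hc).ge
    · rw [expect_pure]
      exact le_add_right le_rfl
  · obtain ⟨μ, g, hμ, -, hg⟩ := exists_stdOracles_eq_map hD hK ho q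
    rw [logOracles_of_ne_veri ho q hflag, hμ, PMF.map_comp, expect_map,
      potential_of_complete hflag hc]
    refine le_add_right ?_
    rw [← expect_const μ ε]
    refine expect_mono fun a _ => ?_
    rw [expect_const]
    refine (potential_of_complete (st := (g a st.1, .cons (.cons a q) st.2.1, st.2.2)) hflag
      fun t ht => ?_).ge
    rcases hg a st.1 t ht with ht | ⟨rfl, hq⟩
    · refine (hc t ht).imp_left fun h => ?_
      simp [Data.mem, h]
    · left
      simp [Data.mem, hq]

/-- The outcome of an attack in which a query was recorded. -/
def recorded {S : Type} (res : Data × S × Data × Data) : ℝ≥0∞ :=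
  if res.2.2.2.isTrue = true then 1 else 0

/-- The potential starts at `ε` and loses at most `ε²` per query. At the end it is the winning
probability where a query was recorded and at most `ε` elsewhere; the missing `ε` on recorded
outcomes is what the left side measures. -/
theorem mul_expect_recorded_le (hD : D.IsCorrect) (hK : ∀ i, D.Valid κ params (K i))
    {ε : ℝ≥0∞} (hε : ε ≠ ⊤) {A : PrivacyAdversary} {c : Fin (n + 1)} {x : Data} {t₁ t₂ : ℕ}
    (h₁ : A.phase1.prog.HaltsIn (logOracles n .nil (D.stdOracles κ params K none))
      ([], .nil, .nil) x t₁)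
    (h₂ : ∀ m : Data, m.size ≤ x.size + t₁ → ∀ sig : Data,
      sig ∈ (D.sign κ params (K c) (K (Fin.last n)).pk m.fst).support →
      ∀ st, A.phase2.prog.HaltsIn (logOracles n (.cons .nil sig) (D.stdOracles κ params K none))
        st (.ofList [x.fst, m.snd, sig]) t₂) :
    ε * expect (attack (D.stdOracles κ params K none) n c A.phase1.prog A.phase2.prog [] x)
        recorded ≤
      expect (attack (D.stdOracles κ params K none) n c A.phase1.prog A.phase2.prog [] x)
        (fun res => winProb D κ params K res.2) + ε * ε * (t₁ + t₂ : ℕ) := by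
  set μ := attack (D.stdOracles κ params K none) n c A.phase1.prog A.phase2.prog [] x with hμ
  have key : ε ≤ expect μ (fun res => if res.2.2.2.isTrue = true then winProb D κ params K res.2
      else ε) + ε * ε * (t₁ + t₂ : ℕ) := by
    have s₁ := h₁.le_expect_output (h := potential D κ params K ε .nil) (δ := ε * ε)
      (potential_le hD hK ε none)
    rw [potential_of_complete (st := ([], Data.nil, Data.nil)) (by simp [Data.isTrue])
      (fun t ht => by simp at ht)] at s₁
    rw [hμ, attack, expect_bind, Nat.cast_add, mul_add, add_comm (ε * ε * (t₁ : ℝ≥0∞)), ← add_assoc,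
      ← expect_const (A.phase1.prog.output _ _ _) (ε * ε * (t₂ : ℝ≥0∞)), ← expect_add]
    refine s₁.trans (add_le_add_left (expect_mono fun out hout => ?_) _)
    have hsz := h₁.size_output_le hout
    rw [attackSnd]
    by_cases hflag : out.2.2.2.isTrue = true
    · rw [if_pos hflag, expect_pure, if_pos hflag, potential, if_pos hflag]
      exact le_add_right le_rfl
    · rw [if_neg hflag]
      by_cases hc : IsComplete .nil out.2
      swap
      · rw [potential, if_neg hflag, if_neg hc]
        exact zero_le
      rw [potential_of_complete hflag hc, stdOracles_sign, PMF.bind_map, expect_bind,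
        ← expect_const (D.sign κ params (K c) (K (Fin.last n)).pk out.1.fst)
          (ε * ε * (t₂ : ℝ≥0∞)), ← expect_add,
        ← expect_const (D.sign κ params (K c) (K (Fin.last n)).pk out.1.fst) ε]
      refine expect_mono fun sig hsig => ?_
      rw [expect_const]
      have s₂ := (h₂ out.1 hsz sig hsig
        (⟨out.1.fst, sig, c, Fin.last n⟩ :: out.2.1, out.2.2.1, out.2.2.2)).le_expect_output
        (h := potential D κ params K ε (.cons .nil sig)) (δ := ε * ε)
        (potential_le hD hK ε (some sig))
      rw [potential_of_complete (D := D) (by exact hflag)] at s₂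
      · refine s₂.trans (add_le_add_left (expect_mono fun res _ => ?_) _)
        rw [potential]
        split_ifs
        · exact le_rfl
        · exact le_rfl
        · exact zero_le
      -- Between the phases the challenge enters the log of the game only; `IsComplete` with the new
      -- challenge permits just this entry.
      · intro t ht
        rcases List.mem_cons.1 ht with rfl | ht
        · exact Or.inr rfl
        · exact (hc t ht).imp_right fun h => absurd h (by simp)
  -- Adding `ε * recorded` to `key` brings the integrand to at most `ε + winProb` on every outcome;
  -- then `ε ≠ ⊤` is cancelled.
  have key₂ : ε + ε * expect μ recorded ≤
      ε + (expect μ (fun res => winProb D κ params K res.2) + ε * ε * (t₁ + t₂ : ℕ)) := by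
    calc ε + ε * expect μ recorded
        ≤ expect μ (fun res => if res.2.2.2.isTrue = true then winProb D κ params K res.2
            else ε) + ε * ε * (t₁ + t₂ : ℕ) + ε * expect μ recorded := by gcongr
      _ = expect μ (fun res => (if res.2.2.2.isTrue = true then winProb D κ params K res.2
            else ε) + ε * recorded res) + ε * ε * (t₁ + t₂ : ℕ) := by
          rw [expect_add, expect_const_mul]
          ring
      _ ≤ expect μ (fun res => ε + winProb D κ params K res.2) + ε * ε * (t₁ + t₂ : ℕ) := by
          gcongr
          refine expect_mono fun res _ => ?_
          rw [recorded]
          split_ifs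
          · rw [mul_one, add_comm]
          · simp
      _ = _ := by
          rw [expect_add, expect_const, add_assoc]
  exact (ENNReal.add_le_add_iff_left hε).1 key₂

end Forgery

/-! ### Polynomial bounds -/

/-- A bound for the length of the output. -/
def PPT.outSize (M : PPT Empty) : Polynomial ℕ := Polynomial.X + M.time 0

theorem PPT.size_le_of_mem_run (M : PPT Empty) {N : ℕ} {x : List Data}
    (hx : (Data.ofList x).size ≤ N) {d : Data} (hd : d ∈ (M.run x).support) :
    d.size ≤ M.outSize.eval N := by
  rw [PPT.run, PMF.mem_support_map_iff] at hd
  obtain ⟨out, hout, rfl⟩ := hd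
  have := (M.haltsIn (S := Unit) (l := 0) hx (O := fun o => o.elim) (fun o => o.elim)
    ()).size_output_le hout
  simp only [PPT.outSize, Polynomial.eval_add, Polynomial.eval_X]
  omega

theorem mem_support_of_mem_iid {α : Type} {p : PMF α} : ∀ {k : ℕ} {f : Fin k → α},
    f ∈ (iid p k).support → ∀ i, f i ∈ p.support
  | 0, _, _, i => i.elim0
  | k + 1, f, hf, i => by
    simp only [iid, PMF.mem_support_bind_iff, PMF.support_pure, Set.mem_singleton_iff] at hf
    obtain ⟨a, ha, g, hg, rfl⟩ := hf
    refine Fin.cases ?_ (fun i => ?_) i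
    · simpa using ha
    · simpa using mem_support_of_mem_iid hg i

theorem size_ofList_le {b : ℕ} : ∀ {L : List Data}, (∀ d ∈ L, d.size ≤ b) →
    (Data.ofList L).size ≤ L.length * (b + 1) + 1
  | [], _ => by simp [Data.ofList, Data.size]
  | a :: L, h => by
    have h₁ := h a (by simp)
    have h₂ := size_ofList_le fun d hd => h d (List.mem_cons_of_mem a hd)
    simp only [Data.ofList, Data.size, List.length_cons]
    nlinarith

/-- Parameters and keys that can occur in the games, of length at most `b`. -/
structure IsSetup (D : Scheme) (κ : ℕ) {n : ℕ} (params : Data) (K : Fin (n + 1) → KeyPair)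
    (b : ℕ) : Prop where
  valid : ∀ i, D.Valid κ params (K i)
  size_param : (Data.ofNat κ).size ≤ b
  size_params : params.size ≤ b
  size_pk : ∀ i, (K i).pk.size ≤ b
  size_sk : ∀ i, (K i).sk.size ≤ b
  size_input : (Data.ofList (.ofNat κ :: params :: pubKeys K)).size ≤ b

open Polynomial in
theorem exists_isSetup (D : Scheme) (n : ℕ) : ∃ b : Polynomial ℕ, ∀ κ, ∀ params ∈ (D.setup κ).support,
    ∀ K ∈ (iid (D.keyGen κ params) (n + 1)).support, IsSetup D κ params K (b.eval κ) := by
  -- `2 * κ + 3` is the size of the list `[1^κ]`, and `2 * κ + P + 4` bounds that of `[1^κ,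
  -- params]`.
  set P := D.setupAlg.outSize.comp (2 * X + 3) with hP
  set G := D.keyGenAlg.outSize.comp (2 * X + P + 4) with hG
  refine ⟨2 * X + 1 + P + G + ((n : ℕ[X]) + 3) * (2 * X + 1 + P + G + 1) + 1,
    fun κ params hparams K hK => ?_⟩
  have hp : params.size ≤ P.eval κ := by
    have := D.setupAlg.size_le_of_mem_run (N := 2 * κ + 3)
      (by simp [Data.ofList, Data.size, Data.size_ofNat]) hparams
    simpa [hP] using this
  have hk : ∀ i, (K i).pk.size ≤ G.eval κ ∧ (K i).sk.size ≤ G.eval κ := by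
    intro i
    have := mem_support_of_mem_iid hK i
    rw [Algorithms.keyGen, PMF.mem_support_map_iff] at this
    obtain ⟨d, hd, hdK⟩ := this
    have hsz := D.keyGenAlg.size_le_of_mem_run (N := 2 * κ + P.eval κ + 4)
      (by simp only [Data.ofList, Data.size, Data.size_ofNat]; omega) hd
    have hsz' : d.size ≤ G.eval κ := by simpa [hG] using hsz
    rw [← hdK]
    exact ⟨d.size_fst_le.trans hsz', d.size_snd_le.trans hsz'⟩
  have hin := size_ofList_le (b := 2 * κ + 1 + P.eval κ + G.eval κ)
    (L := .ofNat κ :: params :: pubKeys K) (by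
      intro d hd
      simp only [List.mem_cons, pubKeys, List.mem_ofFn] at hd
      rcases hd with rfl | rfl | ⟨i, rfl⟩
      · rw [Data.size_ofNat]; omega
      · omega
      · have := (hk i).1; omega)
  have hev : (2 * X + 1 + P + G + ((n : ℕ[X]) + 3) * (2 * X + 1 + P + G + 1) + 1).eval κ =
      2 * κ + 1 + P.eval κ + G.eval κ +
        (n + 3) * (2 * κ + 1 + P.eval κ + G.eval κ + 1) + 1 := by simp
  simp only [List.length_cons, pubKeys, List.length_ofFn] at hin
  rw [hev]
  refine ⟨fun i => ⟨hparams, mem_support_of_mem_iid hK i⟩, ?_, by omega, fun i => ?_, fun i => ?_,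
    ?_⟩
  · rw [Data.size_ofNat]; omega
  · have := (hk i).1; omega
  · have := (hk i).2; omega
  · rw [pubKeys]
    have : n + 1 + 1 + 1 = n + 3 := rfl
    rw [this] at hin
    omega

open Polynomial in
/-- A bound for the length of the answers of the oracles. -/
def Scheme.answerSize (D : Scheme) : Polynomial ℕ :=
  -- The summand `1` is for `⊥`. With `X` the setup bound plus the query length, `6 * X + 20` bounds
  -- an input made of five setup items and the query.
  1 + (D.signAlg.outSize + D.simulateAlg.outSize + D.verifyAlg.outSize).comp (6 * X + 20)

section Sizes

variable {D : Scheme} {κ n : ℕ} {params : Data} {K : Fin (n + 1) → KeyPair} {b : ℕ}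

theorem IsSetup.size_sign (h : IsSetup D κ params K b) {i j : Fin (n + 1)} {m sig : Data}
    {N : ℕ} (hm : m.size ≤ N) (hsig : sig ∈ (D.sign κ params (K i) (K j).pk m).support) :
    sig.size ≤ D.answerSize.eval (b + N) := by
  have h1 := h.size_param
  have h2 := h.size_params
  have h3 := h.size_pk i
  have h4 := h.size_sk i
  have h5 := h.size_pk j
  have := D.signAlg.size_le_of_mem_run (N := 6 * (b + N) + 20)
    (by simp only [Data.ofList, Data.size]; omega) hsig
  simp only [Scheme.answerSize, Polynomial.eval_add, Polynomial.eval_comp, Polynomial.eval_mul,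
    Polynomial.eval_X, Polynomial.eval_ofNat, Polynomial.eval_one]
  omega

theorem IsSetup.boundedBy (h : IsSetup D κ params K b) (ch : Option Data) :
    BoundedBy (D.stdOracles κ params K ch) D.answerSize b := by
  intro o log q as has
  have h1 := h.size_param
  have h2 := h.size_params
  have hev : D.answerSize.eval (b + q.size) = 1 + (D.signAlg.outSize.eval (6 * (b + q.size) + 20) +
      D.simulateAlg.outSize.eval (6 * (b + q.size) + 20) +
      D.verifyAlg.outSize.eval (6 * (b + q.size) + 20)) := by
    simp [Scheme.answerSize]
  have hbot : ∀ as ∈ (PMF.pure (Data.bot, log)).support,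
      as.1.size ≤ D.answerSize.eval (b + q.size) := by
    intro as has
    rw [PMF.support_pure, Set.mem_singleton_iff] at has
    subst has
    rw [hev]
    simp only [Data.size]
    omega
  cases o with
  | sign =>
    simp only [Scheme.stdOracles] at has
    unfold Scheme.signOracle at has
    split at has
    · split at has
      · rename_i m s v _ _ i j hi hj
        rw [PMF.mem_support_map_iff] at has
        obtain ⟨a, ha, rfl⟩ := has
        exact h.size_sign (by simp only [Data.size]; omega) ha
      · exact hbot _ has
    · exact hbot _ has
  | sim =>
    simp only [Scheme.stdOracles] at has
    unfold Scheme.simOracle at has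
    split at has
    · split at has
      · rename_i m s v _ _ i j hi hj
        rw [PMF.mem_support_map_iff] at has
        obtain ⟨a, ha, rfl⟩ := has
        have h3 := h.size_pk i
        have h4 := h.size_sk j
        have h5 := h.size_pk j
        have := D.simulateAlg.size_le_of_mem_run
          (N := 6 * (b + (Data.cons m (.cons s v)).size) + 20)
          (by simp only [Data.ofList, Data.size]; omega) ha
        rw [hev]
        dsimp only
        omega
      · exact hbot _ has
    · exact hbot _ has
  | veri =>
    simp only [Scheme.stdOracles] at has
    unfold Scheme.veriOracle at has
    split at has
    · split at has
      · rename_i m sig s v _ _ i j hi hj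
        split_ifs at has
        · exact hbot _ has
        · rw [PMF.mem_support_map_iff] at has
          obtain ⟨a, ha, rfl⟩ := has
          have h3 := h.size_pk i
          have h4 := h.size_sk j
          have h5 := h.size_pk j
          have := D.verifyAlg.size_le_of_mem_run
            (N := 6 * (b + (Data.cons m (.cons sig (.cons s v))).size) + 20)
            (by simp only [Data.ofList, Data.size]; omega) ha
          rw [hev]
          dsimp only
          omega
      · exact hbot _ has
    · exact hbot _ has

theorem IsSetup.boundedBy_noVeri (h : IsSetup D κ params K b) (ch : Option Data) :
    BoundedBy (D.stdOraclesNoVeri κ params K ch) D.answerSize b := by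
  intro o log q as has
  by_cases ho : o = .veri
  · subst ho
    simp only [Scheme.stdOraclesNoVeri, PMF.support_pure, Set.mem_singleton_iff] at has
    subst has
    simp [Scheme.answerSize, Data.size]
  · rw [stdOraclesNoVeri_eq ho ch none] at has
    exact h.boundedBy none o log q as has

end Sizes

/-! ### Negligible functions -/

/-- The leading term is positive; `κ = 0` has to be avoided because of polynomials such as `X`. -/
theorem eval_pos {p : Polynomial ℕ} (hp : p ≠ 0) {κ : ℕ} (hκ : 1 ≤ κ) : 0 < p.eval κ := by
  rw [Polynomial.eval_eq_sum_range]
  refine lt_of_lt_of_le ?_ (Finset.single_le_sum (f := fun i => p.coeff i * κ ^ i)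
    (fun _ _ => Nat.zero_le _) (Finset.self_mem_range_succ p.natDegree))
  exact Nat.mul_pos (Nat.pos_of_ne_zero (Polynomial.leadingCoeff_ne_zero.2 hp)) (by positivity)

theorem IsNegligible.add {f g : ℕ → ℝ} (hf : IsNegligible f) (hg : IsNegligible g) :
    IsNegligible fun κ => f κ + g κ := by
  intro p hp
  obtain ⟨a, ha⟩ := hf (2 * p) (mul_ne_zero two_ne_zero hp)
  obtain ⟨b, hb⟩ := hg (2 * p) (mul_ne_zero two_ne_zero hp)
  refine ⟨max a b, fun κ hκ => ?_⟩
  have h₁ := ha κ (le_of_max_le_left hκ)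
  have h₂ := hb κ (le_of_max_le_right hκ)
  have e : (((2 * p).eval κ : ℕ) : ℝ) = 2 * (p.eval κ : ℕ) := by simp
  rw [e] at h₁ h₂
  calc f κ + g κ < 1 / (2 * (p.eval κ : ℕ)) + 1 / (2 * (p.eval κ : ℕ)) := add_lt_add h₁ h₂
    _ = 1 / (p.eval κ : ℕ) := by ring

theorem IsNegligible.mono {f g : ℕ → ℝ} (hg : IsNegligible g) (h : ∀ κ, f κ ≤ g κ) :
    IsNegligible f := fun p hp =>
  (hg p hp).imp fun _ ha κ hκ => (h κ).trans_lt (ha κ hκ)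

/-- A function is negligible if it is at most `g / ε + ε * T` for all `ε`, where `g` is negligible
and `T` is a polynomial. -/
theorem IsNegligible.of_mul_le {f g : ℕ → ℝ} (hg : IsNegligible g) (T : Polynomial ℕ)
    (h : ∀ κ, ∀ ε : ℝ, 0 < ε → ε * f κ ≤ g κ + ε * ε * (T.eval κ : ℕ)) : IsNegligible f := by
  intro p hp
  have hT : T + 1 ≠ 0 := fun h => by
    have := congrArg (Polynomial.eval 0) h
    simp at this
  -- With `ε = 1 / (2 * P * (t + 1))`, both `g` and `ε² * t` are to stay below `ε / (2 * P) = 1 / (4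
  -- * P² * (t + 1))`. The `+ 1` guards against `T = 0`.
  obtain ⟨a, ha⟩ := hg (2 * 2 * (p * p * (T + 1)))
    (mul_ne_zero (mul_ne_zero two_ne_zero two_ne_zero) (mul_ne_zero (mul_ne_zero hp hp) hT))
  refine ⟨max a 1, fun κ hκ => ?_⟩
  have hP : (0 : ℝ) < (p.eval κ : ℕ) := by
    exact_mod_cast eval_pos hp (le_of_max_le_right hκ)
  have h₁ := ha κ (le_of_max_le_left hκ)
  have e : (((2 * 2 * (p * p * (T + 1))).eval κ : ℕ) : ℝ) =
      4 * ((p.eval κ : ℕ) * (p.eval κ : ℕ) * ((T.eval κ : ℕ) + 1)) := by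
    simp only [Polynomial.eval_mul, Polynomial.eval_add, Polynomial.eval_one,
      Polynomial.eval_ofNat]
    push_cast
    ring
  rw [e] at h₁
  set P : ℝ := ((p.eval κ : ℕ) : ℝ)
  set t : ℝ := ((T.eval κ : ℕ) : ℝ)
  have ht : 0 ≤ t := Nat.cast_nonneg _
  have h₂ := h κ (1 / (2 * P * (t + 1))) (by positivity)
  have h₃ : 1 / (2 * P * (t + 1)) * (1 / (2 * P * (t + 1))) * t ≤
      1 / (4 * (P * P * (t + 1))) := by
    rw [div_mul_div_comm, div_mul_eq_mul_div, div_le_div_iff₀ (by positivity) (by positivity)]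
    nlinarith [mul_nonneg (mul_pos hP hP).le ht, mul_pos hP hP]
  have h₄ : 1 / (2 * P * (t + 1)) * f κ < 1 / (2 * P * (t + 1)) * (1 / P) := by
    calc _ < 1 / (4 * (P * P * (t + 1))) + 1 / (4 * (P * P * (t + 1))) := by linarith
      _ = _ := by field_simp; ring
  exact lt_of_mul_lt_mul_left h₄ (by positivity)

/-! ### The reduction -/

section Reduction

variable {D : Scheme} {κ n : ℕ}

section Fixed

variable {params : Data} {K : Fin (n + 1) → KeyPair} {b : ℕ}

/-- The comparison passes through the event that the hybrid outputs `y` with nothing recorded. One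
direction is enough, since the advantage is defined without absolute value. -/
theorem IsSetup.fixedGame_le (h : IsSetup D κ params K b) (hD : D.IsCorrect)
    (A : PrivacyAdversary) (c : Fin (n + 1)) (y : Data) :
    fixedGame D A (fun D κ _ params K ch => D.stdOracles κ params K ch) κ params K c y ≤
      fixedGame D (A.withoutVerification n)
        (fun D κ _ params K ch => D.stdOraclesNoVeri κ params K ch) κ params K c y +
      expect (attack (D.stdOracles κ params K none) n c A.phase1.prog A.phase2.prog []
        (.ofList (.ofNat κ :: params :: pubKeys K))) recorded := by
  rw [apply_eq_expect]
  refine (fixedGame_coupled_attack hD h.valid h.boundedBy A c _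
    (fun res => (if ¬ res.2.2.2.isTrue = true ∧ res.1 = y then 1 else 0) + recorded res)
    ?_).trans ?_
  · rintro a res hres
    rw [recorded]
    by_cases hflag : res.2.2.2.isTrue = true
    · rw [if_pos hflag]
      split_ifs <;> simp
    · obtain rfl := hres.resolve_left hflag
      simp [hflag]
  · rw [expect_add]
    gcongr
    rw [apply_eq_expect]
    refine attack_coupled_fixedGame hD h.valid h.boundedBy h.boundedBy_noVeri A c _ _
      fun res a hres => ?_
    split_ifs with h₁ h₂
    · exact le_rfl
    · exact absurd ((hres.resolve_left h₁.1).symm.trans h₁.2) h₂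
    · exact zero_le
    · exact le_rfl

open Polynomial in
/-- A bound for the number of oracle queries of a privacy adversary. -/
def PrivacyAdversary.attackTime (A : PrivacyAdversary) (D : Scheme) : Polynomial ℕ :=
  A.phase1.time (D.answerSize + 3) +
    (A.phase2.time (D.answerSize + 3)).comp (2 * X + A.phase1.time (D.answerSize + 3) +
      D.answerSize.comp (2 * X + A.phase1.time (D.answerSize + 3)) + 4)

/-- By its implementation, the forger outputs the recorded query of `attack` together with the log
of the game; so its chance of winning is exactly the expectation of `winProb`. -/
theorem IsSetup.mul_expect_recorded_le (h : IsSetup D κ params K b) (hD : D.IsCorrect)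
    (A : PrivacyAdversary) (c : Fin (n + 1)) {ε : ℝ≥0∞} (hε : ε ≠ ⊤) :
    ε * expect (attack (D.stdOracles κ params K none) n c A.phase1.prog A.phase2.prog []
        (.ofList (.ofNat κ :: params :: pubKeys K))) recorded ≤
      ((A.forger n c).runWith (D.stdOracles κ params K none) []
        (.ofList (.ofNat κ :: params :: pubKeys K))).bind (checkForgery D κ params K) true +
      ε * ε * ((A.attackTime D).eval b : ℕ) := by
  set x := Data.ofList (.ofNat κ :: params :: pubKeys K) with hx
  set t₁ := (A.phase1.time (D.answerSize + 3)).eval b with ht₁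
  set N := 2 * b + t₁ + D.answerSize.eval (2 * b + t₁) + 4 with hN
  have hT : (A.attackTime D).eval b = t₁ + (A.phase2.time (D.answerSize + 3)).eval N := by
    simp [PrivacyAdversary.attackTime, hN, ht₁]
  have := DesignatedVerifier.mul_expect_recorded_le (A := A) (c := c) (x := x) hD h.valid hε
    (A.phase1.haltsIn_logOracles h.size_input (h.boundedBy none) n .nil ([], .nil, .nil))
    (t₂ := (A.phase2.time (D.answerSize + 3)).eval N) fun m hm sig hsig st => by
      have hx₀ : x.size ≤ b := h.size_input
      have hmb : m.size ≤ b + t₁ := by omega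
      refine A.phase2.haltsIn_logOracles ?_ ((h.boundedBy none).mono (by omega)) n _ st
      have h₁ := h.size_sign ((Data.size_fst_le m).trans hmb) hsig
      have e : b + (b + t₁) = 2 * b + t₁ := by omega
      rw [e] at h₁
      have h₂ : x.fst.size ≤ b := h.size_param
      have h₃ := (Data.size_snd_le m).trans hmb
      simp only [Data.ofList, Data.size]
      omega
  rw [hT]
  convert this using 2
  rw [A.runWith_forger n c h.size_input (h.boundedBy none), PMF.bind_map, apply_eq_expect,
    expect_bind]
  exact expect_congr fun res _ => (apply_eq_expect _ _).symm

end Fixed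

/-- The probability that a privacy adversary submits a forgery. -/
def forgeryProb (D : Scheme) (A : PrivacyAdversary) (κ n : ℕ) (c : Fin (n + 1)) : ℝ≥0∞ :=
  expect (D.setup κ) fun params => expect (iid (D.keyGen κ params) (n + 1)) fun K =>
    expect (attack (D.stdOracles κ params K none) n c A.phase1.prog A.phase2.prog []
      (.ofList (.ofNat κ :: params :: pubKeys K))) recorded

theorem psiGame_eq (D : Scheme) (A : PrivacyAdversary) (O : OracleFamily) (κ n : ℕ)
    (c : Fin (n + 1)) : psiGame D A O κ n c = (D.setup κ).bind fun params =>
      (iid (D.keyGen κ params) (n + 1)).bind fun K => fixedGame D A O κ params K c := rfl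

theorem bind_apply_eq_expect {α β : Type} (μ : PMF α) (F : α → PMF β) (y : β) :
    μ.bind F y = expect μ fun a => F a y := rfl

theorem psiGame_le (hD : D.IsCorrect) (A : PrivacyAdversary) (c : Fin (n + 1)) (y : Data) :
    psiGame D A (fun D κ _ params K ch => D.stdOracles κ params K ch) κ n c y ≤
      psiGame D (A.withoutVerification n)
        (fun D κ _ params K ch => D.stdOraclesNoVeri κ params K ch) κ n c y +
      forgeryProb D A κ n c := by
  obtain ⟨b, hb⟩ := exists_isSetup D n
  rw [psiGame_eq, psiGame_eq, bind_apply_eq_expect, bind_apply_eq_expect, forgeryProb, ← expect_add]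
  refine expect_mono fun params hparams => ?_
  rw [bind_apply_eq_expect, bind_apply_eq_expect, ← expect_add]
  exact expect_mono fun K hK => (hb κ params hparams K hK).fixedGame_le hD A c y

theorem forgeryProb_le_one (A : PrivacyAdversary) (c : Fin (n + 1)) :
    forgeryProb D A κ n c ≤ 1 := by
  have h : ∀ {α : Type} (μ : PMF α) {f : α → ℝ≥0∞}, (∀ a, f a ≤ 1) → expect μ f ≤ 1 :=
    fun μ f hf => (expect_mono fun a _ => hf a).trans (expect_const μ 1).le
  refine h _ fun params => h _ fun K => h _ fun res => ?_
  rw [recorded]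
  split_ifs <;> simp

/-- For a fixed `ε` the inequality survives averaging over parameters and keys, with one polynomial
bound for all of them; `ε` is chosen only afterwards, depending on `κ` alone. -/
theorem isNegligible_forgeryProb (hD : D.IsCorrect) (hU : D.IsStronglyUnforgeable n)
    (A : PrivacyAdversary) (c : Fin (n + 1)) :
    IsNegligible fun κ => (forgeryProb D A κ n c).toReal := by
  obtain ⟨b, hb⟩ := exists_isSetup D n
  refine (hU (A.forger n c)).of_mul_le ((A.attackTime D).comp b) fun κ ε hε => ?_
  have key : ENNReal.ofReal ε * forgeryProb D A κ n c ≤ ufGame D (A.forger n c) κ n true +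
      ENNReal.ofReal ε * ENNReal.ofReal ε * (((A.attackTime D).comp b).eval κ : ℕ) := by
    rw [Polynomial.eval_comp, ufGame_eq, bind_apply_eq_expect, forgeryProb, ← expect_const_mul,
      ← expect_const (D.setup κ) (ENNReal.ofReal ε * ENNReal.ofReal ε * _), ← expect_add]
    refine expect_mono fun params hparams => ?_
    rw [bind_apply_eq_expect, ← expect_const_mul,
      ← expect_const (iid (D.keyGen κ params) (n + 1))
        (ENNReal.ofReal ε * ENNReal.ofReal ε * _), ← expect_add]
    refine expect_mono fun K hK => ?_
    exact (hb κ params hparams K hK).mul_expect_recorded_le hD A c ENNReal.ofReal_ne_top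
  have hne : ENNReal.ofReal ε * ENNReal.ofReal ε * (((A.attackTime D).comp b).eval κ : ℕ) ≠ ⊤ :=
    ENNReal.mul_ne_top (ENNReal.mul_ne_top ENNReal.ofReal_ne_top ENNReal.ofReal_ne_top)
      (ENNReal.natCast_ne_top _)
  have := ENNReal.toReal_mono (ENNReal.add_ne_top.2 ⟨PMF.apply_ne_top _ _, hne⟩) key
  rwa [ENNReal.toReal_add (PMF.apply_ne_top _ _) hne, ENNReal.toReal_mul, ENNReal.toReal_mul,
    ENNReal.toReal_mul, ENNReal.toReal_ofReal hε.le, ENNReal.toReal_natCast] at this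

theorem psiAdvantage_le (hD : D.IsCorrect) (A : PrivacyAdversary) :
    psiAdvantage D A (fun D κ _ params K ch => D.stdOracles κ params K ch) n κ ≤
      psiAdvantage D (A.withoutVerification n)
        (fun D κ _ params K ch => D.stdOraclesNoVeri κ params K ch) n κ +
      ((forgeryProb D A κ n 1).toReal + (forgeryProb D A κ n 0).toReal) := by
  have hdec : ∀ (μ : PMF Data) (y : Data), μ.map (fun a => decide (a = y)) true = μ y := by
    intro μ y
    rw [apply_eq_expect, apply_eq_expect, expect_map]
    simp
  have hfin : ∀ c, forgeryProb D A κ n c ≠ ⊤ := fun c =>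
    ((forgeryProb_le_one A c).trans_lt ENNReal.one_lt_top).ne
  rw [psiAdvantage, psiAdvantage, sub_add_eq_add_sub]
  refine sub_le_sub_right ?_ _
  rw [← ENNReal.toReal_add (hfin 1) (hfin 0), ← ENNReal.toReal_add (PMF.apply_ne_top _ _)
    (ENNReal.add_ne_top.2 ⟨hfin 1, hfin 0⟩)]
  refine ENNReal.toReal_mono (ENNReal.add_ne_top.2 ⟨PMF.apply_ne_top _ _,
    ENNReal.add_ne_top.2 ⟨hfin 1, hfin 0⟩⟩) ?_
  rw [bind_apply_eq_expect, bind_apply_eq_expect,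
    -- For either challenge bit the loss is bounded by the sum of both forgery probabilities; this
    -- is cruder than their average but also negligible.
    ← expect_const (PMF.uniformOfFintype Bool) (forgeryProb D A κ n 1 + forgeryProb D A κ n 0),
    ← expect_add]
  refine expect_mono fun c _ => ?_
  rw [hdec, hdec]
  refine (psiGame_le hD A _ _).trans (add_le_add_right ?_ _)
  split_ifs
  · exact le_self_add
  · exact le_add_self

end Reduction

end

end DesignatedVerifier

theorem mainTheorem2 (n : ℕ) (hn : 1 ≤ n) (D : DesignatedVerifier.Scheme)
    (hcorrect : D.IsCorrect)
    (hprivate : D.IsSenderPrivateWrt n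
      fun D κ _ params K challenge => D.stdOraclesNoVeri κ params K challenge)
    (hunforgeable : D.IsStronglyUnforgeable n) :
    D.IsSenderPrivate n := fun A =>
  ((hprivate (A.withoutVerification n)).add
    ((DesignatedVerifier.isNegligible_forgeryProb hcorrect hunforgeable A 1).add
      (DesignatedVerifier.isNegligible_forgeryProb hcorrect hunforgeable A 0))).mono fun _ =>
    DesignatedVerifier.psiAdvantage_le hcorrect A
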